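/- Let $\mathbb K\in\{\mathbb R,\mathbb C\}$ and let $A$ be a continuous inverse algebra over $\mathbb K$, i.e. a unital associative $\mathbb K$-algebra with a Hausdorff locally convex vector topology such that multiplication $A\times A\to A$ is continuous, the group of units $A^\times$ is open in $A$, and inversion $A^\times\to A$ is continuous. Assume: $(*)$ for each continuous seminorm $p$ on $A$ there are a continuous seminorm $q$ on $A$ and $r>0$ such that $\sum_{n=1}^\infty r^n\|\mu_n\|_{p,q}<\infty$, where $\|\mu_n\|_{p,q}:=\sup\{p(x_1x_2\cdots x_n)\colon x_1,\dots,x_n\in A,\ q(x_i)\le 1 \text{ for all } i\}\in[0,\infty]$. An evolution of a continuous curve $\gamma\colon[0,1]\to A$ is a $C^1$-curve $\eta\colon[0,1]\to A^\times$ with $\eta(0)=1$ and $\eta'(t)=\eta(t)\gamma(t)$ for all $t\in[0,1]$; it is unique if it exists, and is then denoted $\mathrm{Evol}(\gamma)$. Write $\mathrm{evol}(\gamma):=\mathrm{Evol}(\gamma)(1)$. The space $C^k([0,1],A)$ carries the topology of uniform convergence of all derivatives of order $\le k$; $\mathcal O_{C^k}$ denotes the topology induced by $C^k([0,1],A)$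 on a subspace; $C^1([0,1],A^\times)$ is the subset of $C^1([0,1],A)$ of the curves with values in $A^\times$. The group $A^\times$ is called strongly $C^k$-regular if each $\gamma\in C^k([0,1],A)$ has an evolution and $\mathrm{evol}\colon C^k([0,1],A)\to A^\times$ is smooth; it is called $C^k$-regular if each $\gamma\in C^\infty([0,1],A)$ has an evolution and $\mathrm{evol}\colon (C^\infty([0,1],A),\mathcal O_{C^k})\to A^\times$ is smooth. Here smooth means that all iterated (real) directional derivatives exist and are jointly continuous. A map is $\mathbb C$-analytic if it is continuous and locally around each point the pointwise sum of a series of continuous homogeneous polynomials; it is $\mathbb R$-analytic if it extends to a $\mathbb C$-analytic map between the complexifications, defined on an open set that contains the original domain. A curve $\gamma\colon[0,1]\to A$ is Lipschitz if $\{(\gamma(t)-\gamma(s))/(t-s)\colon s\ne t\}$ is bounded in $A$; $\mathrm{Lip}([0,1],A)$ is the space of these curves. $A$ is called Mackey-complete if every Lipschitz curve $[0,1]\to A$ has a Riemann integral in $A$. Then the following holds: (a) If $A$ is sequentially complete, then $A^\times$ is strongly $C^0$-regular, and the map $\mathrm{Evol}\colon C^0([0,1],A)\to C^1([0,1],A^\times)$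 is $\mathbb K$-analytic. (b) If $A$ is Mackey-complete, then $A^\times$ is $C^0$-regular and strongly $C^1$-regular. Moreover, each $\gamma\in\mathrm{Lip}([0,1],A)$ has an evolution $\mathrm{Evol}(\gamma)\in C^1([0,1],A^\times)$, and $\mathrm{Evol}\colon(\mathrm{Lip}([0,1],A),\mathcal O_{C^0})\to C^1([0,1],A^\times)$ is $\mathbb K$-analytic. -/

import Mathlib

open Filter Topology unitInterval

noncomputable section

namespace CIA

/-! ### Curves on the unit interval -/

section Curves

variable (𝕜 : Type*) [RCLike 𝕜] {E : Type*} [AddCommGroup E] [Module 𝕜 E] [TopologicalSpace E]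

/-- The difference quotient `(γ s - γ t) / (s - t)` of a curve on `[0,1]`. -/
def diffQuot (γ : I → E) (s t : I) : E :=
  ((((s : ℝ) - (t : ℝ) : ℝ) : 𝕜))⁻¹ • (γ s - γ t)

/-- `δ` is the derivative of the curve `γ` on `[0,1]` (one-sided at the end points). -/
def HasCurveDeriv (γ δ : I → E) : Prop :=
  ∀ t : I, Tendsto (fun s : I => diffQuot 𝕜 γ s t) (𝓝[≠] t) (𝓝 (δ t))

/-- A Lipschitz curve: the set of its difference quotients is bounded. -/
def IsLipschitzCurve (γ : I → E) : Prop :=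
  Bornology.IsVonNBounded 𝕜 {v : E | ∃ s t : I, s ≠ t ∧ v = diffQuot 𝕜 γ s t}

/-- `x` is the Riemann integral over `[0,1]` of `γ`: the limit of the Riemann sums over tagged
partitions, as the mesh tends to `0`. -/
def HasRiemannIntegral (γ : I → E) (x : E) : Prop :=
  ∀ V ∈ 𝓝 (0 : E), ∃ ε : ℝ, 0 < ε ∧
    ∀ (n : ℕ) (t : Fin (n + 1) → I) (s : Fin n → I),
      Monotone t → t 0 = 0 → t (Fin.last n) = 1 →
      (∀ i : Fin n, t i.castSucc ≤ s i ∧ s i ≤ t i.succ) →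
      (∀ i : Fin n, (t i.succ : ℝ) - (t i.castSucc : ℝ) < ε) →
      (∑ i : Fin n, (((t i.succ : ℝ) - (t i.castSucc : ℝ) : ℝ) : 𝕜) • γ (s i)) - x ∈ V

variable (E) in
/-- Mackey-completeness: every Lipschitz curve has a Riemann integral. -/
def MackeyComplete : Prop :=
  ∀ γ : I → E, IsLipschitzCurve 𝕜 γ → ∃ x : E, HasRiemannIntegral 𝕜 γ x

end Curves

/-- Sequential completeness: every Cauchy sequence converges. -/
def SequentiallyComplete (E : Type*) [AddCommGroup E] [TopologicalSpace E] : Prop :=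
  ∀ u : ℕ → E, (∀ V ∈ 𝓝 (0 : E), ∃ N : ℕ, ∀ m ≥ N, ∀ n ≥ N, u m - u n ∈ V) →
    ∃ x : E, Tendsto u atTop (𝓝 x)

/-! ### Function spaces -/

section FunctionSpaces

variable (𝕜 : Type*) [RCLike 𝕜]

theorem diffQuot_add {E : Type*} [AddCommGroup E] [Module 𝕜 E] (γ δ : I → E) (s t : I) :
    diffQuot 𝕜 (γ + δ) s t = diffQuot 𝕜 γ s t + diffQuot 𝕜 δ s t := by
  simp only [diffQuot, Pi.add_apply, ← smul_add]
  congr 1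
  abel

theorem diffQuot_smul {E : Type*} [AddCommGroup E] [Module 𝕜 E] (c : 𝕜) (γ : I → E) (s t : I) :
    diffQuot 𝕜 (c • γ) s t = c • diffQuot 𝕜 γ s t := by
  simp only [diffQuot, Pi.smul_apply, ← smul_sub]
  rw [smul_comm]

theorem diffQuot_zero {E : Type*} [AddCommGroup E] [Module 𝕜 E] (s t : I) :
    diffQuot 𝕜 (0 : I → E) s t = 0 := by
  simp [diffQuot]

variable (E : Type*) [AddCommGroup E] [Module 𝕜 E] [TopologicalSpace E]
  [IsTopologicalAddGroup E] [ContinuousSMul 𝕜 E]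

/-- The curves `[0,1] → E` of class `C^r`: all derivatives of order at most `r` exist and are
continuous. -/
def crSubmodule (r : ℕ∞) : Submodule 𝕜 C(I, E) where
  carrier := {γ | ∃ δ : ℕ → C(I, E), δ 0 = γ ∧
    ∀ j : ℕ, (j : ℕ∞) < r → HasCurveDeriv 𝕜 (δ j) (δ (j + 1))}
  zero_mem' := by
    refine ⟨fun _ => 0, rfl, fun j _ t => ?_⟩
    simp only [ContinuousMap.coe_zero, diffQuot_zero, Pi.zero_apply]
    exact tendsto_const_nhds
  add_mem' := by
    rintro γ γ' ⟨δ, rfl, h⟩ ⟨δ', rfl, h'⟩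
    refine ⟨fun j => δ j + δ' j, rfl, fun j hj t => ?_⟩
    simp only [ContinuousMap.coe_add, diffQuot_add]
    exact (h j hj t).add (h' j hj t)
  smul_mem' := by
    rintro c γ ⟨δ, rfl, h⟩
    refine ⟨fun j => c • δ j, rfl, fun j hj t => ?_⟩
    simp only [ContinuousMap.coe_smul, diffQuot_smul]
    exact (h j hj t).const_smul c

open Classical in
/-- The derivative of a `C¹`-curve, as a continuous curve (and `0` for other curves). -/
def curveDeriv {E : Type*} [AddCommGroup E] [Module 𝕜 E] [TopologicalSpace E]
    (γ : C(I, E)) : C(I, E) :=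
  if h : ∃ δ : C(I, E), HasCurveDeriv 𝕜 γ δ then h.choose else 0

/-- The space of `C^r`-curves `[0,1] → E`, with the topology `O_{C^k}` (for `k ≤ r`) of uniform
convergence of all derivatives of order at most `k`. -/
def CrCurve (r _k : ℕ∞) : Type _ := crSubmodule 𝕜 E r

instance (r k : ℕ∞) : AddCommGroup (CrCurve 𝕜 E r k) :=
  inferInstanceAs (AddCommGroup (crSubmodule 𝕜 E r))

instance (r k : ℕ∞) : Module 𝕜 (CrCurve 𝕜 E r k) :=
  inferInstanceAs (Module 𝕜 (crSubmodule 𝕜 E r))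

/-- The underlying continuous curve. -/
def CrCurve.toCurve {𝕜 : Type*} [RCLike 𝕜] {E : Type*} [AddCommGroup E] [Module 𝕜 E]
    [TopologicalSpace E] [IsTopologicalAddGroup E] [ContinuousSMul 𝕜 E] {r k : ℕ∞}
    (γ : CrCurve 𝕜 E r k) : C(I, E) :=
  Subtype.val (p := fun γ => γ ∈ crSubmodule 𝕜 E r) γ

/-- The initial topology with respect to `γ ↦ γ^(j)`, `j ≤ k`, where `C([0,1], E)` carries the
topology of uniform convergence (that is, the compact-open topology). -/
instance (r k : ℕ∞) : TopologicalSpace (CrCurve 𝕜 E r k) :=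
  TopologicalSpace.induced
    (fun γ (j : {j : ℕ // (j : ℕ∞) ≤ k}) => (curveDeriv 𝕜)^[j.1] γ.toCurve) inferInstance

/-- The space `C^r([0,1], E)` with its usual topology. -/
abbrev CrSpace (r : ℕ∞) : Type _ := CrCurve 𝕜 E r r

/-- The space `Lip([0,1], E)` of Lipschitz curves. As a type, it carries the topology `O_{C^0}`
induced by `C([0,1], E)`. -/
def lipSubmodule : Submodule 𝕜 C(I, E) where
  carrier := {γ | IsLipschitzCurve 𝕜 γ}
  zero_mem' := by
    refine (Bornology.isVonNBounded_singleton (0 : E)).subset ?_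
    rintro v ⟨s, t, -, rfl⟩
    simp [diffQuot_zero]
  add_mem' := by
    intro γ δ hγ hδ
    refine (Bornology.IsVonNBounded.add hγ hδ).subset ?_
    rintro v ⟨s, t, hst, rfl⟩
    rw [ContinuousMap.coe_add, diffQuot_add]
    exact Set.add_mem_add ⟨s, t, hst, rfl⟩ ⟨s, t, hst, rfl⟩
  smul_mem' := by
    intro c γ hγ
    refine (Bornology.IsVonNBounded.image hγ (c • ContinuousLinearMap.id 𝕜 E)).subset ?_
    rintro v ⟨s, t, hst, rfl⟩
    rw [ContinuousMap.coe_smul, diffQuot_smul]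
    exact ⟨diffQuot 𝕜 γ s t, ⟨s, t, hst, rfl⟩, by simp⟩

end FunctionSpaces

/-! ### Smooth and analytic maps -/

/-- `f` is `C^r` on the open set `U`: it is continuous there, and the iterated directional
derivatives `D k x (y_1, …, y_k) = (D_{y_k} ⋯ D_{y_1} f)(x)` with `k ≤ r` exist and are continuous
on `U × E^k` (derivatives with respect to a real parameter). -/
def IsCrOn (𝕜 : Type*) [RCLike 𝕜] {E F : Type*} [AddCommGroup E] [Module 𝕜 E] [TopologicalSpace E]
    [AddCommGroup F] [Module 𝕜 F] [TopologicalSpace F] (r : ℕ∞) (f : E → F) (U : Set E) : Prop :=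
  ∃ D : (k : ℕ) → E → (Fin k → E) → F,
    (∀ x ∈ U, ∀ y : Fin 0 → E, D 0 x y = f x) ∧
    (∀ k : ℕ, (k : ℕ∞) < r → ∀ x ∈ U, ∀ (y : Fin k → E) (z : E),
      Tendsto (fun t : ℝ => ((t : 𝕜))⁻¹ • (D k (x + (t : 𝕜) • z) y - D k x y)) (𝓝[≠] 0)
        (𝓝 (D (k + 1) x (Fin.snoc (α := fun _ => E) y z)))) ∧
    (∀ k : ℕ, (k : ℕ∞) ≤ r →
      ContinuousOn (fun w : E × (Fin k → E) => D k w.1 w.2) (U ×ˢ Set.univ))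

/-- `f` is complex analytic on the open set `U`: it is continuous there and, locally around each
point, the pointwise limit of a series of continuous homogeneous polynomials. -/
def IsComplexAnalyticOn {E F : Type*} [AddCommGroup E] [Module ℂ E] [TopologicalSpace E]
    [AddCommGroup F] [Module ℂ F] [TopologicalSpace F] (f : E → F) (U : Set E) : Prop :=
  ContinuousOn f U ∧ ∀ x ∈ U, ∃ Y ∈ 𝓝 (0 : E), (∀ y ∈ Y, x + y ∈ U) ∧
    ∃ β : (n : ℕ) → ContinuousMultilinearMap ℂ (fun _ : Fin n => E) F,
      ∀ y ∈ Y, Tendsto (fun N : ℕ => ∑ n ∈ Finset.range N, β n (fun _ => y)) atTop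
        (𝓝 (f (x + y)))

/-- The complexification `E_ℂ = E ⊕ iE` of a real topological vector space, with the product
topology; `(a, b)` stands for `a + ib`. -/
def Complexification (E : Type*) : Type _ := E × E

namespace Complexification

variable (E : Type*)

instance [AddCommGroup E] : AddCommGroup (Complexification E) :=
  inferInstanceAs (AddCommGroup (E × E))

instance [TopologicalSpace E] : TopologicalSpace (Complexification E) :=
  inferInstanceAs (TopologicalSpace (E × E))

instance [AddCommGroup E] [Module ℝ E] : Module ℂ (Complexification E) where
  smul z v := (z.re • v.1 - z.im • v.2, z.re • v.2 + z.im • v.1)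
  one_smul v := Prod.ext
    (show (1 : ℂ).re • v.1 - (1 : ℂ).im • v.2 = v.1 by simp)
    (show (1 : ℂ).re • v.2 + (1 : ℂ).im • v.1 = v.2 by simp)
  mul_smul z w v := Prod.ext
    (show (z * w).re • v.1 - (z * w).im • v.2 =
        z.re • (w.re • v.1 - w.im • v.2) - z.im • (w.re • v.2 + w.im • v.1) by
      rw [Complex.mul_re, Complex.mul_im]; module)
    (show (z * w).re • v.2 + (z * w).im • v.1 =
        z.re • (w.re • v.2 + w.im • v.1) + z.im • (w.re • v.1 - w.im • v.2) by
      rw [Complex.mul_re, Complex.mul_im]; module)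
  smul_zero z := Prod.ext
    (show z.re • (0 : E) - z.im • (0 : E) = 0 by simp)
    (show z.re • (0 : E) + z.im • (0 : E) = 0 by simp)
  smul_add z v w := Prod.ext
    (show z.re • (v.1 + w.1) - z.im • (v.2 + w.2) =
        (z.re • v.1 - z.im • v.2) + (z.re • w.1 - z.im • w.2) by module)
    (show z.re • (v.2 + w.2) + z.im • (v.1 + w.1) =
        (z.re • v.2 + z.im • v.1) + (z.re • w.2 + z.im • w.1) by module)
  add_smul z w v := Prod.ext
    (show (z + w).re • v.1 - (z + w).im • v.2 =
        (z.re • v.1 - z.im • v.2) + (w.re • v.1 - w.im • v.2) by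
      rw [Complex.add_re, Complex.add_im]; module)
    (show (z + w).re • v.2 + (z + w).im • v.1 =
        (z.re • v.2 + z.im • v.1) + (w.re • v.2 + w.im • v.1) by
      rw [Complex.add_re, Complex.add_im]; module)
  zero_smul v := Prod.ext
    (show (0 : ℂ).re • v.1 - (0 : ℂ).im • v.2 = 0 by simp)
    (show (0 : ℂ).re • v.2 + (0 : ℂ).im • v.1 = 0 by simp)

variable {E}

/-- The embedding `E → E_ℂ`. -/
def ofReal [AddCommGroup E] (x : E) : Complexification E := (x, (0 : E))

end Complexification

/-- `f` is real analytic on the open set `U`: it extends to a complex analytic map with values in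
`F_ℂ` on an open subset of `E_ℂ` that contains `U`. -/
def IsRealAnalyticOn {E F : Type*} [AddCommGroup E] [Module ℝ E] [TopologicalSpace E]
    [AddCommGroup F] [Module ℝ F] [TopologicalSpace F] (f : E → F) (U : Set E) : Prop :=
  ∃ (V : Set (Complexification E)) (g : Complexification E → Complexification F),
    IsOpen V ∧ IsComplexAnalyticOn g V ∧
    ∀ x ∈ U, Complexification.ofReal x ∈ V ∧
      g (Complexification.ofReal x) = Complexification.ofReal (f x)

/-! ### Continuous inverse algebras and condition (∗) -/

section Algebras

/-- The unit group is open and inversion is continuous on it. -/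
def HasContinuousInverse (A : Type*) [Ring A] [TopologicalSpace A] : Prop :=
  IsOpen {a : A | IsUnit a} ∧ ContinuousOn (Ring.inverse : A → A) {a : A | IsUnit a}

variable (𝕜 : Type*) [RCLike 𝕜] (A : Type*) [Ring A] [Algebra 𝕜 A] [TopologicalSpace A]

/-- `‖μ_n‖_{p,q}`, the supremum of `p (x_1 ⋯ x_n)` over all `x_1, …, x_n` in the closed unit ball
of `q`. -/
def mulNorm {𝕜 : Type*} [RCLike 𝕜] {A : Type*} [Ring A] [Algebra 𝕜 A] (p q : Seminorm 𝕜 A)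
    (n : ℕ) : ENNReal :=
  ⨆ (x : Fin n → A) (_ : ∀ i, q (x i) ≤ 1), ENNReal.ofReal (p (List.ofFn x).prod)

/-- Condition (∗): for each continuous seminorm `p` there are a continuous seminorm `q` and `r > 0`
with `∑_{n ≥ 1} r^n ‖μ_n‖_{p,q} < ∞`. -/
def ConditionStar : Prop :=
  ∀ p : Seminorm 𝕜 A, Continuous p →
    ∃ q : Seminorm 𝕜 A, Continuous q ∧ ∃ r : ℝ, 0 < r ∧
      ∑' n : ℕ, ENNReal.ofReal r ^ (n + 1) * mulNorm p q (n + 1) < ⊤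

variable [IsTopologicalRing A] [ContinuousSMul 𝕜 A]

/-! ### Evolutions and regularity of the unit group

The unit group is an open subset of `A`; its tangent bundle is identified with `Aˣ × A`, so that
left translation of a tangent vector is multiplication in `A`. -/

/-- `η` is an evolution of `γ` in the unit group: a `C¹`-curve with values in the unit group,
`η(0) = 1` and `η' = η γ`. -/
def IsEvolution {𝕜 : Type*} [RCLike 𝕜] {A : Type*} [Ring A] [Algebra 𝕜 A] [TopologicalSpace A]
    [IsTopologicalRing A] [ContinuousSMul 𝕜 A] (γ : C(I, A)) (η : CrSpace 𝕜 A 1) : Prop :=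
  (∀ t : I, IsUnit (η.toCurve t)) ∧ η.toCurve 0 = 1 ∧
    HasCurveDeriv 𝕜 η.toCurve (fun t => η.toCurve t * γ t)

/-- For a space `X` of curves (where `c` gives the curve that underlies an element of `X`), `Evol`
is the evolution map on `X`: each `x : X` has exactly one evolution, namely `Evol x`. -/
def IsEvolutionMap {𝕜 : Type*} [RCLike 𝕜] {A : Type*} [Ring A] [Algebra 𝕜 A] [TopologicalSpace A]
    [IsTopologicalRing A] [ContinuousSMul 𝕜 A] {X : Type*} (c : X → C(I, A))
    (Evol : X → CrSpace 𝕜 A 1) : Prop :=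
  ∀ (x : X) (η : CrSpace 𝕜 A 1), IsEvolution (c x) η ↔ η = Evol x

/-- The unit group is strongly `C^k`-regular: every `C^k`-curve `γ` in `A` has an evolution, and
`evol : C^k([0,1], A) → Aˣ`, `γ ↦ Evol(γ)(1)`, is smooth. -/
def UnitsStronglyRegular (k : ℕ∞) : Prop :=
  ∃ Evol : CrSpace 𝕜 A k → CrSpace 𝕜 A 1, IsEvolutionMap CrCurve.toCurve Evol ∧
    IsCrOn 𝕜 ⊤ (fun γ => (Evol γ).toCurve 1) Set.univ

/-- The unit group is `C^k`-regular: every smooth curve `γ` in `A` has an evolution, and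
`evol : (C^∞([0,1], A), O_{C^k}) → Aˣ`, `γ ↦ Evol(γ)(1)`, is smooth. -/
def UnitsRegular (k : ℕ∞) : Prop :=
  ∃ Evol : CrCurve 𝕜 A ⊤ k → CrSpace 𝕜 A 1, IsEvolutionMap CrCurve.toCurve Evol ∧
    IsCrOn 𝕜 ⊤ (fun γ => (Evol γ).toCurve 1) Set.univ

end Algebras

end CIA

end

/-! Condition (∗), after rescaling `q`, becomes p(x₁⋯xₙ) ≤ C q(x₁)⋯q(xₙ) for words of every length
(`ConditionStar.exists_prodBound`). One pair (p, q) thus controls all Picard iterates F₀ = 1, Fₙ₊₁ =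
∫ Fₙγ of η' = ηγ: with q∘γ ≤ M one gets p(Fₙ(t)) ≤ C Mⁿtⁿ/n!. Their sum is the evolution, provided
that the primitives and the series exist.

Completeness is needed for these two points only. Under sequential completeness both are standard.
Under Mackey completeness, Lipschitz curves have primitives, and Fₙγ is Lipschitz if γ is, because
Fₙ is C¹. The series converges because a factorially decaying series is the integral of a single
Lipschitz curve built from disjoint bumps (`MackeyComplete.factorialSummable`). `IsPicardSpace`
collects what is needed of a space L of curves. It holds for all continuous curves in the first case
and for Lipschitz curves in the second. All further results concern a continuous linear map `c` from
a space X into L, which covers every topology in the theorem.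

Write E = Evol(γ). Its inverse solves θ' = -γθ. The cocycle identity Evol(γ + y) = Evol(E y E⁻¹) E
(`IsPicardSpace.evol_add`) reduces continuity of Evol to continuity at 0, where the Picard bound
C(exp M - 1) settles it. Variation of constants solves u' = uγ + g, and iterating it gives the
iterated integrals `iterSolve`. The derivative of an iterated integral in direction z is the sum of
those with z inserted (`IsPicardSpace.tendsto_iterSolve_slope`), so evol is smooth. The series of
the iterated integrals of y, y, …, y relative to γ converges to Evol(γ + y) for every y in L
(`IsPicardSpace.tendsto_sum_iterSolve`), which is complex analyticity. Over ℝ the complexification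
of A has the properties used here, and its evolution map extends the real one
(`IsPicardSpace.isRealAnalyticOn_evolMap`). -/

noncomputable section

set_option linter.unusedSectionVars false

namespace CIA

/-! ### Differentiation rules for curves on the unit interval. -/

section Calculus

variable {𝕜 : Type*} [RCLike 𝕜] {E F G : Type*} [AddCommGroup E] [Module 𝕜 E] [TopologicalSpace E]
  [AddCommGroup F] [Module 𝕜 F] [TopologicalSpace F]
  [AddCommGroup G] [Module 𝕜 G] [TopologicalSpace G]

theorem seminorm_diffQuot (p : Seminorm 𝕜 E) (γ : I → E) (s t : I) :
    p (diffQuot 𝕜 γ s t) = |(s : ℝ) - t|⁻¹ * p (γ s - γ t) := by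
  rw [diffQuot, map_smul_eq_mul, norm_inv, RCLike.norm_ofReal]

theorem smul_diffQuot (γ : I → E) {s t : I} (h : s ≠ t) :
    ((((s : ℝ) - (t : ℝ) : ℝ) : 𝕜)) • diffQuot 𝕜 γ s t = γ s - γ t := by
  rw [diffQuot, smul_inv_smul₀]
  exact RCLike.ofReal_ne_zero.2 (sub_ne_zero.2 fun h' => h (Subtype.ext h'))

namespace HasCurveDeriv

variable {γ δ γ' δ' : I → E}

theorem continuous [IsTopologicalAddGroup E] [ContinuousSMul 𝕜 E] (h : HasCurveDeriv 𝕜 γ δ) :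
    Continuous γ := by
  rw [continuous_iff_continuousAt]
  intro t
  have h1 : Tendsto (fun s : I => ((((s : ℝ) - (t : ℝ) : ℝ) : 𝕜))) (𝓝[≠] t) (𝓝 0) := by
    have : Continuous (fun s : I => ((((s : ℝ) - (t : ℝ) : ℝ) : 𝕜))) := by fun_prop
    simpa using (this.tendsto t).mono_left nhdsWithin_le_nhds
  have h2 : Tendsto γ (𝓝[≠] t) (𝓝 (γ t)) := by
    have h3 := (h1.smul (h t)).add_const (γ t)
    rw [zero_smul, zero_add] at h3
    refine h3.congr' ?_
    filter_upwards [self_mem_nhdsWithin] with s hs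
    rw [smul_diffQuot γ hs, sub_add_cancel]
  exact continuousAt_iff_punctured_nhds.2 h2

theorem unique [T2Space E] (h : HasCurveDeriv 𝕜 γ δ) (h' : HasCurveDeriv 𝕜 γ δ') : δ = δ' :=
  funext fun t => tendsto_nhds_unique (h t) (h' t)

theorem const (x : E) : HasCurveDeriv 𝕜 (fun _ => x) 0 := fun t => by
  simpa [diffQuot] using tendsto_const_nhds

theorem add [IsTopologicalAddGroup E] (h : HasCurveDeriv 𝕜 γ δ) (h' : HasCurveDeriv 𝕜 γ' δ') :
    HasCurveDeriv 𝕜 (γ + γ') (δ + δ') := fun t => by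
  simpa only [diffQuot_add, Pi.add_apply] using (h t).add (h' t)

theorem const_smul [ContinuousSMul 𝕜 E] (c : 𝕜) (h : HasCurveDeriv 𝕜 γ δ) :
    HasCurveDeriv 𝕜 (c • γ) (c • δ) := fun t => by
  simpa only [diffQuot_smul, Pi.smul_apply] using (h t).const_smul c

theorem neg [IsTopologicalAddGroup E] [ContinuousSMul 𝕜 E] (h : HasCurveDeriv 𝕜 γ δ) :
    HasCurveDeriv 𝕜 (-γ) (-δ) := by
  simpa using h.const_smul (-1)

theorem sub [IsTopologicalAddGroup E] [ContinuousSMul 𝕜 E]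
    (h : HasCurveDeriv 𝕜 γ δ) (h' : HasCurveDeriv 𝕜 γ' δ') :
    HasCurveDeriv 𝕜 (γ - γ') (δ - δ') := by
  simpa only [sub_eq_add_neg] using h.add h'.neg

theorem sum [IsTopologicalAddGroup E] {ι : Type*} (s : Finset ι) {γ δ : ι → I → E}
    (h : ∀ i ∈ s, HasCurveDeriv 𝕜 (γ i) (δ i)) :
    HasCurveDeriv 𝕜 (fun t => ∑ i ∈ s, γ i t) (fun t => ∑ i ∈ s, δ i t) := by
  classical
  induction s using Finset.induction_on with
  | empty => exact const (𝕜 := 𝕜) (0 : E)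
  | insert a s ha ih =>
    simp only [Finset.sum_insert ha]
    exact (h a (by simp)).add (ih fun i hi => h i (by simp [hi]))

theorem comp_linear (h : HasCurveDeriv 𝕜 γ δ) (L : E →ₗ[𝕜] F) (hL : Continuous L) :
    HasCurveDeriv 𝕜 (fun t => L (γ t)) (fun t => L (δ t)) := fun t => by
  refine ((hL.tendsto _).comp (h t)).congr fun s => ?_
  simp [diffQuot]

theorem bilinear [IsTopologicalAddGroup G] [IsTopologicalAddGroup F] [ContinuousSMul 𝕜 F]
    {ζ ζ' : I → F} (h : HasCurveDeriv 𝕜 γ δ)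
    (h' : HasCurveDeriv 𝕜 ζ ζ') (m : E →ₗ[𝕜] F →ₗ[𝕜] G)
    (hm : Continuous fun z : E × F => m z.1 z.2) :
    HasCurveDeriv 𝕜 (fun t => m (γ t) (ζ t)) (fun t => m (δ t) (ζ t) + m (γ t) (ζ' t)) := by
  intro t
  have h1 : Tendsto (fun s => m (diffQuot 𝕜 γ s t) (ζ s)) (𝓝[≠] t) (𝓝 (m (δ t) (ζ t))) :=
    (hm.tendsto (δ t, ζ t)).comp
      ((h t).prodMk_nhds ((h'.continuous.tendsto t).mono_left nhdsWithin_le_nhds))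
  have h2 : Tendsto (fun s => m (γ t) (diffQuot 𝕜 ζ s t)) (𝓝[≠] t) (𝓝 (m (γ t) (ζ' t))) :=
    (hm.tendsto (γ t, ζ' t)).comp (tendsto_const_nhds.prodMk_nhds (h' t))
  refine (h1.add h2).congr fun s => ?_
  simp only [diffQuot, map_smul, LinearMap.smul_apply, ← smul_add, map_sub, LinearMap.sub_apply]
  congr 1
  abel

end HasCurveDeriv

end Calculus

/-! ### Mean value inequality and convergence in terms of continuous seminorms. -/

section Seminorms

variable {𝕜 : Type*} [RCLike 𝕜] {E : Type*} [AddCommGroup E] [Module 𝕜 E] [TopologicalSpace E]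

/-- A mean value inequality. -/
theorem HasCurveDeriv.seminorm_sub_le [IsTopologicalAddGroup E] [ContinuousSMul 𝕜 E]
    {Γ γ : I → E} (h : HasCurveDeriv 𝕜 Γ γ) {p : Seminorm 𝕜 E}
    (hp : Continuous p) {B B' : ℝ → ℝ} (hB : ∀ x, HasDerivAt B (B' x) x) {a b : I} (hab : a ≤ b)
    (hle : ∀ t : I, a ≤ t → t ≤ b → p (γ t) ≤ B' t) : p (Γ b - Γ a) ≤ B b - B a := by
  have hΓ := h.continuous
  set f : ℝ → ℝ := fun u => p (Γ (Set.projIcc 0 1 zero_le_one u) - Γ a) with hf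
  have hfc : Continuous f := by fun_prop
  have hfI : ∀ t : I, f t = p (Γ t - Γ a) := fun t => by simp [hf]
  rw [← hfI]
  -- The real function `f` has right slopes bounded in the limit by p(γ) ≤ B', so the comparison
  -- theorem for one-sided slopes gives f ≤ B - B(a).
  refine image_le_of_liminf_slope_right_le_deriv_boundary (a := a) (b := b)
    (B := fun u => B u - B a)
    (B' := B') hfc.continuousOn (by simp [hfI])
    (fun u _ => ((hB u).continuousAt.sub continuousAt_const).continuousWithinAt)
    (fun u _ => ((hB u).sub_const _).hasDerivWithinAt) ?_ ⟨hab, le_rfl⟩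
  intro x hx r hr
  have hxI : x ∈ Set.Icc (0 : ℝ) 1 := ⟨a.2.1.trans hx.1, hx.2.le.trans b.2.2⟩
  set t : I := ⟨x, hxI⟩ with ht
  have hpt : p (γ t) < r := (hle t hx.1 hx.2.le).trans_lt hr
  have h1 : ∀ᶠ s in 𝓝[≠] t, p (diffQuot 𝕜 Γ s t) < r :=
    ((hp.tendsto _).comp (h t)).eventually (gt_mem_nhds hpt)
  have hx1 : x < 1 := hx.2.trans_le b.2.2
  have hproj : Tendsto (Set.projIcc (0 : ℝ) 1 zero_le_one) (𝓝[>] x) (𝓝[≠] t) := by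
    refine tendsto_nhdsWithin_iff.2 ⟨?_, ?_⟩
    · have : Tendsto (Set.projIcc (0 : ℝ) 1 zero_le_one) (𝓝 x) (𝓝 t) := by
        have := (continuous_projIcc (a := (0 : ℝ)) (b := 1) (h := zero_le_one)).tendsto x
        rwa [Set.projIcc_of_mem _ hxI] at this
      exact this.mono_left nhdsWithin_le_nhds
    · filter_upwards [Ioo_mem_nhdsGT hx1] with u hu
      rw [Set.projIcc_of_mem _ ⟨hxI.1.trans hu.1.le, hu.2.le⟩]
      exact fun h => hu.1.ne' (congrArg Subtype.val h)
  refine Eventually.frequently ?_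
  filter_upwards [hproj.eventually h1, Ioo_mem_nhdsGT hx1] with u hu hux
  have huI : u ∈ Set.Icc (0 : ℝ) 1 := ⟨hxI.1.trans hux.1.le, hux.2.le⟩
  refine lt_of_le_of_lt ?_ hu
  have e1 : f u = p (Γ ⟨u, huI⟩ - Γ a) := hfI ⟨u, huI⟩
  have e2 : f x = p (Γ t - Γ a) := hfI t
  rw [slope_def_field, seminorm_diffQuot, Set.projIcc_of_mem _ huI, e1, e2, div_eq_inv_mul,
    abs_of_pos (sub_pos.2 hux.1)]
  refine mul_le_mul_of_nonneg_left ?_ (inv_nonneg.2 (sub_pos.2 hux.1).le)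
  have := map_add_le_add p (Γ ⟨u, huI⟩ - Γ t) (Γ t - Γ a)
  rw [sub_add_sub_cancel] at this
  linarith

theorem HasCurveDeriv.seminorm_sub_le_mul [IsTopologicalAddGroup E] [ContinuousSMul 𝕜 E]
    {Γ γ : I → E} (h : HasCurveDeriv 𝕜 Γ γ) {p : Seminorm 𝕜 E}
    (hp : Continuous p) {M : ℝ} {a b : I} (hab : a ≤ b)
    (hle : ∀ t : I, a ≤ t → t ≤ b → p (γ t) ≤ M) : p (Γ b - Γ a) ≤ M * ((b : ℝ) - a) := by
  have := h.seminorm_sub_le hp (B := fun x => M * x) (B' := fun _ => M)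
    (fun x => by simpa using (hasDerivAt_id x).const_mul M) hab hle
  rwa [← mul_sub] at this

theorem HasCurveDeriv.seminorm_sub_le_abs [IsTopologicalAddGroup E] [ContinuousSMul 𝕜 E]
    {Γ γ : I → E} (h : HasCurveDeriv 𝕜 Γ γ) {p : Seminorm 𝕜 E}
    (hp : Continuous p) {M : ℝ} (hle : ∀ t : I, p (γ t) ≤ M) (a b : I) :
    p (Γ b - Γ a) ≤ M * |(b : ℝ) - a| := by
  rcases le_total a b with hab | hab
  · rw [abs_of_nonneg (sub_nonneg.2 (Subtype.coe_le_coe.2 hab))]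
    exact h.seminorm_sub_le_mul hp hab fun t _ _ => hle t
  · rw [abs_sub_comm, abs_of_nonneg (sub_nonneg.2 (Subtype.coe_le_coe.2 hab)), map_sub_rev]
    exact h.seminorm_sub_le_mul hp hab fun t _ _ => hle t

variable [PolynormableSpace 𝕜 E]

variable (𝕜) in
-- Continuous seminorms are closed under finite suprema and positive multiples, so a single unit
-- ball does the work of a finite family of balls.
theorem exists_seminorm_lt_one_subset {V : Set E} (hV : V ∈ 𝓝 (0 : E)) :
    ∃ p : Seminorm 𝕜 E, Continuous p ∧ ∀ x, p x < 1 → x ∈ V := by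
  obtain ⟨⟨s, r⟩, hr, hs⟩ := (PolynormableSpace.withSeminorms 𝕜 E).hasBasis_zero_ball.mem_iff.1 hV
  replace hr : 0 < r := hr
  have hcont (s : Finset {p : Seminorm 𝕜 E // Continuous p}) :
      Continuous ⇑(s.sup (fun p => p.1) : Seminorm 𝕜 E) := by
    classical
    induction s using Finset.induction_on with
    | empty => simpa using (continuous_zero : Continuous (0 : E → ℝ))
    | insert a s ha ih =>
      rw [Finset.sup_insert]
      exact Continuous.max a.2 ih
  obtain ⟨c, hc⟩ : ∃ c : NNReal, (c : ℝ) = r⁻¹ := ⟨⟨r⁻¹, inv_nonneg.2 hr.le⟩, rfl⟩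
  refine ⟨c • (s.sup (fun p => p.1) : Seminorm 𝕜 E), ?_, fun x hx => hs ?_⟩
  · exact (hcont s).const_smul c
  · rw [Seminorm.mem_ball_zero]
    have h1 : (c : ℝ) * (s.sup (fun p => p.1) : Seminorm 𝕜 E) x < 1 := hx
    rw [hc, inv_mul_lt_iff₀ hr, mul_one] at h1
    exact h1

variable (𝕜) in
theorem tendsto_nhds_iff_seminorm [IsTopologicalAddGroup E] {ι : Type*} {l : Filter ι} {f : ι → E}
    {x : E} : Tendsto f l (𝓝 x) ↔ ∀ p : Seminorm 𝕜 E, Continuous p → ∀ ε > 0,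
      ∀ᶠ i in l, p (f i - x) < ε := by
  rw [← tendsto_sub_nhds_zero_iff]
  constructor
  · intro h p hp ε hε
    have := (hp.tendsto 0).comp h
    rw [map_zero] at this
    exact this.eventually (gt_mem_nhds hε)
  · intro h V hV
    obtain ⟨p, hp, hpV⟩ := exists_seminorm_lt_one_subset 𝕜 hV
    exact (h p hp 1 one_pos).mono fun i hi => hpV _ hi

variable (𝕜) in
theorem eq_zero_of_seminorm [IsTopologicalAddGroup E] [T2Space E] {x : E}
    (h : ∀ p : Seminorm 𝕜 E, Continuous p → p x = 0) : x = 0 := by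
  have : Tendsto (fun _ : ℕ => x) atTop (𝓝 0) :=
    (tendsto_nhds_iff_seminorm 𝕜).2 fun p hp ε hε => by simp [h p hp, hε]
  exact tendsto_nhds_unique tendsto_const_nhds this

variable (𝕜) in
-- On the compact interval the compact-open topology is uniform convergence, for the
-- translation-invariant uniformity of `E`.
theorem tendsto_curve_iff_seminorm [IsTopologicalAddGroup E] {ι : Type*} {l : Filter ι}
    {f : ι → C(I, E)} {g : C(I, E)} :
    Tendsto f l (𝓝 g) ↔ ∀ p : Seminorm 𝕜 E, Continuous p → ∀ ε > 0,
      ∀ᶠ i in l, ∀ t, p (f i t - g t) < ε := by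
  let : UniformSpace E := IsTopologicalAddGroup.rightUniformSpace E
  have : IsUniformAddGroup E := isUniformAddGroup_of_addCommGroup
  rw [ContinuousMap.tendsto_iff_tendstoUniformly]
  constructor
  · intro h p hp ε hε
    have hV : {z : E × E | p (z.2 - z.1) < ε} ∈ uniformity E := by
      rw [uniformity_eq_comap_nhds_zero E]
      refine ⟨{x | p x < ε}, ?_, fun z hz => hz⟩
      exact hp.continuousAt.eventually (gt_mem_nhds (by simpa using hε))
    exact (h _ hV).mono fun i hi t => hi t
  · intro h V hV
    rw [uniformity_eq_comap_nhds_zero E] at hV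
    obtain ⟨W, hW, hWV⟩ := hV
    obtain ⟨p, hp, hpW⟩ := exists_seminorm_lt_one_subset 𝕜 hW
    exact (h p hp 1 one_pos).mono fun i hi t => hWV (hpW _ (hi t))

theorem exists_seminorm_curve_le [IsTopologicalAddGroup E] {p : Seminorm 𝕜 E} (hp : Continuous p)
    (γ : C(I, E)) : ∃ M : ℝ, 0 ≤ M ∧ ∀ t, p (γ t) ≤ M := by
  obtain ⟨M, hM⟩ := isCompact_univ.exists_bound_of_continuousOn
    (f := fun t : I => p (γ t)) (by fun_prop)
  exact ⟨M, (norm_nonneg _).trans (hM 0 trivial), fun t => (le_abs_self _).trans (hM t trivial)⟩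

variable [IsTopologicalAddGroup E] [ContinuousSMul 𝕜 E]

theorem HasCurveDeriv.eq_of_deriv_zero [T2Space E] {Γ : I → E} (h : HasCurveDeriv 𝕜 Γ 0) (a b : I) :
    Γ b = Γ a := by
  refine sub_eq_zero.1 (eq_zero_of_seminorm 𝕜 fun p hp => le_antisymm ?_ (apply_nonneg _ _))
  simpa using h.seminorm_sub_le_abs hp (M := 0) (by simp) a b

/-- A pointwise limit of curves whose derivatives converge uniformly can be differentiated term by
term. -/
theorem hasCurveDeriv_of_tendsto {Γ : ℕ → I → E} {γ : ℕ → I → E} {Γ' γ' : I → E}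
    (h : ∀ n, HasCurveDeriv 𝕜 (Γ n) (γ n)) (hΓ : ∀ t, Tendsto (fun n => Γ n t) atTop (𝓝 (Γ' t)))
    (hγ : ∀ p : Seminorm 𝕜 E, Continuous p → ∀ ε > 0, ∀ᶠ n in atTop, ∀ t, p (γ n t - γ' t) < ε) :
    HasCurveDeriv 𝕜 Γ' γ' := by
  intro t
  rw [tendsto_nhds_iff_seminorm 𝕜]
  intro p hp ε hε
  obtain ⟨N, hN⟩ := eventually_atTop.1 (hγ p hp (ε / 6) (by positivity))
  -- The mean value inequality for Γₙ - Γ_N, whose derivative is at most 2 · ε/6, survives n → ∞.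
  -- The resulting bound on difference quotients is independent of `s`.
  have hd : ∀ s ≠ t, p (diffQuot 𝕜 Γ' s t - diffQuot 𝕜 (Γ N) s t) ≤ ε / 3 := by
    intro s hs
    have hst : |(s : ℝ) - t| ≠ 0 := by
      rw [abs_ne_zero, sub_ne_zero]; exact fun h => hs (Subtype.ext h)
    have h1 : ∀ n ≥ N, p ((Γ n s - Γ N s) - (Γ n t - Γ N t)) ≤ ε / 3 * |(s : ℝ) - t| := by
      intro n hn
      refine ((h n).sub (h N)).seminorm_sub_le_abs hp (fun u => ?_) t s
      have e : (γ n - γ N) u = (γ n u - γ' u) - (γ N u - γ' u) := by simp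
      rw [e]
      have := map_sub_le_add p (γ n u - γ' u) (γ N u - γ' u)
      linarith [hN n hn u, hN N le_rfl u]
    have h2 : p ((Γ' s - Γ N s) - (Γ' t - Γ N t)) ≤ ε / 3 * |(s : ℝ) - t| := by
      refine le_of_tendsto ((hp.tendsto _).comp
        (((hΓ s).sub_const _).sub ((hΓ t).sub_const _))) ?_
      filter_upwards [eventually_ge_atTop N] with n hn using h1 n hn
    have e : diffQuot 𝕜 Γ' s t - diffQuot 𝕜 (Γ N) s t
        = diffQuot 𝕜 (fun u => Γ' u - Γ N u) s t := by
      simp only [diffQuot, ← smul_sub]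
      congr 1
      abel
    rw [e, seminorm_diffQuot, inv_mul_le_iff₀ (by positivity)]
    linarith
  filter_upwards [(tendsto_nhds_iff_seminorm 𝕜).1 (h N t) p hp (ε / 3) (by positivity),
    self_mem_nhdsWithin] with s h1 hs
  have e : diffQuot 𝕜 Γ' s t - γ' t = (diffQuot 𝕜 Γ' s t - diffQuot 𝕜 (Γ N) s t)
      + (diffQuot 𝕜 (Γ N) s t - γ N t) + (γ N t - γ' t) := by abel
  rw [e]
  have h3 := map_add_le_add p ((diffQuot 𝕜 Γ' s t - diffQuot 𝕜 (Γ N) s t)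
      + (diffQuot 𝕜 (Γ N) s t - γ N t)) (γ N t - γ' t)
  have h4 := map_add_le_add p (diffQuot 𝕜 Γ' s t - diffQuot 𝕜 (Γ N) s t)
      (diffQuot 𝕜 (Γ N) s t - γ N t)
  linarith [hN N le_rfl t, hd s hs]

end Seminorms

/-! ### Picard iteration for a continuous bilinear multiplication. -/

section Picard

variable {𝕜 : Type*} [RCLike 𝕜] {A : Type*} [AddCommGroup A] [Module 𝕜 A] [TopologicalSpace A]
  [IsTopologicalAddGroup A] [ContinuousSMul 𝕜 A]

/-- Iterated right multiplication by the elements of a list, for a bilinear multiplication. -/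
def foldlLinear (m : A →ₗ[𝕜] A →ₗ[𝕜] A) : List A → A →ₗ[𝕜] A
  | [] => LinearMap.id
  | a :: w => foldlLinear m w ∘ₗ m.flip a

theorem continuous_foldlLinear {m : A →ₗ[𝕜] A →ₗ[𝕜] A}
    (hm : Continuous fun z : A × A => m z.1 z.2) (w : List A) : Continuous (foldlLinear m w) := by
  induction w with
  | nil => exact continuous_id
  | cons a w ih => exact ih.comp (hm.comp (continuous_id.prodMk continuous_const))

theorem foldlLinear_cons (m : A →ₗ[𝕜] A →ₗ[𝕜] A) (a x : A) (w : List A) :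
    foldlLinear m (a :: w) x = foldlLinear m w (m x a) := rfl

theorem map_prod_nonneg (q : Seminorm 𝕜 A) (w : List A) : 0 ≤ (w.map q).prod :=
  List.prod_nonneg fun x hx => by
    obtain ⟨a, -, rfl⟩ := List.mem_map.1 hx
    exact apply_nonneg q a

/-- The list `w` keeps the seminorm fixed through the induction: the step moves the factor a(s) from
the integrand into the list, where it costs a factor q(a(s)) ≤ M. Bounding each product separately
by continuity would change the seminorm at every step. -/
theorem seminorm_foldlLinear_iterate_le {m : A →ₗ[𝕜] A →ₗ[𝕜] A}
    (hm : Continuous fun z : A × A => m z.1 z.2) {p q : Seminorm 𝕜 A} (hp : Continuous p)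
    {K M : ℝ} {F : ℕ → I → A} {a : I → A}
    (hF : ∀ n, HasCurveDeriv 𝕜 (F (n + 1)) (fun t => m (F n t) (a t)))
    (hF0 : ∀ n, F (n + 1) 0 = 0) (ha : ∀ t, q (a t) ≤ M)
    (hK : ∀ t w, p (foldlLinear m w (F 0 t)) ≤ K * (w.map q).prod) (n : ℕ) (t : I) (w : List A) :
    p (foldlLinear m w (F n t)) ≤ K * (M ^ n * (t : ℝ) ^ n / n.factorial) * (w.map q).prod := by
  have hM : 0 ≤ M := (apply_nonneg q _).trans (ha 0)
  have hK0 : 0 ≤ K := by simpa [foldlLinear] using (apply_nonneg p _).trans (hK 0 [])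
  induction n generalizing t w with
  | zero => simpa using hK t w
  | succ n ih =>
    have hd := (hF n).comp_linear (foldlLinear m w) (continuous_foldlLinear hm w)
    set P := (w.map q).prod with hP
    have hP0 : 0 ≤ P := map_prod_nonneg q w
    -- This comparison function, in place of a linear one, is what produces the factorial.
    have hB : ∀ x : ℝ, HasDerivAt
        (fun x => K * (M ^ (n + 1) * x ^ (n + 1) / (n + 1).factorial) * P)
        (K * (M ^ (n + 1) * x ^ n / n.factorial) * P) x := by
      intro x
      have h1 := (((hasDerivAt_pow (n + 1) x).const_mul (M ^ (n + 1))).div_const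
        ((n + 1).factorial : ℝ)).const_mul K |>.mul_const P
      refine h1.congr_deriv ?_
      rw [Nat.factorial_succ]
      have : (n.factorial : ℝ) ≠ 0 := by positivity
      push_cast
      field_simp
    have := hd.seminorm_sub_le hp hB (a := 0) (b := t) t.2.1 (fun s _ _ => ?_)
    · simpa [hF0] using this
    · have h2 := ih s (a s :: w)
      rw [foldlLinear_cons, List.map_cons, List.prod_cons] at h2
      refine h2.trans ?_
      have hs : (0 : ℝ) ≤ s := s.2.1
      have : K * (M ^ n * (s : ℝ) ^ n / n.factorial) * (q (a s) * P)
          ≤ K * (M ^ n * (s : ℝ) ^ n / n.factorial) * (M * P) := by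
        gcongr
        exact ha s
      refine this.trans (le_of_eq ?_)
      rw [pow_succ]
      ring

/-- The pointwise product of curves, for a bilinear multiplication. -/
def curveMul (m : A →ₗ[𝕜] A →ₗ[𝕜] A) (hm : Continuous fun z : A × A => m z.1 z.2)
    (η γ : C(I, A)) : C(I, A) :=
  ⟨fun t => m (η t) (γ t), hm.comp (η.continuous.prodMk γ.continuous)⟩

variable (𝕜) in
/-- Convergence of the series of all sequences that decay factorially. -/
def FactorialSummable (A : Type*) [AddCommGroup A] [Module 𝕜 A] [TopologicalSpace A] : Prop :=
  ∀ a : ℕ → A, (∀ p : Seminorm 𝕜 A, Continuous p →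
      ∃ C M : ℝ, ∀ n : ℕ, p (a n) ≤ C * (M ^ n / n.factorial)) →
    ∃ x, Tendsto (fun N => ∑ n ∈ Finset.range N, a n) atTop (𝓝 x)

theorem sum_range_pow_div_factorial_le {C M : ℝ} (hC : 0 ≤ C) (hM : 0 ≤ M) (N : ℕ) :
    ∑ n ∈ Finset.range N, C * (M ^ n / n.factorial) ≤ C * Real.exp M := by
  rw [← Finset.mul_sum]
  exact mul_le_mul_of_nonneg_left (Real.sum_le_exp_of_nonneg hM N) hC

theorem tendsto_sum_pow_div_factorial (C M : ℝ) :
    Tendsto (fun N => ∑ n ∈ Finset.range N, C * (M ^ n / n.factorial)) atTop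
      (𝓝 (C * Real.exp M)) := by
  simp_rw [← Finset.mul_sum]
  have := (NormedSpace.expSeries_div_hasSum_exp M).tendsto_sum_nat
  rw [← Real.exp_eq_exp_ℝ] at this
  exact this.const_mul C

theorem seminorm_sub_sum_le {p : Seminorm 𝕜 A} (hp : Continuous p) {a : ℕ → A} {x : A}
    (hx : Tendsto (fun N => ∑ n ∈ Finset.range N, a n) atTop (𝓝 x)) {C M : ℝ} (hC : 0 ≤ C)
    (hM : 0 ≤ M) (h : ∀ n, p (a n) ≤ C * (M ^ n / n.factorial)) (N : ℕ) :
    p (x - ∑ n ∈ Finset.range N, a n)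
      ≤ C * Real.exp M - ∑ n ∈ Finset.range N, C * (M ^ n / n.factorial) := by
  refine le_of_tendsto ((hp.tendsto _).comp (hx.sub_const (∑ n ∈ Finset.range N, a n))) ?_
  filter_upwards [eventually_ge_atTop N] with k hk
  simp only [Function.comp]
  have h1 := sum_range_pow_div_factorial_le hC hM k
  rw [← Finset.sum_range_add_sum_Ico _ hk] at h1
  rw [← Finset.sum_range_add_sum_Ico _ hk, add_sub_cancel_left]
  have h2 : p (∑ n ∈ Finset.Ico N k, a n) ≤ ∑ n ∈ Finset.Ico N k, C * (M ^ n / n.factorial) :=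
    (Finset.le_sum_of_subadditive p (map_zero p).le (map_add_le_add p) _ _).trans
      (Finset.sum_le_sum fun n _ => h n)
  linarith

variable [PolynormableSpace 𝕜 A] [T2Space A]

/-- Solution of a linear initial value problem by Picard iteration. -/
theorem exists_linear_ode_solution {m : A →ₗ[𝕜] A →ₗ[𝕜] A}
    (hm : Continuous fun z : A × A => m z.1 z.2) (e : A)
    (hstar : ∀ p : Seminorm 𝕜 A, Continuous p → ∃ q : Seminorm 𝕜 A, Continuous q ∧
      ∃ C : ℝ, ∀ w : List A, p (foldlLinear m w e) ≤ C * (w.map q).prod)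
    (hsum : FactorialSummable 𝕜 A) {L : Submodule 𝕜 C(I, A)}
    (hprim : ∀ γ ∈ L, ∃ Γ : C(I, A), HasCurveDeriv 𝕜 Γ γ ∧ Γ 0 = 0) {γ : C(I, A)}
    (hmul : ∀ η δ : C(I, A), HasCurveDeriv 𝕜 η δ → curveMul m hm η γ ∈ L) :
    ∃ η : C(I, A), η 0 = e ∧ HasCurveDeriv 𝕜 η (curveMul m hm η γ) ∧
      ∀ (p q : Seminorm 𝕜 A) (C M : ℝ), Continuous p → Continuous q →
        (∀ w : List A, p (foldlLinear m w e) ≤ C * (w.map q).prod) → (∀ t, q (γ t) ≤ M) →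
        ∀ t, p (η t - e) ≤ C * (Real.exp M - 1) := by
  -- The iterates carry a continuous derivative along, because only products of such curves with γ
  -- are known to lie in `L`.
  have hstep : ∀ η : {η : C(I, A) // ∃ δ : C(I, A), HasCurveDeriv 𝕜 η δ},
      ∃ Γ : {η : C(I, A) // ∃ δ : C(I, A), HasCurveDeriv 𝕜 η δ},
        HasCurveDeriv 𝕜 Γ.1 (curveMul m hm η.1 γ) ∧ Γ.1 0 = 0 := by
    rintro ⟨η, δ, hδ⟩
    obtain ⟨Γ, h1, h2⟩ := hprim _ (hmul η δ hδ)
    exact ⟨⟨Γ, _, h1⟩, h1, h2⟩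
  choose J hJ hJ0 using hstep
  let F : ℕ → {η : C(I, A) // ∃ δ : C(I, A), HasCurveDeriv 𝕜 η δ} := fun n =>
    Nat.rec ⟨ContinuousMap.const I e, 0, HasCurveDeriv.const e⟩ (fun _ => J) n
  have hF : ∀ n, HasCurveDeriv 𝕜 (F (n + 1)).1 (fun t => m ((F n).1 t) (γ t)) := fun n => hJ (F n)
  have hF0 : ∀ n, (F (n + 1)).1 0 = 0 := fun n => hJ0 (F n)
  have hbound : ∀ (p q : Seminorm 𝕜 A) (C M : ℝ), Continuous p →
      (∀ w : List A, p (foldlLinear m w e) ≤ C * (w.map q).prod) → (∀ t, q (γ t) ≤ M) →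
      0 ≤ C ∧ 0 ≤ M ∧ ∀ n t w, p (foldlLinear m w ((F n).1 t)) ≤
        C * (M ^ n / n.factorial) * (w.map q).prod := by
    intro p q C M hp hC hM
    have hC0 : 0 ≤ C := by simpa [foldlLinear] using (apply_nonneg p _).trans (hC [])
    have hM0 : 0 ≤ M := (apply_nonneg q _).trans (hM 0)
    refine ⟨hC0, hM0, fun n t w => ?_⟩
    refine (seminorm_foldlLinear_iterate_le hm (q := q) (F := fun n => (F n).1) (a := γ) hp hF hF0
      hM (fun t w => hC w) n t w).trans ?_
    have hP0 := map_prod_nonneg q w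
    gcongr
    exact mul_le_of_le_one_right (by positivity) (pow_le_one₀ t.2.1 t.2.2)
  have hlim : ∀ t, ∃ x, Tendsto (fun N => ∑ n ∈ Finset.range N, (F n).1 t) atTop (𝓝 x) := by
    intro t
    refine hsum _ fun p hp => ?_
    obtain ⟨q, hq, C, hC⟩ := hstar p hp
    obtain ⟨M, -, hM⟩ := exists_seminorm_curve_le hq γ
    obtain ⟨-, -, h⟩ := hbound p q C M hp hC hM
    exact ⟨C, M, fun n => by simpa [foldlLinear] using h n t []⟩
  choose H hH using hlim
  -- The constant term has derivative 0, so the derivative of the partial sum with N + 1 terms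
  -- involves only N terms.
  have hderiv : ∀ N, HasCurveDeriv 𝕜 (fun t => ∑ n ∈ Finset.range (N + 1), (F n).1 t)
      (fun t => m (∑ n ∈ Finset.range N, (F n).1 t) (γ t)) := by
    intro N
    have h1 := HasCurveDeriv.sum (Finset.range N) (fun n _ => hF n)
    have h2 := h1.add (HasCurveDeriv.const e)
    convert h2 using 1
    · funext t
      rw [Finset.sum_range_succ']
      rfl
    · funext t
      simp
  have hHd : HasCurveDeriv 𝕜 H (fun t => m (H t) (γ t)) := by
    refine hasCurveDeriv_of_tendsto hderiv (fun t => (hH t).comp (tendsto_add_atTop_nat 1)) ?_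
    intro p hp ε hε
    obtain ⟨q, hq, C, hC⟩ := hstar p hp
    obtain ⟨M, -, hM⟩ := exists_seminorm_curve_le hq γ
    obtain ⟨hC0, hM0, h⟩ := hbound p q C M hp hC hM
    have h3 := (tendsto_sum_pow_div_factorial (C * M) M).const_sub (C * M * Real.exp M)
    rw [sub_self] at h3
    filter_upwards [h3.eventually (gt_mem_nhds hε)] with N hN t
    refine lt_of_le_of_lt ?_ hN
    have h4 : Tendsto (fun N => ∑ n ∈ Finset.range N, m ((F n).1 t) (γ t)) atTop
        (𝓝 (m (H t) (γ t))) := by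
      have := ((hm.tendsto (H t, γ t)).comp ((hH t).prodMk_nhds tendsto_const_nhds))
      refine this.congr fun N => ?_
      simp
    rw [map_sub_rev, map_sum, LinearMap.sum_apply]
    refine seminorm_sub_sum_le hp h4 (mul_nonneg hC0 hM0) hM0 (fun n => ?_) N
    -- The one-letter list estimates the product with γ(t) in the same seminorm `p`; the constant
    -- becomes C M.
    have h5 := h n t [γ t]
    rw [List.map_singleton, List.prod_singleton] at h5
    refine h5.trans ?_
    calc C * (M ^ n / n.factorial) * q (γ t) ≤ C * (M ^ n / n.factorial) * M := by
          gcongr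
          exact hM t
      _ = C * M * (M ^ n / n.factorial) := by ring
  refine ⟨⟨H, hHd.continuous⟩, ?_, hHd, ?_⟩
  · refine tendsto_nhds_unique (hH 0) ?_
    refine tendsto_const_nhds.congr' ?_
    filter_upwards [eventually_ge_atTop 1] with N hN
    obtain ⟨k, rfl⟩ := Nat.exists_eq_add_of_le' hN
    rw [Finset.sum_range_succ', Finset.sum_eq_zero fun n _ => hF0 n, zero_add]
    rfl
  · intro p q C M hp hq hC hM t
    obtain ⟨hC0, hM0, h⟩ := hbound p q C M hp hC hM
    -- Taking N = 1 removes F₀ = e on the left and the leading 1 of the exponential series on the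
    -- right.
    have := seminorm_sub_sum_le hp (hH t) hC0 hM0
      (fun n => by simpa [foldlLinear] using h n t []) 1
    have e1 : (F 0).1 t = e := rfl
    simpa [e1, mul_sub] using this

end Picard

/-! ### Evolutions in an algebra: existence, inverses, variation of constants, continuity. -/

section Ring

variable {𝕜 : Type*} [RCLike 𝕜] {A : Type*} [Ring A] [Algebra 𝕜 A] [TopologicalSpace A]
  [IsTopologicalRing A] [ContinuousSMul 𝕜 A]

theorem HasCurveDeriv.mul {γ δ γ' δ' : I → A} (h : HasCurveDeriv 𝕜 γ δ)
    (h' : HasCurveDeriv 𝕜 γ' δ') : HasCurveDeriv 𝕜 (γ * γ') (δ * γ' + γ * δ') :=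
  h.bilinear h' (LinearMap.mul 𝕜 A) continuous_mul

theorem foldlLinear_mul (w : List A) (x : A) :
    foldlLinear (LinearMap.mul 𝕜 A) w x = x * w.prod := by
  induction w generalizing x with
  | nil => simp [foldlLinear]
  | cons a w ih => rw [foldlLinear_cons, ih]; simp [mul_assoc]

theorem foldlLinear_mul_flip (w : List A) (x : A) :
    foldlLinear (LinearMap.mul 𝕜 A).flip w x = w.reverse.prod * x := by
  induction w generalizing x with
  | nil => simp [foldlLinear]
  | cons a w ih => rw [foldlLinear_cons, ih]; simp [mul_assoc]

/-- The seminorm `p` is dominated by the product of the values of `q`, up to the factor `C`. -/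
def ProdBound (p q : Seminorm 𝕜 A) (C : ℝ) : Prop :=
  ∀ w : List A, p w.prod ≤ C * (w.map q).prod

/-- A space `L` of curves in an algebra `A` for which linear initial value problems can be solved
by Picard iteration. -/
structure IsPicardSpace (L : Submodule 𝕜 C(I, A)) : Prop where
  prodBound : ∀ p : Seminorm 𝕜 A, Continuous p →
    ∃ q : Seminorm 𝕜 A, Continuous q ∧ ∃ C : ℝ, ProdBound p q C
  units_mem : {a : A | IsUnit a} ∈ 𝓝 (1 : A)
  summable : FactorialSummable 𝕜 A
  exists_primitive : ∀ γ ∈ L, ∃ Γ : C(I, A), HasCurveDeriv 𝕜 Γ γ ∧ Γ 0 = 0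
  mul_mem : ∀ {η δ γ : C(I, A)}, HasCurveDeriv 𝕜 η δ → γ ∈ L → η * γ ∈ L
  mem_mul : ∀ {η δ γ : C(I, A)}, HasCurveDeriv 𝕜 η δ → γ ∈ L → γ * η ∈ L

variable (𝕜) in
/-- The evolution of a continuous curve (arbitrary if it does not exist). -/
def evol (γ : C(I, A)) : C(I, A) :=
  Classical.epsilon fun η : C(I, A) => η 0 = 1 ∧ HasCurveDeriv 𝕜 η (η * γ : C(I, A))

variable (𝕜) in
/-- The inverse of the evolution of a continuous curve. -/
def evolInv (γ : C(I, A)) : C(I, A) := Ring.inverse (evol 𝕜 γ)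

variable (𝕜) in
/-- The primitive of a continuous curve that vanishes at `0` (arbitrary if it does not exist). -/
def primitive (γ : C(I, A)) : C(I, A) :=
  Classical.epsilon fun Γ : C(I, A) => HasCurveDeriv 𝕜 Γ γ ∧ Γ 0 = 0

variable (𝕜) in
/-- The solution of `u' = u γ + g`, `u(0) = 0`. -/
def solve (γ g : C(I, A)) : C(I, A) := primitive 𝕜 (g * evolInv 𝕜 γ) * evol 𝕜 γ

variable (𝕜) in
/-- The iterated integrals of a list of curves, relative to the curve `γ`. -/
def iterSolve (γ : C(I, A)) : List C(I, A) → C(I, A)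
  | [] => evol 𝕜 γ
  | y :: w => solve 𝕜 γ (iterSolve γ w * y)

variable (𝕜) in
/-- The derivative of `iterSolve γ w`. -/
def iterSolveDeriv (γ : C(I, A)) : List C(I, A) → C(I, A)
  | [] => evol 𝕜 γ * γ
  | y :: w => iterSolve 𝕜 γ (y :: w) * γ + iterSolve 𝕜 γ w * y

variable [PolynormableSpace 𝕜 A] [T2Space A] {L : Submodule 𝕜 C(I, A)}

namespace IsPicardSpace

theorem exists_evol (hL : IsPicardSpace L) {γ : C(I, A)} (hγ : γ ∈ L) :
    ∃ η : C(I, A), (η 0 = 1 ∧ HasCurveDeriv 𝕜 η (η * γ : C(I, A))) ∧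
      ∀ (p q : Seminorm 𝕜 A) (C M : ℝ), Continuous p → Continuous q → ProdBound p q C →
        (∀ t, q (γ t) ≤ M) → ∀ t, p (η t - 1) ≤ C * (Real.exp M - 1) := by
  obtain ⟨η, h0, h1, h2⟩ := exists_linear_ode_solution (m := LinearMap.mul 𝕜 A) continuous_mul 1
    (by simpa only [foldlLinear_mul, one_mul, ProdBound] using hL.prodBound) hL.summable
    hL.exists_primitive
    (fun η δ h => hL.mul_mem h hγ)
  refine ⟨η, ⟨h0, h1⟩, ?_⟩
  simpa only [foldlLinear_mul, one_mul, ProdBound] using h2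

/-- The real factors q(a) commute, so the bound also serves the opposite multiplication. -/
theorem _root_.CIA.ProdBound.reverse {p q : Seminorm 𝕜 A} {C : ℝ} (h : ProdBound p q C)
    (w : List A) :
    p w.reverse.prod ≤ C * (w.map q).prod := by
  have := h w.reverse
  rwa [List.map_reverse, (List.reverse_perm (w.map q)).prod_eq] at this

/-- The same Picard scheme for the opposite multiplication. Applied to -γ it yields the inverse of
the evolution. -/
theorem exists_evol_left (hL : IsPicardSpace L) {γ : C(I, A)} (hγ : γ ∈ L) :
    ∃ θ : C(I, A), (θ 0 = 1 ∧ HasCurveDeriv 𝕜 θ (γ * θ : C(I, A))) ∧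
      ∀ (p q : Seminorm 𝕜 A) (C M : ℝ), Continuous p → Continuous q → ProdBound p q C →
        (∀ t, q (γ t) ≤ M) → ∀ t, p (θ t - 1) ≤ C * (Real.exp M - 1) := by
  have hm : Continuous fun z : A × A => (LinearMap.mul 𝕜 A).flip z.1 z.2 :=
    continuous_snd.mul continuous_fst
  obtain ⟨η, h0, h1, h2⟩ := exists_linear_ode_solution (m := (LinearMap.mul 𝕜 A).flip) hm 1
    (fun p hp => by
      obtain ⟨q, hq, C, hC⟩ := hL.prodBound p hp
      refine ⟨q, hq, C, fun w => ?_⟩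
      rw [foldlLinear_mul_flip, mul_one]
      exact ProdBound.reverse hC w) hL.summable hL.exists_primitive
    (fun η δ h => hL.mem_mul h hγ)
  refine ⟨η, ⟨h0, h1⟩, fun p q C M hp hq hC => h2 p q C M hp hq fun w => ?_⟩
  rw [foldlLinear_mul_flip, mul_one]
  exact ProdBound.reverse hC w

theorem primitive_spec (hL : IsPicardSpace L) {γ : C(I, A)} (hγ : γ ∈ L) :
    HasCurveDeriv 𝕜 (primitive 𝕜 γ) γ ∧ primitive 𝕜 γ 0 = 0 :=
  Classical.epsilon_spec (hL.exists_primitive γ hγ)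

theorem evol_spec (hL : IsPicardSpace L) {γ : C(I, A)} (hγ : γ ∈ L) :
    evol 𝕜 γ 0 = 1 ∧ HasCurveDeriv 𝕜 (evol 𝕜 γ) (evol 𝕜 γ * γ : C(I, A)) :=
  Classical.epsilon_spec (p := fun η : C(I, A) => η 0 = 1 ∧ HasCurveDeriv 𝕜 η (η * γ : C(I, A)))
    ⟨_, (hL.exists_evol hγ).choose_spec.1⟩

/-- A solution of the equation for the evolution is inverse to a solution of the adjoint
equation. -/
theorem mul_eq_one_of_hasCurveDeriv (hL : IsPicardSpace L) {γ η θ : C(I, A)} (hη0 : η 0 = 1)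
    (hη : HasCurveDeriv 𝕜 η (η * γ : C(I, A))) (hθ0 : θ 0 = 1)
    (hθ : HasCurveDeriv 𝕜 θ (-γ * θ : C(I, A))) : η * θ = 1 ∧ θ * η = 1 := by
  have h1 : ∀ t, η t * θ t = 1 := by
    intro t
    have hd := hη.mul hθ
    have e : (⇑(η * γ) * ⇑θ + ⇑η * ⇑(-γ * θ) : I → A) = 0 := by
      funext t; simp [mul_assoc]
    rw [e] at hd
    simpa [hη0, hθ0] using hd.eq_of_deriv_zero 0 t
  refine ⟨ContinuousMap.ext h1, ContinuousMap.ext ?_⟩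
  -- From ηθ = 1 alone, θη is merely idempotent. An invertible idempotent is 1 and the units form a
  -- neighbourhood of 1, so the set where θη = 1 is open as well as closed; it contains 0 and the
  -- interval is connected.
  have hcl : IsClosed {t : I | θ t * η t = 1} := isClosed_eq (by fun_prop) (by fun_prop)
  have hop : IsOpen {t : I | θ t * η t = 1} := by
    rw [isOpen_iff_mem_nhds]
    intro t ht
    have ht : θ t * η t = 1 := ht
    have hc : Tendsto (fun s => θ s * η s) (𝓝 t) (𝓝 1) := by
      rw [← ht]
      exact Continuous.tendsto (by fun_prop) t
    filter_upwards [hc hL.units_mem] with s hs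
    have hs : IsUnit (θ s * η s) := hs
    refine hs.mul_left_cancel ?_
    rw [mul_one, mul_assoc, ← mul_assoc (η s), h1, one_mul]
  have := IsClopen.eq_univ ⟨hcl, hop⟩ ⟨0, show θ 0 * η 0 = 1 by simp [hη0, hθ0]⟩
  intro t
  exact (Set.ext_iff.1 this t).2 trivial

/-- The pointwise inverse coincides with the Picard solution of the adjoint equation, from which it
inherits its derivative and the exponential bound. -/
theorem evolInv_spec (hL : IsPicardSpace L) {γ : C(I, A)} (hγ : γ ∈ L) :
    evol 𝕜 γ * evolInv 𝕜 γ = 1 ∧ evolInv 𝕜 γ * evol 𝕜 γ = 1 ∧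
      HasCurveDeriv 𝕜 (evolInv 𝕜 γ) (-γ * evolInv 𝕜 γ : C(I, A)) ∧
      ∀ (p q : Seminorm 𝕜 A) (C M : ℝ), Continuous p → Continuous q → ProdBound p q C →
        (∀ t, q (γ t) ≤ M) → ∀ t, p (evolInv 𝕜 γ t - 1) ≤ C * (Real.exp M - 1) := by
  obtain ⟨h0, h1⟩ := hL.evol_spec hγ
  obtain ⟨θ, ⟨hθ0, hθ⟩, hb⟩ := hL.exists_evol_left (L.neg_mem hγ)
  obtain ⟨h2, h3⟩ := hL.mul_eq_one_of_hasCurveDeriv h0 h1 hθ0 hθ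
  have e : evolInv 𝕜 γ = θ := by
    have hu : evol 𝕜 γ = ((⟨evol 𝕜 γ, θ, h2, h3⟩ : (C(I, A))ˣ) : C(I, A)) := rfl
    rw [evolInv, hu, Ring.inverse_unit]
    rfl
  rw [e]
  exact ⟨h2, h3, hθ, fun p q C M hp hq hC hM => hb p q C M hp hq hC fun t => by simpa using hM t⟩

theorem evolInv_mul_evol (hL : IsPicardSpace L) {γ : C(I, A)} (hγ : γ ∈ L) (x : C(I, A)) :
    x * evolInv 𝕜 γ * evol 𝕜 γ = x := by
  rw [mul_assoc, (hL.evolInv_spec hγ).2.1, mul_one]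

theorem mul_evolInv_mem (hL : IsPicardSpace L) {γ g : C(I, A)} (hγ : γ ∈ L) (hg : g ∈ L) :
    g * evolInv 𝕜 γ ∈ L :=
  hL.mem_mul (hL.evolInv_spec hγ).2.2.1 hg

/-- The curve u E⁻¹, with E the evolution of γ, has derivative uγE⁻¹ - uγE⁻¹ = 0 and is therefore
constant. All uniqueness statements rest on this. -/
theorem eq_mul_evol (hL : IsPicardSpace L) {γ u : C(I, A)} (hγ : γ ∈ L)
    (hu : HasCurveDeriv 𝕜 u (u * γ : C(I, A))) : u = ContinuousMap.const I (u 0) * evol 𝕜 γ := by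
  obtain ⟨h1, h2, h3, -⟩ := hL.evolInv_spec hγ
  have hd := hu.mul h3
  have e : (⇑(u * γ) * ⇑(evolInv 𝕜 γ) + ⇑u * ⇑(-γ * evolInv 𝕜 γ) : I → A) = 0 := by
    funext t; simp [mul_assoc]
  rw [e] at hd
  have h0 : evolInv 𝕜 γ 0 = 1 := by
    have := DFunLike.congr_fun h1 0
    simpa [(hL.evol_spec hγ).1] using this
  have h4 : u * evolInv 𝕜 γ = ContinuousMap.const I (u 0) := by
    ext t
    simpa [h0] using hd.eq_of_deriv_zero 0 t
  rw [← h4, hL.evolInv_mul_evol hγ]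

theorem evol_unique (hL : IsPicardSpace L) {γ u : C(I, A)} (hγ : γ ∈ L)
    (hu : HasCurveDeriv 𝕜 u (u * γ : C(I, A))) (hu0 : u 0 = 1) : u = evol 𝕜 γ := by
  rw [hL.eq_mul_evol hγ hu, hu0]
  exact one_mul _

theorem evol_bound (hL : IsPicardSpace L) {γ : C(I, A)} (hγ : γ ∈ L) {p q : Seminorm 𝕜 A} {C M : ℝ}
    (hp : Continuous p) (hq : Continuous q) (hC : ProdBound p q C) (hM : ∀ t, q (γ t) ≤ M) (t : I) :
    p (evol 𝕜 γ t - 1) ≤ C * (Real.exp M - 1) := by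
  obtain ⟨η, ⟨h0, h1⟩, hb⟩ := hL.exists_evol hγ
  rw [← hL.evol_unique hγ h1 h0]
  exact hb p q C M hp hq hC hM t

/-- Variation of constants: for u = PE with P' = gE⁻¹, the product rule gives P'E = g and PE' = uγ.
-/
theorem solve_hasCurveDeriv (hL : IsPicardSpace L) {γ g : C(I, A)} (hγ : γ ∈ L) (hg : g ∈ L) :
    HasCurveDeriv 𝕜 (solve 𝕜 γ g) (solve 𝕜 γ g * γ + g : C(I, A)) := by
  have h := (hL.primitive_spec (hL.mul_evolInv_mem hγ hg)).1.mul (hL.evol_spec hγ).2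
  have e : (⇑(g * evolInv 𝕜 γ) * ⇑(evol 𝕜 γ) + ⇑(primitive 𝕜 (g * evolInv 𝕜 γ)) *
      ⇑(evol 𝕜 γ * γ) : I → A) = ⇑(solve 𝕜 γ g * γ + g) := by
    funext t
    have e0 := DFunLike.congr_fun (hL.evolInv_mul_evol hγ g) t
    rw [ContinuousMap.mul_apply, ContinuousMap.mul_apply, mul_assoc] at e0
    simp [solve, e0, mul_assoc, add_comm]
  rw [e] at h
  exact h

theorem solve_zero (hL : IsPicardSpace L) {γ g : C(I, A)} (hγ : γ ∈ L) (hg : g ∈ L) :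
    solve 𝕜 γ g 0 = 0 := by
  simp [solve, (hL.primitive_spec (hL.mul_evolInv_mem hγ hg)).2]

theorem solve_unique (hL : IsPicardSpace L) {γ g u : C(I, A)} (hγ : γ ∈ L) (hg : g ∈ L)
    (hu : HasCurveDeriv 𝕜 u (u * γ + g : C(I, A))) (hu0 : u 0 = 0) : u = solve 𝕜 γ g := by
  have h := hu.sub (hL.solve_hasCurveDeriv hγ hg)
  have e : (⇑(u * γ + g) - ⇑(solve 𝕜 γ g * γ + g) : I → A) = ⇑((u - solve 𝕜 γ g) * γ) := by
    funext t
    simp [sub_mul]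
  rw [e] at h
  have := hL.eq_mul_evol (u := u - solve 𝕜 γ g) hγ h
  rw [ContinuousMap.sub_apply, hu0, hL.solve_zero hγ hg, sub_zero] at this
  refine sub_eq_zero.1 (this.trans ?_)
  ext t
  simp

theorem solve_add (hL : IsPicardSpace L) {γ g h : C(I, A)} (hγ : γ ∈ L) (hg : g ∈ L) (hh : h ∈ L) :
    solve 𝕜 γ (g + h) = solve 𝕜 γ g + solve 𝕜 γ h := by
  refine (hL.solve_unique hγ (L.add_mem hg hh) ?_ ?_).symm
  · have := (hL.solve_hasCurveDeriv hγ hg).add (hL.solve_hasCurveDeriv hγ hh)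
    convert! this using 1
    funext t
    simp [add_mul]
    abel
  · simp [hL.solve_zero hγ hg, hL.solve_zero hγ hh]

theorem solve_smul (hL : IsPicardSpace L) {γ g : C(I, A)} (hγ : γ ∈ L) (hg : g ∈ L) (c : 𝕜) :
    solve 𝕜 γ (c • g) = c • solve 𝕜 γ g := by
  refine (hL.solve_unique hγ (L.smul_mem c hg) ?_ ?_).symm
  · have := (hL.solve_hasCurveDeriv hγ hg).const_smul c
    convert! this using 1
    funext t
    simp
  · simp [hL.solve_zero hγ hg]

theorem iterSolve_hasCurveDeriv (hL : IsPicardSpace L) {γ : C(I, A)} (hγ : γ ∈ L) (w : List C(I, A))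
    (hw : ∀ y ∈ w, y ∈ L) : HasCurveDeriv 𝕜 (iterSolve 𝕜 γ w) (iterSolveDeriv 𝕜 γ w) := by
  induction w with
  | nil => exact (hL.evol_spec hγ).2
  | cons y w ih =>
    exact hL.solve_hasCurveDeriv hγ
      (hL.mul_mem (ih fun y hy => hw y (by simp [hy])) (hw y (by simp)))

theorem iterSolve_mul_mem (hL : IsPicardSpace L) {γ y : C(I, A)} (hγ : γ ∈ L) {w : List C(I, A)}
    (hw : ∀ y ∈ w, y ∈ L) (hy : y ∈ L) : iterSolve 𝕜 γ w * y ∈ L :=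
  hL.mul_mem (hL.iterSolve_hasCurveDeriv hγ w hw) hy

/-! ### Continuity -/

section Continuity

variable {ι : Type*} {l : Filter ι}

theorem tendsto_primitive (hL : IsPicardSpace L) {F : ι → C(I, A)} {γ : C(I, A)}
    (hF : Tendsto F l (𝓝 γ)) (hFL : ∀ i, F i ∈ L) (hγ : γ ∈ L) :
    Tendsto (fun i => primitive 𝕜 (F i)) l (𝓝 (primitive 𝕜 γ)) := by
  rw [tendsto_curve_iff_seminorm 𝕜] at hF ⊢
  intro p hp ε hε
  filter_upwards [hF p hp (ε / 2) (half_pos hε)] with i hi t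
  have h := ((hL.primitive_spec (hFL i)).1.sub (hL.primitive_spec hγ).1).seminorm_sub_le_mul hp
    (a := 0) (b := t) t.2.1 (M := ε / 2) (fun s _ _ => (hi s).le)
  simp only [Pi.sub_apply, (hL.primitive_spec (hFL i)).2, (hL.primitive_spec hγ).2, sub_zero] at h
  have : ε / 2 * ((t : ℝ) - (0 : I)) ≤ ε / 2 * 1 := by
    gcongr
    simpa using t.2.2
  linarith

/-- The Picard bound C(exp M - 1) is small when M is, uniformly on the interval, both for the
evolution and for its inverse. -/
theorem tendsto_evol_zero (hL : IsPicardSpace L) {F : ι → C(I, A)}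
    (hF : Tendsto F l (𝓝 0)) (hFL : ∀ i, F i ∈ L) :
    Tendsto (fun i => evol 𝕜 (F i)) l (𝓝 1) ∧ Tendsto (fun i => evolInv 𝕜 (F i)) l (𝓝 1) := by
  have key : ∀ p : Seminorm 𝕜 A, Continuous p → ∀ ε > 0, ∃ q : Seminorm 𝕜 A, Continuous q ∧
      ∃ C δ : ℝ, 0 < δ ∧ ProdBound p q C ∧ C * (Real.exp δ - 1) < ε := by
    intro p hp ε hε
    obtain ⟨q, hq, C, hC⟩ := hL.prodBound p hp
    have h1 : Tendsto (fun δ => C * (Real.exp δ - 1)) (𝓝[>] 0) (𝓝 0) := by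
      have : Continuous fun δ => C * (Real.exp δ - 1) := by fun_prop
      simpa using (this.tendsto 0).mono_left nhdsWithin_le_nhds
    obtain ⟨δ, h2, hδ⟩ := ((h1.eventually (gt_mem_nhds hε)).and self_mem_nhdsWithin).exists
    exact ⟨q, hq, C, δ, hδ, hC, h2⟩
  rw [tendsto_curve_iff_seminorm 𝕜] at hF
  constructor
  · rw [tendsto_curve_iff_seminorm 𝕜]
    intro p hp ε hε
    obtain ⟨q, hq, C, δ, hδ, hC, hlt⟩ := key p hp ε hε
    filter_upwards [hF q hq δ hδ] with i hi t
    exact (hL.evol_bound (hFL i) hp hq hC (fun t => by simpa using (hi t).le) t).trans_lt hlt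
  · rw [tendsto_curve_iff_seminorm 𝕜]
    intro p hp ε hε
    obtain ⟨q, hq, C, δ, hδ, hC, hlt⟩ := key p hp ε hε
    filter_upwards [hF q hq δ hδ] with i hi t
    exact ((hL.evolInv_spec (hFL i)).2.2.2 p q C δ hp hq hC
      (fun t => by simpa using (hi t).le) t).trans_lt hlt

theorem conj_mem (hL : IsPicardSpace L) {γ y : C(I, A)} (hγ : γ ∈ L) (hy : y ∈ L) :
    evol 𝕜 γ * y * evolInv 𝕜 γ ∈ L :=
  hL.mul_evolInv_mem hγ (hL.mul_mem (hL.evol_spec hγ).2 hy)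

/-- The cocycle identity of the evolution. As y ↦ E y E⁻¹ is continuous and linear, it transports
continuity of the evolution from 0 to every γ. -/
theorem evol_add (hL : IsPicardSpace L) {γ y : C(I, A)} (hγ : γ ∈ L) (hy : y ∈ L) :
    evol 𝕜 (γ + y) = evol 𝕜 (evol 𝕜 γ * y * evolInv 𝕜 γ) * evol 𝕜 γ := by
  have hc := hL.conj_mem hγ hy
  refine (hL.evol_unique (L.add_mem hγ hy) ?_ ?_).symm
  · have h := (hL.evol_spec hc).2.mul (hL.evol_spec hγ).2
    have e : evol 𝕜 (evol 𝕜 γ * y * evolInv 𝕜 γ) * (evol 𝕜 γ * y * evolInv 𝕜 γ) * evol 𝕜 γ +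
        evol 𝕜 (evol 𝕜 γ * y * evolInv 𝕜 γ) * (evol 𝕜 γ * γ) =
        evol 𝕜 (evol 𝕜 γ * y * evolInv 𝕜 γ) * evol 𝕜 γ * (γ + y) := by
      rw [← mul_assoc (evol 𝕜 (evol 𝕜 γ * y * evolInv 𝕜 γ)) _ (evolInv 𝕜 γ),
        hL.evolInv_mul_evol hγ, mul_add, add_comm]
      simp only [mul_assoc]
    rw [← e]
    exact h
  · simp [(hL.evol_spec hc).1, (hL.evol_spec hγ).1]

theorem evolInv_add (hL : IsPicardSpace L) {γ y : C(I, A)} (hγ : γ ∈ L) (hy : y ∈ L) :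
    evolInv 𝕜 (γ + y) = evolInv 𝕜 γ * evolInv 𝕜 (evol 𝕜 γ * y * evolInv 𝕜 γ) := by
  have hc := hL.conj_mem hγ hy
  have h1 := hL.evolInv_mul_evol (L.add_mem hγ hy)
    (evolInv 𝕜 γ * evolInv 𝕜 (evol 𝕜 γ * y * evolInv 𝕜 γ))
  have h2 := (hL.evolInv_spec (L.add_mem hγ hy)).1
  calc evolInv 𝕜 (γ + y) = evolInv 𝕜 γ * (evolInv 𝕜 (evol 𝕜 γ * y * evolInv 𝕜 γ) *
        evol 𝕜 (evol 𝕜 γ * y * evolInv 𝕜 γ)) * evol 𝕜 γ * evolInv 𝕜 (γ + y) := by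
        rw [(hL.evolInv_spec hc).2.1, mul_one, (hL.evolInv_spec hγ).2.1, one_mul]
    _ = evolInv 𝕜 γ * evolInv 𝕜 (evol 𝕜 γ * y * evolInv 𝕜 γ) *
        (evol 𝕜 (γ + y) * evolInv 𝕜 (γ + y)) := by
        rw [hL.evol_add hγ hy]
        simp only [mul_assoc]
    _ = _ := by rw [h2, mul_one]

theorem tendsto_evol (hL : IsPicardSpace L) {F : ι → C(I, A)} {γ : C(I, A)}
    (hF : Tendsto F l (𝓝 γ)) (hFL : ∀ i, F i ∈ L) (hγ : γ ∈ L) :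
    Tendsto (fun i => evol 𝕜 (F i)) l (𝓝 (evol 𝕜 γ)) ∧
      Tendsto (fun i => evolInv 𝕜 (F i)) l (𝓝 (evolInv 𝕜 γ)) := by
  have h1 : Tendsto (fun i => evol 𝕜 γ * (F i - γ) * evolInv 𝕜 γ) l (𝓝 0) := by
    have := ((hF.sub_const γ).const_mul (evol 𝕜 γ)).mul_const (evolInv 𝕜 γ)
    simpa using this
  obtain ⟨h2, h3⟩ := hL.tendsto_evol_zero h1 fun i => hL.conj_mem hγ (L.sub_mem (hFL i) hγ)
  constructor
  · have := h2.mul_const (evol 𝕜 γ)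
    rw [one_mul] at this
    refine this.congr fun i => ?_
    rw [← hL.evol_add hγ (L.sub_mem (hFL i) hγ), add_sub_cancel]
  · have := h3.const_mul (evolInv 𝕜 γ)
    rw [mul_one] at this
    refine this.congr fun i => ?_
    rw [← hL.evolInv_add hγ (L.sub_mem (hFL i) hγ), add_sub_cancel]

theorem tendsto_solve (hL : IsPicardSpace L) {F G : ι → C(I, A)} {γ g : C(I, A)}
    (hF : Tendsto F l (𝓝 γ)) (hFL : ∀ i, F i ∈ L) (hγ : γ ∈ L)
    (hG : Tendsto G l (𝓝 g)) (hGL : ∀ i, G i ∈ L) (hg : g ∈ L) :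
    Tendsto (fun i => solve 𝕜 (F i) (G i)) l (𝓝 (solve 𝕜 γ g)) :=
  (hL.tendsto_primitive (hG.mul (hL.tendsto_evol hF hFL hγ).2)
    (fun i => hL.mul_evolInv_mem (hFL i) (hGL i)) (hL.mul_evolInv_mem hγ hg)).mul
    (hL.tendsto_evol hF hFL hγ).1

/-- Each entry of `w` pairs a family with its limit, so that one induction on the list handles both.
-/
theorem tendsto_iterSolve (hL : IsPicardSpace L) {F : ι → C(I, A)} {γ : C(I, A)}
    (hF : Tendsto F l (𝓝 γ)) (hFL : ∀ i, F i ∈ L) (hγ : γ ∈ L) (w : List ((ι → C(I, A)) × C(I, A)))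
    (hw : ∀ y ∈ w, Tendsto y.1 l (𝓝 y.2) ∧ (∀ i, y.1 i ∈ L) ∧ y.2 ∈ L) :
    Tendsto (fun i => iterSolve 𝕜 (F i) (w.map fun y => y.1 i)) l
      (𝓝 (iterSolve 𝕜 γ (w.map Prod.snd))) := by
  induction w with
  | nil => exact (hL.tendsto_evol hF hFL hγ).1
  | cons y w ih =>
    have hw' : ∀ y ∈ w, Tendsto y.1 l (𝓝 y.2) ∧ (∀ i, y.1 i ∈ L) ∧ y.2 ∈ L :=
      fun y hy => hw y (by simp [hy])
    obtain ⟨h1, h2, h3⟩ := hw y (by simp)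
    refine hL.tendsto_solve hF hFL hγ ((ih hw').mul h1) (fun i => ?_) ?_
    · refine hL.iterSolve_mul_mem (hFL i) ?_ (h2 i)
      intro z hz
      obtain ⟨u, hu, rfl⟩ := List.mem_map.1 hz
      exact (hw' u hu).2.1 i
    · refine hL.iterSolve_mul_mem hγ ?_ h3
      intro z hz
      obtain ⟨u, hu, rfl⟩ := List.mem_map.1 hz
      exact (hw' u hu).2.2

end Continuity

end IsPicardSpace

end Ring

/-! ### The topology on spaces of differentiable curves. -/

section CrSpaces

variable {𝕜 : Type*} [RCLike 𝕜] {E : Type*} [AddCommGroup E] [Module 𝕜 E] [TopologicalSpace E]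
  [IsTopologicalAddGroup E] [ContinuousSMul 𝕜 E]

theorem HasCurveDeriv.curveDeriv_eq [T2Space E] {γ δ : C(I, E)} (h : HasCurveDeriv 𝕜 γ δ) :
    curveDeriv 𝕜 γ = δ := by
  have h1 : ∃ δ : C(I, E), HasCurveDeriv 𝕜 γ δ := ⟨δ, h⟩
  rw [curveDeriv, dif_pos h1]
  exact DFunLike.coe_injective (h1.choose_spec.unique h)

variable (𝕜 E) in
/-- The inclusion of `C^r`-curves into continuous curves. -/
def CrCurve.toCurveLinear (r k : ℕ∞) : CrCurve 𝕜 E r k →ₗ[𝕜] C(I, E) := (crSubmodule 𝕜 E r).subtype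

theorem CrCurve.toCurveLinear_apply {r k : ℕ∞} (γ : CrCurve 𝕜 E r k) :
    CrCurve.toCurveLinear 𝕜 E r k γ = γ.toCurve := rfl

theorem CrCurve.toCurve_injective {r k : ℕ∞} :
    Function.Injective (CrCurve.toCurve : CrCurve 𝕜 E r k → C(I, E)) := Subtype.val_injective

theorem CrCurve.continuous_toCurve {r k : ℕ∞} :
    Continuous (CrCurve.toCurve : CrCurve 𝕜 E r k → C(I, E)) :=
  continuous_pi_iff.1 (continuous_induced_dom (f := fun (γ : CrCurve 𝕜 E r k)
    (j : {j : ℕ // (j : ℕ∞) ≤ k}) => (curveDeriv 𝕜)^[j.1] γ.toCurve)) ⟨0, by simp⟩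

theorem CrCurve.hasCurveDeriv {r k : ℕ∞} (hr : 1 ≤ r) (γ : CrCurve 𝕜 E r k) :
    HasCurveDeriv 𝕜 γ.toCurve (curveDeriv 𝕜 γ.toCurve) := by
  obtain ⟨δ, h0, h1⟩ := γ.2
  have h : ∃ δ : C(I, E), HasCurveDeriv 𝕜 γ.toCurve δ := by
    have h2 := h1 0 (lt_of_lt_of_le (by simp) hr)
    rw [h0] at h2
    exact ⟨_, h2⟩
  rw [curveDeriv, dif_pos h]
  exact h.choose_spec

/-- A `C¹`-curve, given by the curve and its derivative. -/
def CrSpace.mk₁ (γ δ : C(I, E)) (h : HasCurveDeriv 𝕜 γ δ) : CrSpace 𝕜 E 1 :=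
  -- For r = 1 only the entries 0 and 1 of the sequence of derivatives are constrained; the later
  -- ones are filler.
  ⟨γ, fun j => if j = 0 then γ else δ, if_pos rfl, fun j hj => by
    have : j = 0 := by
      have : j < 1 := by exact_mod_cast hj
      omega
    subst this
    simpa using h⟩

theorem CrSpace.continuous_curveDeriv :
    Continuous fun γ : CrSpace 𝕜 E 1 => curveDeriv 𝕜 γ.toCurve :=
  continuous_pi_iff.1 (continuous_induced_dom (f := fun (γ : CrSpace 𝕜 E 1)
    (j : {j : ℕ // (j : ℕ∞) ≤ 1}) => (curveDeriv 𝕜)^[j.1] γ.toCurve)) ⟨1, by simp⟩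

theorem CrSpace.tendsto_nhds {ι : Type*} {l : Filter ι} {F : ι → CrSpace 𝕜 E 1}
    {f : CrSpace 𝕜 E 1} (h0 : Tendsto (fun i => (F i).toCurve) l (𝓝 f.toCurve))
    (h1 : Tendsto (fun i => curveDeriv 𝕜 (F i).toCurve) l (𝓝 (curveDeriv 𝕜 f.toCurve))) :
    Tendsto F l (𝓝 f) := by
  rw [nhds_induced, tendsto_comap_iff, tendsto_pi_nhds]
  rintro ⟨j, hj⟩
  have hj : j ≤ 1 := by exact_mod_cast hj
  interval_cases j
  · exact h0
  · exact h1

end CrSpaces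

/-! ### Smoothness of the endpoint of the evolution. -/

section Evolution

variable {𝕜 : Type*} [RCLike 𝕜] {A : Type*} [Ring A] [Algebra 𝕜 A] [TopologicalSpace A]
  [IsTopologicalRing A] [ContinuousSMul 𝕜 A] [PolynormableSpace 𝕜 A] [T2Space A]
  {L : Submodule 𝕜 C(I, A)}

namespace IsPicardSpace

/-! ### Directional derivatives -/

/-- The difference of two solutions solves the equation for γ again, with the perturbation as
inhomogeneity. After division by the increment the right side converges by continuity of `solve`, so
differentiability follows from continuity. -/
theorem iterSolve_cons_sub (hL : IsPicardSpace L) {γ γ' y : C(I, A)} (hγ : γ ∈ L) (hγ' : γ' ∈ L)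
    (hy : y ∈ L) {w : List C(I, A)} (hw : ∀ y ∈ w, y ∈ L) :
    iterSolve 𝕜 γ' (y :: w) - iterSolve 𝕜 γ (y :: w) = solve 𝕜 γ
      (iterSolve 𝕜 γ' (y :: w) * (γ' - γ) + (iterSolve 𝕜 γ' w - iterSolve 𝕜 γ w) * y) := by
  have hyw : ∀ z ∈ y :: w, z ∈ L := by simpa using ⟨hy, hw⟩
  have h1 := hL.iterSolve_mul_mem hγ' hw hy
  have h2 := hL.iterSolve_mul_mem hγ hw hy
  refine hL.solve_unique hγ ?_ ?_ ?_
  · rw [sub_mul]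
    exact L.add_mem (hL.iterSolve_mul_mem hγ' hyw (L.sub_mem hγ' hγ)) (L.sub_mem h1 h2)
  · have h := (hL.iterSolve_hasCurveDeriv hγ' _ hyw).sub (hL.iterSolve_hasCurveDeriv hγ _ hyw)
    have e : iterSolveDeriv 𝕜 γ' (y :: w) - iterSolveDeriv 𝕜 γ (y :: w) =
        (iterSolve 𝕜 γ' (y :: w) - iterSolve 𝕜 γ (y :: w)) * γ +
        (iterSolve 𝕜 γ' (y :: w) * (γ' - γ) + (iterSolve 𝕜 γ' w - iterSolve 𝕜 γ w) * y) := by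
      simp only [iterSolveDeriv, sub_mul, mul_sub]
      abel
    rw [← e]
    exact h
  · have e1 := hL.solve_zero hγ' h1
    have e2 := hL.solve_zero hγ h2
    simp only [iterSolve, ContinuousMap.sub_apply, e1, e2, sub_zero]

theorem evol_sub (hL : IsPicardSpace L) {γ γ' : C(I, A)} (hγ : γ ∈ L) (hγ' : γ' ∈ L) :
    evol 𝕜 γ' - evol 𝕜 γ = solve 𝕜 γ (evol 𝕜 γ' * (γ' - γ)) := by
  have h1 := (hL.evol_spec hγ').2
  have h2 := (hL.evol_spec hγ).2
  refine hL.solve_unique hγ (hL.mul_mem h1 (L.sub_mem hγ' hγ)) ?_ ?_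
  · have e : evol 𝕜 γ' * γ' - evol 𝕜 γ * γ =
        (evol 𝕜 γ' - evol 𝕜 γ) * γ + evol 𝕜 γ' * (γ' - γ) := by
      simp only [sub_mul, mul_sub]
      abel
    rw [← e]
    exact h1.sub h2
  · simp [(hL.evol_spec hγ').1, (hL.evol_spec hγ).1]

theorem tendsto_add_smul {X : Type*} [AddCommGroup X] [Module 𝕜 X] [TopologicalSpace X]
    [IsTopologicalAddGroup X] [ContinuousSMul 𝕜 X] (x z : X) :
    Tendsto (fun t : ℝ => x + (t : 𝕜) • z) (𝓝[≠] 0) (𝓝 x) := by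
  have : Continuous (fun t : ℝ => x + (t : 𝕜) • z) := by fun_prop
  simpa using (this.tendsto 0).mono_left nhdsWithin_le_nhds

theorem tendsto_iterSolve_add_smul (hL : IsPicardSpace L) {γ z : C(I, A)} (hγ : γ ∈ L) (hz : z ∈ L)
    {w : List C(I, A)} (hw : ∀ y ∈ w, y ∈ L) :
    Tendsto (fun t : ℝ => iterSolve 𝕜 (γ + (t : 𝕜) • z) w) (𝓝[≠] 0) (𝓝 (iterSolve 𝕜 γ w)) := by
  have := hL.tendsto_iterSolve (tendsto_add_smul γ z)
    (fun t => L.add_mem hγ (L.smul_mem (t : 𝕜) hz)) hγ (w.map fun y => (fun _ => y, y)) (by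
      intro y hy
      obtain ⟨u, hu, rfl⟩ := List.mem_map.1 hy
      exact ⟨tendsto_const_nhds, fun _ => hw u hu, hw u hu⟩)
  simpa [Function.comp_def] using this

/-- Differentiating an iterated integral in direction z inserts z at each possible place, and
`permutations'Aux z w` is the list of these insertions. In the induction, z goes either in front of
the first entry or further inside. -/
theorem tendsto_iterSolve_slope (hL : IsPicardSpace L) {γ z : C(I, A)} (hγ : γ ∈ L) (hz : z ∈ L)
    {w : List C(I, A)} (hw : ∀ y ∈ w, y ∈ L) :
    Tendsto (fun t : ℝ => ((t : 𝕜))⁻¹ • (iterSolve 𝕜 (γ + (t : 𝕜) • z) w - iterSolve 𝕜 γ w))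
      (𝓝[≠] 0) (𝓝 (((List.permutations'Aux z w).map (iterSolve 𝕜 γ)).sum)) := by
  have hmem : ∀ t : ℝ, γ + (t : 𝕜) • z ∈ L := fun t => L.add_mem hγ (L.smul_mem (t : 𝕜) hz)
  have hne : ∀ᶠ t : ℝ in 𝓝[≠] 0, (t : 𝕜) ≠ 0 := by
    filter_upwards [self_mem_nhdsWithin] with t ht
    exact RCLike.ofReal_ne_zero.2 ht
  induction w with
  | nil =>
    have h1 := hL.tendsto_solve (tendsto_const_nhds (x := γ) (f := 𝓝[≠] (0 : ℝ))) (fun _ => hγ) hγ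
      ((hL.tendsto_iterSolve_add_smul hγ hz hw).mul_const z)
      (fun t => hL.iterSolve_mul_mem (hmem t) hw hz) (hL.iterSolve_mul_mem hγ hw hz)
    simp only [List.permutations'Aux, List.map_cons, List.map_nil, List.sum_cons, List.sum_nil,
      add_zero]
    refine h1.congr' ?_
    filter_upwards [hne] with t ht
    rw [iterSolve, iterSolve, hL.evol_sub hγ (hmem t), add_sub_cancel_left, mul_smul_comm,
      hL.solve_smul hγ (hL.mul_mem (hL.evol_spec (hmem t)).2 hz), inv_smul_smul₀ ht]
  | cons y w ih =>
    have hy : y ∈ L := hw y (by simp)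
    have hw' : ∀ y ∈ w, y ∈ L := fun y hy => hw y (by simp [hy])
    have hins : ∀ v ∈ List.permutations'Aux z w, ∀ u ∈ v, u ∈ L := by
      intro v hv u hu
      have hp : v.Perm (z :: w) := List.mem_permutations'.1
        (List.mem_flatMap.2 ⟨w, List.mem_permutations'.2 (List.Perm.refl w), hv⟩)
      rcases List.mem_cons.1 (hp.subset hu) with rfl | h
      · exact hz
      · exact hw' u h
    have hslope : ∀ t : ℝ,
        (((t : 𝕜))⁻¹ • (iterSolve 𝕜 (γ + (t : 𝕜) • z) w - iterSolve 𝕜 γ w)) * y ∈ L := fun t => by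
      rw [smul_mul_assoc, sub_mul]
      exact L.smul_mem _ (L.sub_mem (hL.iterSolve_mul_mem (hmem t) hw' hy)
        (hL.iterSolve_mul_mem hγ hw' hy))
    -- `solve` is additive, so the letter y can be put in front of all insertions at once.
    have hsum : ∀ ws : List (List C(I, A)), (∀ v ∈ ws, ∀ u ∈ v, u ∈ L) →
        (ws.map (iterSolve 𝕜 γ)).sum * y ∈ L ∧
        solve 𝕜 γ ((ws.map (iterSolve 𝕜 γ)).sum * y) =
          (ws.map (fun v => iterSolve 𝕜 γ (y :: v))).sum := by
      intro ws hws
      induction ws with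
      | nil =>
        refine ⟨by simp, ?_⟩
        have := hL.solve_smul hγ L.zero_mem (0 : 𝕜)
        simpa using this
      | cons v ws ihs =>
        have hv := hL.iterSolve_mul_mem hγ (hws v (by simp)) hy
        obtain ⟨h1, h2⟩ := ihs fun v hv => hws v (by simp [hv])
        simp only [List.map_cons, List.sum_cons, add_mul]
        exact ⟨L.add_mem hv h1, by rw [hL.solve_add hγ hv h1, h2]; rfl⟩
    obtain ⟨hs1, hs2⟩ := hsum _ hins
    have h1 := hL.tendsto_solve (tendsto_const_nhds (x := γ) (f := 𝓝[≠] (0 : ℝ))) (fun _ => hγ) hγ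
      (((hL.tendsto_iterSolve_add_smul hγ hz hw).mul_const z).add ((ih hw').mul_const y))
      (fun t => L.add_mem (hL.iterSolve_mul_mem (hmem t) hw hz) (hslope t))
      (L.add_mem (hL.iterSolve_mul_mem hγ hw hz) hs1)
    rw [hL.solve_add hγ (hL.iterSolve_mul_mem hγ hw hz) hs1, hs2] at h1
    simp only [List.permutations'Aux, List.map_cons, List.sum_cons, List.map_map]
    refine h1.congr' ?_
    filter_upwards [hne] with t ht
    rw [hL.iterSolve_cons_sub hγ (hmem t) hy hw', add_sub_cancel_left,
      ← hL.solve_smul hγ, smul_add, mul_smul_comm, inv_smul_smul₀ ht, smul_mul_assoc]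
    rw [mul_smul_comm, sub_mul]
    exact L.add_mem (L.smul_mem _ (hL.iterSolve_mul_mem (hmem t) hw hz))
      (L.sub_mem (hL.iterSolve_mul_mem (hmem t) hw' hy) (hL.iterSolve_mul_mem hγ hw' hy))

variable {X : Type*} [AddCommGroup X] [Module 𝕜 X] [TopologicalSpace X]
  {c : X →ₗ[𝕜] C(I, A)}

/-- The endpoint of the evolution depends smoothly on the curve. -/
theorem isCrOn_evol (hL : IsPicardSpace L) (hc : Continuous c) (hcL : ∀ x, c x ∈ L) :
    IsCrOn 𝕜 ⊤ (fun x => evol 𝕜 (c x) 1) Set.univ := by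
  -- The k-th derivative sums the iterated integrals over all orderings of the directions. Reversing
  -- `finRange` puts the newest direction, appended by `Fin.snoc`, at the head of the list, as the
  -- recursion of `permutations'` requires.
  refine ⟨fun k x y => ((((List.finRange k).reverse.permutations').map fun v =>
    iterSolve 𝕜 (c x) (v.map fun i => c (y i))).sum) 1, ?_, ?_, ?_⟩
  · intro x _ y
    simp [iterSolve]
  · intro k _ x _ y z
    have key : ∀ ws : List (List (Fin k)), Tendsto (fun t : ℝ => ((t : 𝕜))⁻¹ •
        ((ws.map fun v => iterSolve 𝕜 (c x + (t : 𝕜) • c z) (v.map fun i => c (y i))).sum -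
          (ws.map fun v => iterSolve 𝕜 (c x) (v.map fun i => c (y i))).sum)) (𝓝[≠] 0)
        (𝓝 (((ws.map (List.map fun i => c (y i))).flatMap (List.permutations'Aux (c z))).map
          (iterSolve 𝕜 (c x))).sum) := by
      intro ws
      induction ws with
      | nil => simp
      | cons v ws ih =>
        have h1 := hL.tendsto_iterSolve_slope (hcL x) (hcL z) (w := v.map fun i => c (y i)) (by
          intro u hu
          obtain ⟨i, -, rfl⟩ := List.mem_map.1 hu
          exact hcL _)
        have h2 := h1.add ih
        simp only [List.map_cons, List.flatMap_cons, List.map_append, List.sum_append,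
          List.sum_cons]
        refine h2.congr fun t => ?_
        rw [← smul_add]
        congr 1
        abel
    have h1 := ((continuous_eval_const (F := C(I, A)) (1 : I)).tendsto _).comp
      (key ((List.finRange k).reverse.permutations'))
    have e : ((List.finRange (k + 1)).reverse.permutations'.map fun v =>
        iterSolve 𝕜 (c x) (v.map fun i => c (Fin.snoc (α := fun _ => X) y z i))) =
        (((List.finRange k).reverse.permutations'.map (List.map fun i => c (y i))).flatMap
          (List.permutations'Aux (c z))).map (iterSolve 𝕜 (c x)) := by
      have e1 : ∀ (n : ℕ) (v : Fin n → X), ((List.finRange n).reverse.permutations'.map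
          (List.map fun i => c (v i))) =
          ((List.ofFn fun i => c (v i)).reverse).permutations' := by
        intro n v
        rw [List.map_permutations', List.map_reverse, List.ofFn_eq_map]
      have e2 : ((List.finRange (k + 1)).reverse.permutations'.map fun v =>
          iterSolve 𝕜 (c x) (v.map fun i => c (Fin.snoc (α := fun _ => X) y z i))) =
          ((List.finRange (k + 1)).reverse.permutations'.map
            (List.map fun i => c (Fin.snoc (α := fun _ => X) y z i))).map (iterSolve 𝕜 (c x)) := by
        rw [List.map_map]
        rfl
      rw [e2, e1, e1, List.ofFn_succ']
      simp [List.permutations']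
    rw [← e] at h1
    refine h1.congr fun t => ?_
    simp
  · intro k _
    refine Continuous.continuousOn (continuous_iff_continuousAt.2 fun ⟨x, y⟩ => ?_)
    refine ((continuous_eval_const (F := C(I, A)) (1 : I)).tendsto _).comp
      (tendsto_list_sum _ fun v _ => ?_)
    have := hL.tendsto_iterSolve (l := 𝓝 (x, y)) (F := fun u => c u.1) (γ := c x)
      ((hc.comp continuous_fst).tendsto _) (fun _ => hcL _) (hcL _)
      (v.map fun i => (fun u => c (u.2 i), c (y i))) (by
        intro u hu
        obtain ⟨i, -, rfl⟩ := List.mem_map.1 hu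
        refine ⟨?_, fun _ => hcL _, hcL _⟩
        exact (hc.comp ((continuous_apply i).comp continuous_snd)).tendsto (x, y))
    simpa [Function.comp_def] using this

end IsPicardSpace

end Evolution

/-! ### Power series expansion of the evolution map. -/

section Analytic

variable {𝕜 : Type*} [RCLike 𝕜] {A : Type*} [Ring A] [Algebra 𝕜 A] [TopologicalSpace A]
  [IsTopologicalRing A] [ContinuousSMul 𝕜 A] [PolynormableSpace 𝕜 A] [T2Space A]
  {L : Submodule 𝕜 C(I, A)}

namespace IsPicardSpace

theorem iterSolve_cons_zero (hL : IsPicardSpace L) {γ y : C(I, A)} (hγ : γ ∈ L) (hy : y ∈ L)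
    {w : List C(I, A)} (hw : ∀ y ∈ w, y ∈ L) : iterSolve 𝕜 γ (y :: w) 0 = 0 :=
  hL.solve_zero hγ (hL.iterSolve_mul_mem hγ hw hy)

/-- The expansion of the evolution of `γ + y` into iterated integrals. -/
theorem tendsto_sum_iterSolve (hL : IsPicardSpace L) {γ y : C(I, A)} (hγ : γ ∈ L) (hy : y ∈ L) :
    Tendsto (fun N => ∑ n ∈ Finset.range N, iterSolve 𝕜 γ (List.replicate n y)) atTop
      (𝓝 (evol 𝕜 (γ + y))) := by
  have hw : ∀ n, ∀ z ∈ List.replicate n y, z ∈ L := fun n z hz =>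
    (List.eq_of_mem_replicate hz) ▸ hy
  have hγy := L.add_mem hγ hy
  obtain ⟨hinv1, hinv2, hinv, -⟩ := hL.evolInv_spec hγ
  set R : ℕ → C(I, A) := fun N =>
    evol 𝕜 (γ + y) - ∑ n ∈ Finset.range N, iterSolve 𝕜 γ (List.replicate n y) with hR
  -- The remainders satisfy R' = Rγ + (previous R)y. Multiplication by E⁻¹ removes the term Rγ and
  -- leaves the Picard recursion Q' = (previous Q)a, which decays factorially.
  set Q : ℕ → C(I, A) := fun N => R N * evolInv 𝕜 γ with hQ
  set a : C(I, A) := evol 𝕜 γ * y * evolInv 𝕜 γ with ha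
  have hsucc : ∀ N, R (N + 1) = evol 𝕜 (γ + y) -
      (∑ n ∈ Finset.range N, iterSolve 𝕜 γ (y :: List.replicate n y) + evol 𝕜 γ) := by
    intro N
    simp only [hR]
    rw [Finset.sum_range_succ']
    rfl
  have hRd : ∀ N, HasCurveDeriv 𝕜 (R (N + 1)) (R (N + 1) * γ + R N * y : C(I, A)) := by
    intro N
    have h1 := HasCurveDeriv.sum (Finset.range N) (fun n _ =>
      hL.iterSolve_hasCurveDeriv hγ (y :: List.replicate n y) (hw (n + 1)))
    have h2 := (hL.evol_spec hγy).2.sub (h1.add (hL.evol_spec hγ).2)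
    have e1 : (R (N + 1) : I → A) = ⇑(evol 𝕜 (γ + y)) -
        ((fun t => ∑ n ∈ Finset.range N, iterSolve 𝕜 γ (y :: List.replicate n y) t) +
          ⇑(evol 𝕜 γ)) := by
      rw [hsucc]
      funext t
      simp
    have e2 : (⇑(R (N + 1) * γ + R N * y) : I → A) = ⇑(evol 𝕜 (γ + y) * (γ + y)) -
        ((fun t => ∑ n ∈ Finset.range N, iterSolveDeriv 𝕜 γ (y :: List.replicate n y) t) +
          ⇑(evol 𝕜 γ * γ)) := by
      rw [hsucc]
      funext t
      simp only [hR, iterSolveDeriv, ContinuousMap.add_apply, ContinuousMap.mul_apply,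
        ContinuousMap.sub_apply, ContinuousMap.coe_sum, Finset.sum_apply, Pi.sub_apply,
        Pi.add_apply, Finset.sum_add_distrib, ← Finset.sum_mul, sub_mul, add_mul, mul_add]
      abel
    rw [e1, e2]
    exact h2
  have hQd : ∀ N, HasCurveDeriv 𝕜 (Q (N + 1)) (fun t => LinearMap.mul 𝕜 A (Q N t) (a t)) := by
    intro N
    have h := (hRd N).mul hinv
    have e : (⇑(R (N + 1) * γ + R N * y) * ⇑(evolInv 𝕜 γ) + ⇑(R (N + 1)) *
        ⇑(-γ * evolInv 𝕜 γ) : I → A) = ⇑(Q N * a) := by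
      have e0 : Q N * a = R N * y * evolInv 𝕜 γ := by
        rw [hQ, ha, ← mul_assoc, ← mul_assoc, hL.evolInv_mul_evol hγ]
      rw [e0]
      funext t
      simp [add_mul, mul_assoc]
    rw [e] at h
    exact h
  have hQ0 : ∀ N, Q (N + 1) 0 = 0 := by
    intro N
    have : R (N + 1) 0 = 0 := by
      rw [hsucc]
      simp only [ContinuousMap.sub_apply, ContinuousMap.add_apply, ContinuousMap.coe_sum,
        Finset.sum_apply, (hL.evol_spec hγy).1, (hL.evol_spec hγ).1]
      rw [Finset.sum_eq_zero fun n _ => hL.iterSolve_cons_zero hγ hy (hw n)]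
      simp
    simp [hQ, this]
  have key : Tendsto R atTop (𝓝 0) := by
    rw [tendsto_curve_iff_seminorm 𝕜]
    intro p hp ε hε
    obtain ⟨q, hq, C, hC⟩ := hL.prodBound p hp
    obtain ⟨M, hM0, hM⟩ := exists_seminorm_curve_le hq a
    obtain ⟨K, hK0, hK⟩ := exists_seminorm_curve_le hq (Q 0)
    obtain ⟨K', hK'0, hK'⟩ := exists_seminorm_curve_le hq (evol 𝕜 γ)
    have hC0 : 0 ≤ C := by simpa using (apply_nonneg p _).trans (hC [])
    have hbase : ∀ (t : I) (w : List A), p (foldlLinear (LinearMap.mul 𝕜 A) w (Q 0 t)) ≤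
        C * K * (w.map q).prod := by
      intro t w
      have h1 := hC (Q 0 t :: w)
      rw [List.prod_cons, List.map_cons, List.prod_cons] at h1
      rw [foldlLinear_mul]
      refine h1.trans ?_
      have := map_prod_nonneg q w
      rw [mul_assoc]
      gcongr
      exact hK t
    have hlim : Tendsto (fun N : ℕ => C * K * (M ^ N / N.factorial) * K') atTop (𝓝 0) := by
      have := ((FloorSemiring.tendsto_pow_div_factorial_atTop M).const_mul (C * K)).mul_const K'
      simpa using this
    filter_upwards [hlim.eventually (gt_mem_nhds hε)] with N hN t
    refine lt_of_le_of_lt ?_ hN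
    -- The one-letter list [E(t)] turns Q back into the remainder R without changing the seminorm.
    have h1 := seminorm_foldlLinear_iterate_le (F := fun N => Q N) (a := a) continuous_mul hp hQd
      hQ0
      hM hbase N t [evol 𝕜 γ t]
    have h2 : foldlLinear (LinearMap.mul 𝕜 A) [evol 𝕜 γ t] (Q N t) = R N t - (0 : C(I, A)) t := by
      have := DFunLike.congr_fun (hL.evolInv_mul_evol hγ (R N)) t
      rw [foldlLinear_mul]
      simpa [hQ] using this
    rw [h2, List.map_singleton, List.prod_singleton] at h1
    refine h1.trans ?_
    gcongr
    · exact mul_le_of_le_one_right (by positivity) (pow_le_one₀ t.2.1 t.2.2)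
    · exact hK' t
  have := key.const_sub (evol 𝕜 (γ + y))
  rw [sub_zero] at this
  exact this.congr fun N => by simp [hR]

variable {X : Type*} [AddCommGroup X] [Module 𝕜 X] {c : X →ₗ[𝕜] C(I, A)}

/-- The evolution map on a space `X` of curves. -/
def evolMap (hL : IsPicardSpace L) (hcL : ∀ x, c x ∈ L) (x : X) : CrSpace 𝕜 A 1 :=
  CrSpace.mk₁ (evol 𝕜 (c x)) (evol 𝕜 (c x) * c x) (hL.evol_spec (hcL x)).2

theorem isEvolutionMap_evolMap (hL : IsPicardSpace L) (hcL : ∀ x, c x ∈ L) :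
    IsEvolutionMap c (hL.evolMap hcL) := by
  intro x η
  constructor
  · rintro ⟨-, h0, h1⟩
    exact CrCurve.toCurve_injective (hL.evol_unique (hcL x) h1 h0)
  · rintro rfl
    obtain ⟨h0, h1⟩ := hL.evol_spec (hcL x)
    obtain ⟨h2, h3, -⟩ := hL.evolInv_spec (hcL x)
    exact ⟨fun t => ⟨⟨_, evolInv 𝕜 (c x) t, DFunLike.congr_fun h2 t, DFunLike.congr_fun h3 t⟩, rfl⟩,
      h0, h1⟩

/-- The bilinear map `(y, g) ↦ solve γ (g y)`, with values in the space of `C¹`-curves. -/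
def solveBilinear (hL : IsPicardSpace L) (hcL : ∀ x, c x ∈ L) {γ : C(I, A)} (hγ : γ ∈ L) :
    X →ₗ[𝕜] CrSpace 𝕜 A 1 →ₗ[𝕜] CrSpace 𝕜 A 1 :=
  have hmem (y : X) (g : CrSpace 𝕜 A 1) : g.toCurve * c y ∈ L :=
    hL.mul_mem (g.hasCurveDeriv le_rfl) (hcL y)
  LinearMap.mk₂ 𝕜 (fun y g => CrSpace.mk₁ (solve 𝕜 γ (g.toCurve * c y)) _
      (hL.solve_hasCurveDeriv hγ (hmem y g)))
    (fun y y' g => CrCurve.toCurve_injective <|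
      (congrArg (solve 𝕜 γ) (by rw [map_add, mul_add])).trans
        (hL.solve_add hγ (hmem y g) (hmem y' g)))
    (fun a y g => CrCurve.toCurve_injective <|
      (congrArg (solve 𝕜 γ) (by rw [map_smul, mul_smul_comm])).trans
        (hL.solve_smul hγ (hmem y g) a))
    (fun y g g' => CrCurve.toCurve_injective <|
      (congrArg (solve 𝕜 γ) (add_mul g.toCurve g'.toCurve (c y))).trans
        (hL.solve_add hγ (hmem y g) (hmem y g')))
    (fun a y g => CrCurve.toCurve_injective <|
      (congrArg (solve 𝕜 γ) (smul_mul_assoc a g.toCurve (c y))).trans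
        (hL.solve_smul hγ (hmem y g) a))

/-- The iterated integrals relative to `γ`, as a multilinear map. -/
def iterMultilinear (hL : IsPicardSpace L) (hcL : ∀ x, c x ∈ L) {γ : C(I, A)} (hγ : γ ∈ L) :
    (n : ℕ) → MultilinearMap 𝕜 (fun _ : Fin n => X) (CrSpace 𝕜 A 1)
  | 0 => MultilinearMap.constOfIsEmpty 𝕜 _ (CrSpace.mk₁ (evol 𝕜 γ) _ (hL.evol_spec hγ).2)
  | n + 1 => LinearMap.uncurryLeft
      { toFun := fun y => (hL.solveBilinear hcL hγ y).compMultilinearMap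
          (iterMultilinear hL hcL hγ n)
        map_add' := fun y y' => by ext m; simp
        map_smul' := fun a y => by ext m; simp }

theorem toCurve_iterMultilinear (hL : IsPicardSpace L) (hcL : ∀ x, c x ∈ L) {γ : C(I, A)}
    (hγ : γ ∈ L) (n : ℕ) (m : Fin n → X) : (hL.iterMultilinear hcL hγ n m).toCurve =
      iterSolve 𝕜 γ (List.ofFn fun i => c (m i)) := by
  induction n with
  | zero => rfl
  | succ n ih =>
    rw [List.ofFn_succ, iterSolve]
    exact congrArg (fun g => solve 𝕜 γ (g * c (m 0))) (ih (Fin.tail m))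

theorem curveDeriv_iterMultilinear (hL : IsPicardSpace L) (hcL : ∀ x, c x ∈ L) {γ : C(I, A)}
    (hγ : γ ∈ L) (n : ℕ) (m : Fin n → X) :
    curveDeriv 𝕜 (hL.iterMultilinear hcL hγ n m).toCurve =
      iterSolveDeriv 𝕜 γ (List.ofFn fun i => c (m i)) := by
  rw [toCurve_iterMultilinear]
  refine (hL.iterSolve_hasCurveDeriv hγ _ fun y hy => ?_).curveDeriv_eq
  obtain ⟨i, rfl⟩ := List.mem_ofFn.1 hy
  exact hcL _

variable [TopologicalSpace X]

theorem tendsto_iterSolve_ofFn (hL : IsPicardSpace L) (hc : Continuous c) (hcL : ∀ x, c x ∈ L)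
    {γ : C(I, A)} (hγ : γ ∈ L) (n : ℕ) (m : Fin n → X) :
    Tendsto (fun v : Fin n → X => iterSolve 𝕜 γ (List.ofFn fun i => c (v i))) (𝓝 m)
      (𝓝 (iterSolve 𝕜 γ (List.ofFn fun i => c (m i)))) := by
  have := hL.tendsto_iterSolve (l := 𝓝 m) (tendsto_const_nhds (x := γ)) (fun _ => hγ) hγ
      ((List.finRange n).map fun i => (fun v => c (v i), c (m i))) (by
        intro u hu
        obtain ⟨i, -, rfl⟩ := List.mem_map.1 hu
        exact ⟨(hc.comp (continuous_apply i)).tendsto m, fun _ => hcL _, hcL _⟩)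
  simpa [Function.comp_def, List.ofFn_eq_map] using this

theorem continuous_iterMultilinear (hL : IsPicardSpace L) (hc : Continuous c) (hcL : ∀ x, c x ∈ L)
    {γ : C(I, A)} (hγ : γ ∈ L) (n : ℕ) : Continuous (hL.iterMultilinear hcL hγ n) := by
  refine continuous_iff_continuousAt.2 fun m => CrSpace.tendsto_nhds ?_ ?_
  · simp only [toCurve_iterMultilinear]
    exact hL.tendsto_iterSolve_ofFn hc hcL hγ n m
  · simp only [curveDeriv_iterMultilinear]
    cases n with
    | zero => simp
    | succ n =>
      have h1 := hL.tendsto_iterSolve_ofFn hc hcL hγ (n + 1) m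
      have h2 := (hL.tendsto_iterSolve_ofFn hc hcL hγ n (Fin.tail m)).comp
        ((continuous_pi fun i : Fin n => continuous_apply i.succ).tendsto m)
      have h3 := (h1.mul_const γ).add (h2.mul ((hc.comp (continuous_apply 0)).tendsto m))
      simp only [List.ofFn_succ] at h3 ⊢
      exact h3

/-- The evolution map has a power series expansion around each point. -/
theorem exists_series_evolMap (hL : IsPicardSpace L) (hc : Continuous c)
    (hcL : ∀ x, c x ∈ L) (x : X) :
    ∃ β : (n : ℕ) → ContinuousMultilinearMap 𝕜 (fun _ : Fin n => X) (CrSpace 𝕜 A 1),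
      ∀ y, Tendsto (fun N : ℕ => ∑ n ∈ Finset.range N, β n (fun _ => y)) atTop
        (𝓝 (hL.evolMap hcL (x + y))) := by
  refine ⟨fun n => ⟨hL.iterMultilinear hcL (hcL x) n,
    hL.continuous_iterMultilinear hc hcL (hcL x) n⟩, fun y => ?_⟩
  have hv := hL.tendsto_sum_iterSolve (hcL x) (hcL y)
  have hw : ∀ n, ∀ z ∈ List.replicate n (c y), z ∈ L := fun n z hz =>
    (List.eq_of_mem_replicate hz) ▸ hcL y
  have e1 : ∀ N, (∑ n ∈ Finset.range N,
      hL.iterMultilinear hcL (hcL x) n (fun _ => y) : CrSpace 𝕜 A 1).toCurve =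
      ∑ n ∈ Finset.range N, iterSolve 𝕜 (c x) (List.replicate n (c y)) := by
    intro N
    rw [← CrCurve.toCurveLinear_apply, map_sum]
    refine Finset.sum_congr rfl fun n _ => ?_
    rw [CrCurve.toCurveLinear_apply, toCurve_iterMultilinear, List.ofFn_const]
  have e2 : ∀ N, curveDeriv 𝕜 (∑ n ∈ Finset.range N,
      hL.iterMultilinear hcL (hcL x) n (fun _ => y) : CrSpace 𝕜 A 1).toCurve =
      ∑ n ∈ Finset.range N, iterSolveDeriv 𝕜 (c x) (List.replicate n (c y)) := by
    intro N
    rw [e1]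
    refine HasCurveDeriv.curveDeriv_eq ?_
    have := HasCurveDeriv.sum (Finset.range N) (fun n _ =>
      hL.iterSolve_hasCurveDeriv (hcL x) (List.replicate n (c y)) (hw n))
    simpa only [ContinuousMap.coe_sum, ← Finset.sum_apply] using this
  refine CrSpace.tendsto_nhds ?_ ?_
  · refine Tendsto.congr (fun N => (e1 N).symm) ?_
    have e : (hL.evolMap hcL (x + y)).toCurve = evol 𝕜 (c x + c y) :=
      congrArg (evol 𝕜) (map_add c x y)
    rw [e]
    exact hv
  · refine Tendsto.congr (fun N => (e2 N).symm) ?_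
    have e : curveDeriv 𝕜 (hL.evolMap hcL (x + y)).toCurve =
        evol 𝕜 (c x + c y) * c x + evol 𝕜 (c x + c y) * c y := by
      rw [← mul_add, ← map_add]
      exact (hL.evol_spec (hcL (x + y))).2.curveDeriv_eq
    rw [e]
    -- With S_N the N-th partial sum, the derivative of S_{N+1} is S_{N+1}·c(x) + S_N·c(y), because
    -- the zeroth term contributes nothing to the second product. Hence the shift in the index.
    have h1 := (hv.mul_const (c x)).comp (tendsto_add_atTop_nat 1)
    have h2 := h1.add (hv.mul_const (c y))
    rw [← tendsto_add_atTop_iff_nat 1]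
    refine h2.congr fun N => ?_
    simp only [Function.comp_apply]
    rw [Finset.sum_range_succ', Finset.sum_range_succ' _ N, add_mul, Finset.sum_mul, Finset.sum_mul,
      add_right_comm, ← Finset.sum_add_distrib]
    rfl

theorem continuous_evolMap (hL : IsPicardSpace L) (hc : Continuous c)
    (hcL : ∀ x, c x ∈ L) : Continuous (hL.evolMap hcL) := by
  refine continuous_iff_continuousAt.2 fun x => ?_
  have h := (hL.tendsto_evol (hc.tendsto x) hcL (hcL x)).1
  refine CrSpace.tendsto_nhds h ?_
  have e : ∀ z, curveDeriv 𝕜 (hL.evolMap hcL z).toCurve = evol 𝕜 (c z) * c z := fun z =>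
    (hL.evol_spec (hcL z)).2.curveDeriv_eq
  simp only [e]
  exact h.mul (hc.tendsto x)

end IsPicardSpace

end Analytic

/-! ### Primitives and convergent series from completeness. -/

section Primitives

variable {𝕜 : Type*} [RCLike 𝕜] {E : Type*} [AddCommGroup E] [Module 𝕜 E] [TopologicalSpace E]

theorem tendsto_coe_unitInterval (t : I) : Tendsto (fun s : I => (s : ℝ)) (𝓝[≠] t) (𝓝[≠] (t : ℝ)) :=
  tendsto_nhdsWithin_iff.2 ⟨(continuous_subtype_val.tendsto t).mono_left nhdsWithin_le_nhds, by
    filter_upwards [self_mem_nhdsWithin] with s hs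
    exact fun h => hs (Subtype.ext h)⟩

theorem hasCurveDeriv_smul_of_hasDerivAt [ContinuousSMul 𝕜 E] {g g' : ℝ → ℝ}
    (h : ∀ x, HasDerivAt g (g' x) x) (a : E) :
    HasCurveDeriv 𝕜 (fun t : I => ((g t : ℝ) : 𝕜) • a) (fun t => ((g' t : ℝ) : 𝕜) • a) := by
  intro t
  have h1 := (hasDerivAt_iff_tendsto_slope.1 (h t)).comp (tendsto_coe_unitInterval t)
  have h2 := ((RCLike.continuous_ofReal (K := 𝕜)).tendsto _).comp h1
  refine (h2.smul_const a).congr fun s => ?_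
  simp only [Function.comp, diffQuot, ← sub_smul, smul_smul, slope_def_field]
  push_cast
  rw [div_eq_inv_mul]

theorem isLipschitzCurve_iff [PolynormableSpace 𝕜 E] {γ : I → E} :
    IsLipschitzCurve 𝕜 γ ↔ ∀ p : Seminorm 𝕜 E, Continuous p →
      ∃ M : ℝ, ∀ s t : I, p (γ s - γ t) ≤ M * |(s : ℝ) - t| := by
  rw [IsLipschitzCurve, (PolynormableSpace.withSeminorms 𝕜 E).isVonNBounded_iff_seminorm_bounded]
  constructor
  · intro h p hp
    obtain ⟨r, -, hr⟩ := h ⟨p, hp⟩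
    refine ⟨r, fun s t => ?_⟩
    rcases eq_or_ne s t with rfl | hst
    · simp
    · have h1 := (hr _ ⟨s, t, hst, rfl⟩).le
      have h2 : 0 < |(s : ℝ) - t| := abs_pos.2 (sub_ne_zero.2 fun h => hst (Subtype.ext h))
      have h3 : p (diffQuot 𝕜 γ s t) ≤ r := h1
      rw [seminorm_diffQuot, inv_mul_le_iff₀ h2] at h3
      linarith
  · rintro h ⟨p, hp⟩
    obtain ⟨M, hM⟩ := h p hp
    refine ⟨max M 0 + 1, by positivity, ?_⟩
    rintro v ⟨s, t, hst, rfl⟩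
    have h2 : 0 < |(s : ℝ) - t| := abs_pos.2 (sub_ne_zero.2 fun h => hst (Subtype.ext h))
    have h3 : p (diffQuot 𝕜 γ s t) ≤ M := by
      rw [seminorm_diffQuot, inv_mul_le_iff₀ h2]
      linarith [hM s t]
    change p (diffQuot 𝕜 γ s t) < _
    linarith [le_max_left M 0]

variable [IsTopologicalAddGroup E] [ContinuousSMul 𝕜 E] [PolynormableSpace 𝕜 E]

theorem IsLipschitzCurve.continuous {γ : I → E} (h : IsLipschitzCurve 𝕜 γ) : Continuous γ := by
  refine continuous_iff_continuousAt.2 fun t => (tendsto_nhds_iff_seminorm 𝕜).2 fun p hp ε hε => ?_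
  obtain ⟨M, hM⟩ := isLipschitzCurve_iff.1 h p hp
  have h1 : Tendsto (fun s : I => M * |(s : ℝ) - t|) (𝓝 t) (𝓝 0) := by
    have : Continuous fun s : I => M * |(s : ℝ) - t| := by fun_prop
    simpa using this.tendsto t
  filter_upwards [h1.eventually (gt_mem_nhds hε)] with s hs
  exact (hM s t).trans_lt hs

theorem HasCurveDeriv.isLipschitzCurve {γ δ : C(I, E)} (h : HasCurveDeriv 𝕜 γ δ) :
    IsLipschitzCurve 𝕜 γ := by
  refine isLipschitzCurve_iff.2 fun p hp => ?_
  obtain ⟨M, -, hM⟩ := exists_seminorm_curve_le hp δ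
  exact ⟨M, fun s t => h.seminorm_sub_le_abs hp hM t s⟩

/-- A continuous curve is a uniform limit of curves that have primitives. -/
theorem exists_approximate_primitives (γ : C(I, E)) :
    ∃ Γ δ : ℕ → C(I, E), (∀ n, HasCurveDeriv 𝕜 (Γ n) (δ n)) ∧ (∀ n, Γ n 0 = 0) ∧
      Tendsto δ atTop (𝓝 γ) := by
  -- Bernstein approximation takes place in real locally convex spaces, so the scalars are
  -- restricted to ℝ.
  let : Module ℝ E := Module.compHom E (algebraMap ℝ 𝕜)
  have hsmul : ∀ (r : ℝ) (x : E), r • x = ((r : ℝ) : 𝕜) • x := fun _ _ => rfl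
  have : ContinuousSMul ℝ E := ⟨by
    simp only [hsmul]
    exact (RCLike.continuous_ofReal.comp continuous_fst).smul continuous_snd⟩
  have : LocallyConvexSpace ℝ E := by
    refine LocallyConvexSpace.ofBasisZero ℝ E (fun V : Set E => V) (fun V => V ∈ 𝓝 0 ∧ Convex ℝ V)
      ⟨fun V => ⟨fun hV => ?_, fun ⟨W, hW, hWV⟩ => mem_of_superset hW.1 hWV⟩⟩ fun V hV => hV.2
    obtain ⟨p, hp, hpV⟩ := exists_seminorm_lt_one_subset 𝕜 hV
    refine ⟨{x | p x < 1}, ⟨hp.continuousAt.eventually (gt_mem_nhds (by simp)), ?_⟩, hpV⟩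
    intro x hx y hy a b ha hb hab
    have hx : p x < 1 := hx
    have hy : p y < 1 := hy
    have h1 := map_add_le_add p (a • x) (b • y)
    rw [hsmul, hsmul, map_smul_eq_mul, map_smul_eq_mul, RCLike.norm_ofReal, RCLike.norm_ofReal,
      abs_of_nonneg ha, abs_of_nonneg hb, ← hsmul, ← hsmul] at h1
    change p (a • x + b • y) < 1
    rcases ha.eq_or_lt with rfl | ha
    · nlinarith
    · nlinarith
  -- A Bernstein approximant is a sum of scalar functions times fixed vectors. Its primitive needs
  -- only scalar integrals and no completeness of `E`.
  have key : ∀ (f : C(I, ℝ)) (a : E), ∃ Γ : C(I, E),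
      HasCurveDeriv 𝕜 Γ (fun t => f t • a) ∧ Γ 0 = 0 := by
    intro f a
    have hf : Continuous (fun u : ℝ => f (Set.projIcc 0 1 zero_le_one u)) := by fun_prop
    have h1 := hasCurveDeriv_smul_of_hasDerivAt (𝕜 := 𝕜)
      (fun x => intervalIntegral.integral_hasDerivAt_right (hf.intervalIntegrable 0 x)
        hf.stronglyMeasurable.stronglyMeasurableAtFilter hf.continuousAt) a
    refine ⟨⟨_, h1.continuous⟩, ?_, ?_⟩
    · simpa [hsmul] using h1
    · simp
  choose P hP hP0 using key
  refine ⟨fun n => ∑ k : Fin (n + 1), P (bernstein n k) (γ (bernstein.z k)),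
    fun n => bernsteinApproximation n γ, fun n => ?_, fun n => ?_,
    bernsteinApproximation_uniform γ⟩
  · have := HasCurveDeriv.sum Finset.univ
      (fun (k : Fin (n + 1)) _ => hP (bernstein n k) (γ (bernstein.z k)))
    convert! this using 1
    · funext t; simp
    · funext t; simp [bernsteinApproximation.apply]
  · simp [hP0]

theorem exists_primitive_of_tendsto {γ : C(I, E)} {Γ δ : ℕ → C(I, E)}
    (hΓ : ∀ n, HasCurveDeriv 𝕜 (Γ n) (δ n)) (hΓ0 : ∀ n, Γ n 0 = 0) (hδ : Tendsto δ atTop (𝓝 γ))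
    [T2Space E] (h : ∀ t, ∃ x, Tendsto (fun n => Γ n t) atTop (𝓝 x)) :
    ∃ Γ : C(I, E), HasCurveDeriv 𝕜 Γ γ ∧ Γ 0 = 0 := by
  choose Γ' hΓ' using h
  have hd := hasCurveDeriv_of_tendsto hΓ hΓ' ((tendsto_curve_iff_seminorm 𝕜).1 hδ)
  refine ⟨⟨Γ', hd.continuous⟩, hd, tendsto_nhds_unique (hΓ' 0) ?_⟩
  simp [hΓ0]

/-! ### Sequentially complete spaces -/

theorem SequentiallyComplete.exists_tendsto (hE : SequentiallyComplete E) {u : ℕ → E}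
    (h : ∀ p : Seminorm 𝕜 E, Continuous p → ∀ ε > 0, ∃ N : ℕ, ∀ m ≥ N, p (u m - u N) < ε) :
    ∃ x, Tendsto u atTop (𝓝 x) := by
  refine hE u fun V hV => ?_
  obtain ⟨p, hp, hpV⟩ := exists_seminorm_lt_one_subset 𝕜 hV
  obtain ⟨N, hN⟩ := h p hp (1 / 2) (by norm_num)
  refine ⟨N, fun m hm n hn => hpV _ ?_⟩
  have := map_sub_le_add p (u m - u N) (u n - u N)
  rw [sub_sub_sub_cancel_right] at this
  linarith [hN m hm, hN n hn]

theorem SequentiallyComplete.exists_primitive [T2Space E] (hE : SequentiallyComplete E)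
    (γ : C(I, E)) : ∃ Γ : C(I, E), HasCurveDeriv 𝕜 Γ γ ∧ Γ 0 = 0 := by
  obtain ⟨Γ, δ, hΓ, hΓ0, hδ⟩ := exists_approximate_primitives (𝕜 := 𝕜) γ
  refine exists_primitive_of_tendsto hΓ hΓ0 hδ fun t => hE.exists_tendsto (𝕜 := 𝕜) ?_
  intro p hp ε hε
  obtain ⟨N, hN⟩ := eventually_atTop.1
    ((tendsto_curve_iff_seminorm 𝕜).1 hδ p hp (ε / 4) (by positivity))
  refine ⟨N, fun m hm => ?_⟩
  have h1 := ((hΓ m).sub (hΓ N)).seminorm_sub_le_abs hp (M := ε / 2) (fun s => ?_) 0 t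
  · simp only [Pi.sub_apply, hΓ0, sub_zero] at h1
    have h2 : |(t : ℝ) - (0 : I)| ≤ 1 := by simpa [abs_of_nonneg t.2.1] using t.2.2
    have h3 : ε / 2 * |(t : ℝ) - (0 : I)| ≤ ε / 2 * 1 := by gcongr
    linarith
  · have e : (⇑(δ m) - ⇑(δ N)) s = (δ m s - γ s) - (δ N s - γ s) := by simp
    rw [e]
    have := map_sub_le_add p (δ m s - γ s) (δ N s - γ s)
    linarith [hN m hm s, hN N le_rfl s]

theorem SequentiallyComplete.factorialSummable (hE : SequentiallyComplete E) :
    FactorialSummable 𝕜 E := by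
  intro a ha
  refine hE.exists_tendsto (𝕜 := 𝕜) fun p hp ε hε => ?_
  obtain ⟨C, M, h⟩ := ha p hp
  obtain ⟨N, hN⟩ := Metric.cauchySeq_iff'.1 (tendsto_sum_pow_div_factorial C M).cauchySeq ε hε
  refine ⟨N, fun m hm => ?_⟩
  have h1 := hN m hm
  rw [Real.dist_eq, ← Finset.sum_range_add_sum_Ico _ hm, add_sub_cancel_left] at h1
  rw [← Finset.sum_range_add_sum_Ico _ hm, add_sub_cancel_left]
  exact ((Finset.le_sum_of_subadditive p (map_zero p).le (map_add_le_add p) _ _).trans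
    (Finset.sum_le_sum fun n _ => h n)).trans_lt ((le_abs_self _).trans_lt h1)

/-! ### Mackey-complete spaces -/

/-- An approximate fundamental theorem: the integral of s ↦ tγ(ts) over [0,1] stands for that of γ
over [0,t]. On each interval of a fine uniform partition, Γ minus the linear curve u ↦ u·γ(left end)
has derivative at most ε + r/2; the increments of Γ telescope and those of the linear curves form a
Riemann sum. -/
theorem seminorm_sub_riemannIntegral_le {Γ δ γ : C(I, E)} (hΓ : HasCurveDeriv 𝕜 Γ δ)
    {p : Seminorm 𝕜 E} (hp : Continuous p) {ε : ℝ} (hε : ∀ s, p (δ s - γ s) ≤ ε) (t : I) {x : E}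
    (hx : HasRiemannIntegral 𝕜 (fun s => ((t : ℝ) : 𝕜) • γ (t * s)) x) :
    p (Γ t - Γ 0 - x) ≤ ε := by
  have hε0 : 0 ≤ ε := (apply_nonneg p _).trans (hε 0)
  refine le_of_forall_pos_le_add fun r hr => ?_
  obtain ⟨ε₁, hε₁, h1⟩ := hx {y | p y < r / 2}
    (hp.continuousAt.eventually (gt_mem_nhds (by simpa using hr)))
  obtain ⟨ρ, hρ, h2⟩ : ∃ ρ > 0, ∀ u v : I, dist u v < ρ → p (γ u - γ v) < r / 2 := by
    let : UniformSpace E := IsTopologicalAddGroup.rightUniformSpace E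
    have : IsUniformAddGroup E := isUniformAddGroup_of_addCommGroup
    have huc := CompactSpace.uniformContinuous_of_continuous γ.continuous
    have hV : {z : E × E | p (z.1 - z.2) < r / 2} ∈ uniformity E := by
      rw [uniformity_eq_comap_nhds_zero_swapped]
      exact ⟨{y | p y < r / 2}, hp.continuousAt.eventually (gt_mem_nhds (by simpa using hr)),
        fun z hz => hz⟩
    obtain ⟨ρ, hρ, h⟩ := Metric.mem_uniformity_dist.1 (mem_map.1 (huc hV))
    exact ⟨ρ, hρ, fun u v huv => h huv⟩
  obtain ⟨N, hN⟩ := exists_nat_one_div_lt (lt_min hε₁ hρ)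
  set pt : ℕ → I := fun k => Set.projIcc 0 1 zero_le_one ((k : ℝ) / (N + 1)) with hpt
  have hNpos : (0 : ℝ) < N + 1 := by positivity
  have hptv : ∀ k ≤ N + 1, ((pt k : I) : ℝ) = (k : ℝ) / (N + 1) := by
    intro k hk
    have : (k : ℝ) / (N + 1) ∈ Set.Icc (0 : ℝ) 1 :=
      ⟨by positivity, by rw [div_le_one hNpos]; exact_mod_cast hk⟩
    simp only [hpt, Set.projIcc_of_mem _ this]
  have hmono : Monotone pt := fun k l hkl =>
    Set.monotone_projIcc _ (by gcongr)
  have hstep : ∀ k < N + 1, ((pt (k + 1) : I) : ℝ) - pt k = 1 / (N + 1) := by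
    intro k hk
    rw [hptv _ hk, hptv _ hk.le]
    push_cast
    ring
  have hpt0 : pt 0 = 0 := by simp [hpt]
  have hpt1 : pt (N + 1) = 1 := by
    refine Subtype.ext ?_
    rw [hptv _ le_rfl]
    push_cast
    exact div_self hNpos.ne'
  have h3 := h1 (N + 1) (fun i => pt i) (fun i => pt i) (fun i j hij => hmono hij) hpt0 (by
      simpa using hpt1) (fun i => ⟨le_rfl, hmono (by simp)⟩) (fun i => by
      have := hstep i i.2
      simp only [Fin.val_succ, Fin.val_castSucc, this]
      exact hN.trans_le (min_le_left _ _))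
  set S : E := ∑ i : Fin (N + 1), ((((pt (i + 1) : I) : ℝ) - pt i : ℝ) : 𝕜) •
    ((t : ℝ) : 𝕜) • γ (t * pt i) with hS
  have h3 : p (S - x) < r / 2 := h3
  have hloc : ∀ k < N + 1, p (Γ (t * pt (k + 1)) - Γ (t * pt k) -
      ((((pt (k + 1) : I) : ℝ) - pt k : ℝ) : 𝕜) • ((t : ℝ) : 𝕜) • γ (t * pt k)) ≤
      (ε + r / 2) * (1 / (N + 1)) := by
    intro k hk
    set v := γ (t * pt k) with hv
    have hd := hΓ.sub (hasCurveDeriv_smul_of_hasDerivAt (𝕜 := 𝕜) (fun u => hasDerivAt_id u) v)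
    have hle : t * pt k ≤ t * pt (k + 1) := by
      have : pt k ≤ pt (k + 1) := hmono (Nat.le_succ k)
      exact mul_le_mul_right this t
    have h4 := hd.seminorm_sub_le_mul hp (M := ε + r / 2) hle (fun s hs1 hs2 => ?_)
    · have e : (⇑Γ - fun s : I => ((id (s : ℝ) : ℝ) : 𝕜) • v) (t * pt (k + 1)) -
          (⇑Γ - fun s : I => ((id (s : ℝ) : ℝ) : 𝕜) • v) (t * pt k) =
          Γ (t * pt (k + 1)) - Γ (t * pt k) -
          ((((pt (k + 1) : I) : ℝ) - pt k : ℝ) : 𝕜) • ((t : ℝ) : 𝕜) • v := by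
        simp only [Pi.sub_apply, id, Set.Icc.coe_mul, smul_smul]
        push_cast
        module
      rw [e] at h4
      refine h4.trans ?_
      have : ((t * pt (k + 1) : I) : ℝ) - (t * pt k : I) ≤ 1 / (N + 1) := by
        rw [Set.Icc.coe_mul, Set.Icc.coe_mul, ← mul_sub, hstep k hk]
        exact mul_le_of_le_one_left (by positivity) t.2.2
      gcongr
    · have e : (⇑δ - fun _ : I => ((1 : ℝ) : 𝕜) • v) s = (δ s - γ s) + (γ s - v) := by simp
      rw [e]
      have hdist : dist s (t * pt k) < ρ := by
        have h5 : (s : ℝ) ≤ (t * pt (k + 1) : I) := hs2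
        have h6 : ((t * pt k : I) : ℝ) ≤ s := hs1
        rw [Subtype.dist_eq, Real.dist_eq, abs_of_nonneg (sub_nonneg.2 h6)]
        have : ((t * pt (k + 1) : I) : ℝ) - (t * pt k : I) ≤ 1 / (N + 1) := by
          rw [Set.Icc.coe_mul, Set.Icc.coe_mul, ← mul_sub, hstep k hk]
          exact mul_le_of_le_one_left (by positivity) t.2.2
        linarith [hN.trans_le (min_le_right _ _)]
      have := map_add_le_add p (δ s - γ s) (γ s - v)
      linarith [hε s, h2 s (t * pt k) hdist]
  have h5 : p (Γ t - Γ 0 - S) ≤ ε + r / 2 := by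
    have e : Γ t - Γ 0 - S = ∑ k ∈ Finset.range (N + 1), (Γ (t * pt (k + 1)) - Γ (t * pt k) -
        ((((pt (k + 1) : I) : ℝ) - pt k : ℝ) : 𝕜) • ((t : ℝ) : 𝕜) • γ (t * pt k)) := by
      rw [Finset.sum_sub_distrib, Finset.sum_range_sub (fun k => Γ (t * pt k)), hpt1, hpt0,
        mul_one, mul_zero, hS, ← Fin.sum_univ_eq_sum_range (fun k =>
        ((((pt (k + 1) : I) : ℝ) - pt k : ℝ) : 𝕜) • ((t : ℝ) : 𝕜) • γ (t * pt k))]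
    rw [e]
    refine (Finset.le_sum_of_subadditive p (map_zero p).le (map_add_le_add p) _ _).trans ?_
    refine (Finset.sum_le_sum fun k hk => hloc k (Finset.mem_range.1 hk)).trans (le_of_eq ?_)
    rw [Finset.sum_const, Finset.card_range, nsmul_eq_mul]
    push_cast
    field_simp
  have := map_add_le_add p (Γ t - Γ 0 - S) (S - x)
  rw [sub_add_sub_cancel] at this
  linarith

/-- The value at t is the Riemann integral of s ↦ tγ(ts), which is again Lipschitz. The primitives
of the Bernstein approximants converge to it. -/
theorem MackeyComplete.exists_primitive [T2Space E] (hE : MackeyComplete 𝕜 E)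
    {γ : C(I, E)} (hγ : IsLipschitzCurve 𝕜 γ) :
    ∃ Γ : C(I, E), HasCurveDeriv 𝕜 Γ γ ∧ Γ 0 = 0 := by
  obtain ⟨Γ, δ, hΓ, hΓ0, hδ⟩ := exists_approximate_primitives (𝕜 := 𝕜) γ
  refine exists_primitive_of_tendsto hΓ hΓ0 hδ fun t => ?_
  have hlip : IsLipschitzCurve 𝕜 (fun s => ((t : ℝ) : 𝕜) • γ (t * s)) := by
    refine isLipschitzCurve_iff.2 fun p hp => ?_
    obtain ⟨M, hM⟩ := isLipschitzCurve_iff.1 hγ p hp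
    refine ⟨t * (M * t), fun s s' => ?_⟩
    rw [← smul_sub, map_smul_eq_mul, RCLike.norm_ofReal, abs_of_nonneg t.2.1, mul_assoc]
    have h1 := hM (t * s) (t * s')
    rw [Set.Icc.coe_mul, Set.Icc.coe_mul, ← mul_sub, abs_mul, abs_of_nonneg t.2.1,
      ← mul_assoc] at h1
    exact mul_le_mul_of_nonneg_left h1 t.2.1
  obtain ⟨x, hx⟩ := hE _ hlip
  refine ⟨x, (tendsto_nhds_iff_seminorm 𝕜).2 fun p hp ε hε => ?_⟩
  filter_upwards [(tendsto_curve_iff_seminorm 𝕜).1 hδ p hp (ε / 2) (half_pos hε)] with n hn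
  have := seminorm_sub_riemannIntegral_le (hΓ n) hp (fun s => (hn s).le) t hx
  rw [hΓ0, sub_zero] at this
  linarith

/-- A tent function supported in `[1/2, 1]`. -/
def tent (v : ℝ) : ℝ := max 0 (min (v - 1 / 2) (1 - v))

theorem continuous_tent : Continuous tent := by
  unfold tent
  fun_prop

theorem tent_nonneg (v : ℝ) : 0 ≤ tent v := le_max_left _ _

theorem tent_le_one (v : ℝ) : tent v ≤ 1 := by
  unfold tent
  refine max_le zero_le_one ?_
  rcases le_total v 1 with h | h
  · exact (min_le_left _ _).trans (by linarith)
  · exact (min_le_right _ _).trans (by linarith)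

theorem abs_tent_sub_le (v w : ℝ) : |tent v - tent w| ≤ |v - w| := by
  unfold tent
  refine (abs_max_sub_max_le_max _ _ _ _).trans (max_le (by simp) ?_)
  refine (abs_min_sub_min_le_max _ _ _ _).trans (max_le ?_ ?_)
  · simp
  · rw [sub_sub_sub_cancel_left, abs_sub_comm]

theorem tent_eq_zero_of_one_le {v : ℝ} (h : 1 ≤ v) : tent v = 0 :=
  max_eq_left ((min_le_right _ _).trans (by linarith))

theorem mem_Ioo_of_tent_ne_zero {v : ℝ} (h : tent v ≠ 0) : 1 / 2 < v ∧ v < 1 := by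
  by_contra hv
  refine h (max_eq_left ?_)
  by_cases h1 : 1 / 2 < v
  · exact (min_le_right _ _).trans (by linarith [not_lt.1 fun h2 => hv ⟨h1, h2⟩])
  · exact (min_le_left _ _).trans (by linarith)

theorem integral_tent_pos : 0 < ∫ v in (0 : ℝ)..1, tent v := by
  refine intervalIntegral.integral_pos zero_lt_one continuous_tent.continuousOn
    (fun v _ => tent_nonneg v) ⟨3 / 4, by norm_num, ?_⟩
  norm_num [tent]

/-- The function u ↦ tent(2ⁿu) lives on the dyadic interval (2⁻ⁿ⁻¹, 2⁻ⁿ), and these are disjoint. If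
all of them vanish at `u`, the index 0 serves as a default. -/
theorem exists_tent_index (u : ℝ) : ∃ N : ℕ, ∀ n ≠ N, tent (2 ^ n * u) = 0 := by
  by_cases h : ∃ N : ℕ, tent (2 ^ N * u) ≠ 0
  · obtain ⟨N, hN⟩ := h
    refine ⟨N, fun n hn => ?_⟩
    by_contra hne
    have key : ∀ k l : ℕ, k < l → tent (2 ^ k * u) ≠ 0 → tent (2 ^ l * u) ≠ 0 → False := by
      intro k l hkl hk hl
      have h1 := (mem_Ioo_of_tent_ne_zero hk).1
      have h2 := (mem_Ioo_of_tent_ne_zero hl).2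
      have hu : 0 < u := by
        by_contra hu
        have : (2 : ℝ) ^ k * u ≤ 0 := mul_nonpos_of_nonneg_of_nonpos (by positivity) (not_lt.1 hu)
        linarith
      have h3 : (2 : ℝ) ^ (k + 1) * u ≤ 2 ^ l * u := by
        gcongr
        · norm_num
        · exact hkl
      rw [pow_succ] at h3
      linarith
    rcases lt_or_gt_of_ne hn with h | h
    · exact key _ _ h hne hN
    · exact key _ _ h hN hne
  · push Not at h
    exact ⟨0, fun n _ => h n⟩

/-- The series is realised as the integral of one Lipschitz curve Σ φₙbₙ. The bump φₙ(u) = 2⁻ⁿ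
tent(2ⁿu) has Lipschitz constant at most 1 and mass 4⁻ⁿκ, which forces bₙ = 4ⁿaₙ/κ. Factorial decay
beats 4ⁿ, so the vectors bₙ are bounded. -/
theorem MackeyComplete.factorialSummable (hE : MackeyComplete 𝕜 E) : FactorialSummable 𝕜 E := by
  intro a ha
  set κ : ℝ := ∫ v in (0 : ℝ)..1, tent v with hκ
  have hκ0 : 0 < κ := integral_tent_pos
  set b : ℕ → E := fun n => (((4 ^ n / κ : ℝ)) : 𝕜) • a n with hb
  have hbb : ∀ p : Seminorm 𝕜 E, Continuous p → ∃ K : ℝ, 0 ≤ K ∧ ∀ n, p (b n) ≤ K := by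
    intro p hp
    obtain ⟨C, M, h⟩ := ha p hp
    have hC : 0 ≤ C := by simpa using (apply_nonneg p _).trans (h 0)
    refine ⟨C / κ * Real.exp (4 * |M|), by positivity, fun n => ?_⟩
    rw [hb, map_smul_eq_mul, RCLike.norm_ofReal, abs_of_pos (by positivity)]
    calc 4 ^ n / κ * p (a n) ≤ 4 ^ n / κ * (C * (|M| ^ n / n.factorial)) := by
          gcongr
          refine (h n).trans (mul_le_mul_of_nonneg_left ?_ hC)
          refine div_le_div_of_nonneg_right ?_ (by positivity)
          rw [← abs_pow]
          exact le_abs_self _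
      _ = C / κ * ((4 * |M|) ^ n / n.factorial) := by rw [mul_pow]; ring
      _ ≤ _ := by
          gcongr
          exact Real.pow_div_factorial_le_exp _ (by positivity) n
  set φ : ℕ → ℝ → ℝ := fun n u => (2 ^ n)⁻¹ * tent (2 ^ n * u) with hφ
  have hφ0 : ∀ n u, 0 ≤ φ n u := fun n u => mul_nonneg (by positivity) (tent_nonneg _)
  have hφle : ∀ n u, φ n u ≤ (2 ^ n)⁻¹ := fun n u =>
    mul_le_of_le_one_right (by positivity) (tent_le_one _)
  have hφlip : ∀ n u v, |φ n u - φ n v| ≤ |u - v| := by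
    intro n u v
    rw [hφ, ← mul_sub, abs_mul, abs_of_pos (by positivity), inv_mul_le_iff₀ (by positivity)]
    refine (abs_tent_sub_le _ _).trans (le_of_eq ?_)
    rw [← mul_sub, abs_mul, abs_of_pos (by positivity)]
  choose N hN using exists_tent_index
  have hφN : ∀ u n, n ≠ N u → φ n u = 0 := fun u n hn => by simp [hφ, hN u n hn]
  set γ : I → E := fun t => ((φ (N t) t : ℝ) : 𝕜) • b (N t) with hγ
  have hlip : IsLipschitzCurve 𝕜 γ := by
    refine isLipschitzCurve_iff.2 fun p hp => ?_
    obtain ⟨K, hK0, hK⟩ := hbb p hp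
    have h1 : ∀ n (s t : I), p (((φ n s - φ n t : ℝ) : 𝕜) • b n) ≤ K * |(s : ℝ) - t| := by
      intro n s t
      rw [map_smul_eq_mul, RCLike.norm_ofReal, mul_comm]
      have := hφlip n s t
      gcongr
      exact hK n
    refine ⟨2 * K, fun s t => ?_⟩
    by_cases h : N s = N t
    · have e : γ s - γ t = ((φ (N t) s - φ (N t) t : ℝ) : 𝕜) • b (N t) := by
        simp only [hγ, h]
        push_cast
        module
      rw [e]
      have : 0 ≤ K * |(s : ℝ) - t| := by positivity
      linarith [h1 (N t) s t]
    -- Each of the two bumps vanishes at the other point, so the increment is a difference of two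
    -- single-bump increments. This is the origin of the factor 2.
    · have e : γ s - γ t = ((φ (N s) s - φ (N s) t : ℝ) : 𝕜) • b (N s) -
          ((φ (N t) t - φ (N t) s : ℝ) : 𝕜) • b (N t) := by
        rw [hφN t _ h, hφN s _ (Ne.symm h)]
        simp [hγ]
      rw [e]
      have h2 := map_sub_le_add p (((φ (N s) s - φ (N s) t : ℝ) : 𝕜) • b (N s))
        (((φ (N t) t - φ (N t) s : ℝ) : 𝕜) • b (N t))
      have h3 := h1 (N t) t s
      rw [abs_sub_comm] at h3
      linarith [h1 (N s) s t]
  obtain ⟨x, hx⟩ := hE γ hlip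
  refine ⟨x, ?_⟩
  set Ψ : ℝ → ℝ := fun v => ∫ w in (0 : ℝ)..v, tent w with hΨ
  have hΨd : ∀ v, HasDerivAt Ψ (tent v) v := fun v =>
    intervalIntegral.integral_hasDerivAt_right (continuous_tent.intervalIntegrable 0 v)
      continuous_tent.stronglyMeasurable.stronglyMeasurableAtFilter continuous_tent.continuousAt
  -- As 2ⁿ ≥ 1 and the tent vanishes beyond 1, the whole mass κ is collected.
  have hΨn : ∀ n : ℕ, Ψ (2 ^ n) = κ := by
    intro n
    have h1 : (1 : ℝ) ≤ 2 ^ n := one_le_pow₀ (by norm_num)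
    have h2 : ∫ w in (1 : ℝ)..2 ^ n, tent w = 0 := by
      rw [intervalIntegral.integral_congr (g := fun _ => 0)]
      · simp
      · intro w hw
        rw [Set.uIcc_of_le h1] at hw
        exact tent_eq_zero_of_one_le hw.1
    have h3 := intervalIntegral.integral_add_adjacent_intervals (μ := MeasureTheory.volume)
      (continuous_tent.intervalIntegrable 0 1) (continuous_tent.intervalIntegrable 1 (2 ^ n))
    rw [h2, add_zero] at h3
    exact h3.symm
  have hgd : ∀ n u, HasDerivAt (fun u => (4 ^ n)⁻¹ * Ψ (2 ^ n * u)) (φ n u) u := by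
    intro n u
    have h1 := ((hΨd (2 ^ n * u)).comp u ((hasDerivAt_id u).const_mul (2 ^ n))).const_mul
      ((4 : ℝ) ^ n)⁻¹
    refine h1.congr_deriv ?_
    have : (4 : ℝ) ^ n = 2 ^ n * 2 ^ n := by rw [← mul_pow]; norm_num
    rw [hφ, this]
    field_simp
  have hd : ∀ m, HasCurveDeriv 𝕜
      (fun t : I => ∑ n ∈ Finset.range m, (((4 ^ n)⁻¹ * Ψ (2 ^ n * t) : ℝ) : 𝕜) • b n)
      (fun t : I => ∑ n ∈ Finset.range m, ((φ n t : ℝ) : 𝕜) • b n) := fun m =>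
    HasCurveDeriv.sum _ fun n _ => hasCurveDeriv_smul_of_hasDerivAt (hgd n) (b n)
  have hφc : ∀ n, Continuous (φ n) := fun n =>
    continuous_const.mul (continuous_tent.comp (by fun_prop))
  have hδc : ∀ m, Continuous (fun t : I => ∑ n ∈ Finset.range m, ((φ n t : ℝ) : 𝕜) • b n) :=
    fun m => continuous_finsetSum _ fun n _ =>
      (RCLike.continuous_ofReal.comp ((hφc n).comp continuous_subtype_val)).smul continuous_const
  refine (tendsto_nhds_iff_seminorm 𝕜).2 fun p hp ε hε => ?_
  obtain ⟨K, hK0, hK⟩ := hbb p hp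
  have hlim : Tendsto (fun m : ℕ => ((2 : ℝ) ^ m)⁻¹ * K) atTop (𝓝 0) := by
    have := (tendsto_inv_atTop_zero.comp
      (tendsto_pow_atTop_atTop_of_one_lt (one_lt_two (α := ℝ)))).mul_const K
    simpa using this
  filter_upwards [hlim.eventually (gt_mem_nhds hε)] with m hm
  have h1 := seminorm_sub_riemannIntegral_le (Γ := ⟨_, (hd m).continuous⟩) (δ := ⟨_, hδc m⟩)
    (γ := ⟨γ, hlip.continuous⟩) (hd m) hp (ε := (2 ^ m)⁻¹ * K) (fun s => ?_) 1 (x := x) (by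
      simpa using hx)
  · refine lt_of_le_of_lt (le_of_eq_of_le ?_ h1) hm
    congr 2
    have e : ∀ n, (((4 ^ n)⁻¹ * κ : ℝ) : 𝕜) • b n = a n := by
      intro n
      rw [hb, smul_smul, ← RCLike.ofReal_mul]
      have : (4 ^ n)⁻¹ * κ * (4 ^ n / κ) = 1 := by field_simp
      rw [this, RCLike.ofReal_one, one_smul]
    have e0 : Ψ 0 = 0 := by simp [hΨ]
    simp only [ContinuousMap.coe_mk, Set.Icc.coe_one, mul_one, hΨn, e, Set.Icc.coe_zero, mul_zero,
      e0, RCLike.ofReal_zero, zero_smul, Finset.sum_const_zero, sub_zero]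
  -- The curve and its m-th partial sum differ only where a bump of index at least m is active, and
  -- there by at most 2⁻ᵐK.
  · simp only [ContinuousMap.coe_mk, hγ]
    by_cases h : N s < m
    · rw [Finset.sum_eq_single (N s) (fun n _ hn => by rw [hφN s n hn]; simp)
        (fun hn => absurd (Finset.mem_range.2 h) hn), sub_self, map_zero]
      positivity
    · rw [Finset.sum_eq_zero fun n hn => by
        rw [hφN s n (by have := Finset.mem_range.1 hn; omega)]; simp, zero_sub, map_neg_eq_map,
        map_smul_eq_mul, RCLike.norm_ofReal, abs_of_nonneg (hφ0 _ _)]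
      have h2 : ((2 : ℝ) ^ N s)⁻¹ ≤ (2 ^ m)⁻¹ := by
        gcongr
        · norm_num
        · omega
      have := (hφle (N s) s).trans h2
      gcongr
      exact hK _

end Primitives

/-! ### Product bounds from condition (∗), Picard spaces and regularity. -/

section PicardSpaces

variable {𝕜 : Type*} [RCLike 𝕜] {A : Type*} [Ring A] [Algebra 𝕜 A] [TopologicalSpace A]
  [IsTopologicalRing A] [ContinuousSMul 𝕜 A]

theorem HasContinuousInverse.units_mem (h : HasContinuousInverse A) :
    {a : A | IsUnit a} ∈ 𝓝 (1 : A) :=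
  h.1.mem_nhds isUnit_one

theorem prod_map_smul (f : A → 𝕜) (w : List A) :
    (w.map fun a => f a • a).prod = (w.map f).prod • w.prod := by
  induction w with
  | nil => simp
  | cons a w ih => simp only [List.map_cons, List.prod_cons, ih, smul_mul_smul_comm]

theorem le_mulNorm (p q : Seminorm 𝕜 A) (w : List A) (hw : ∀ a ∈ w, q a ≤ 1) :
    ENNReal.ofReal (p w.prod) ≤ mulNorm p q w.length := by
  have := le_iSup₂ (f := fun (x : Fin w.length → A) (_ : ∀ i, q (x i) ≤ 1) =>
    ENNReal.ofReal (p (List.ofFn x).prod)) w.get (fun i => hw _ (List.get_mem w i))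
  rwa [List.ofFn_get] at this

/-- Every term of a convergent series of nonnegative terms is at most its sum S, so rⁿp(x₁⋯xₙ) ≤ S
on the unit ball of `q`. Homogeneity extends this to all arguments, and replacing `q` by r⁻¹q
absorbs rⁿ. -/
theorem ConditionStar.exists_prodBound (h : ConditionStar 𝕜 A) (p : Seminorm 𝕜 A)
    (hp : Continuous p) : ∃ q : Seminorm 𝕜 A, Continuous q ∧ ∃ C : ℝ, ProdBound p q C := by
  obtain ⟨q, hq, r, hr, hS⟩ := h p hp
  set S : ENNReal := ∑' n : ℕ, ENNReal.ofReal r ^ (n + 1) * mulNorm p q (n + 1) with hSdef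
  have h1 : ∀ w : List A, w ≠ [] → (∀ a ∈ w, q a ≤ 1) → r ^ w.length * p w.prod ≤ S.toReal := by
    intro w hw0 hw
    obtain ⟨n, hn⟩ := Nat.exists_eq_succ_of_ne_zero (List.length_pos_iff.2 hw0).ne'
    have h2 : ENNReal.ofReal (r ^ w.length * p w.prod) ≤ S := by
      rw [ENNReal.ofReal_mul (by positivity), ENNReal.ofReal_pow hr.le]
      refine (mul_le_mul_right (le_mulNorm p q w hw) _).trans ?_
      rw [hn]
      exact ENNReal.le_tsum (f := fun n => ENNReal.ofReal r ^ (n + 1) * mulNorm p q (n + 1)) n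
    exact (ENNReal.ofReal_le_iff_le_toReal hS.ne).1 h2
  obtain ⟨c, hc⟩ : ∃ c : NNReal, (c : ℝ) = r⁻¹ := ⟨⟨r⁻¹, inv_nonneg.2 hr.le⟩, rfl⟩
  -- The maximum with p(1) covers the empty word, which the sum over n ≥ 1 does not see.
  refine ⟨c • q, hq.const_smul c, max S.toReal (p 1), fun w => ?_⟩
  rcases eq_or_ne w [] with rfl | hw0
  · simp
  -- Dividing by q(a) + δ is legitimate even where q(a) = 0; afterwards δ → 0.
  have h3 : ∀ δ : ℝ, 0 < δ → r ^ w.length * p w.prod ≤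
      S.toReal * (w.map fun a => q a + δ).prod := by
    intro δ hδ
    have hpos : ∀ a, 0 < q a + δ := fun a => add_pos_of_nonneg_of_pos (apply_nonneg q a) hδ
    have hprod : 0 < (w.map fun a => q a + δ).prod := List.prod_pos fun x hx => by
      obtain ⟨a, -, rfl⟩ := List.mem_map.1 hx
      exact hpos a
    have h4 := h1 (w.map fun a => (((q a + δ : ℝ) : 𝕜))⁻¹ • a) (by simpa using hw0) (by
      intro x hx
      obtain ⟨a, -, rfl⟩ := List.mem_map.1 hx
      rw [map_smul_eq_mul, norm_inv, RCLike.norm_ofReal, abs_of_pos (hpos a),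
        inv_mul_le_iff₀ (hpos a)]
      linarith)
    have e : ‖(w.map fun a => (((q a + δ : ℝ) : 𝕜))⁻¹).prod‖ =
        ((w.map fun a => q a + δ).prod)⁻¹ := by
      clear h4 hprod hw0
      induction w with
      | nil => simp
      | cons a w ih =>
        rw [List.map_cons, List.prod_cons, norm_mul, ih, List.map_cons, List.prod_cons, mul_inv,
          norm_inv, RCLike.norm_ofReal, abs_of_pos (hpos a)]
    rw [prod_map_smul (fun a => (((q a + δ : ℝ) : 𝕜))⁻¹), map_smul_eq_mul, List.length_map, e,
      mul_left_comm, inv_mul_le_iff₀ hprod, mul_comm _ S.toReal] at h4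
    exact h4
  have h5 : r ^ w.length * p w.prod ≤ S.toReal * (w.map q).prod := by
    have hlim : Tendsto (fun δ : ℝ => S.toReal * (w.map fun a => q a + δ).prod) (𝓝[>] 0)
        (𝓝 (S.toReal * (w.map q).prod)) := by
      have : Continuous (fun δ : ℝ => S.toReal * (w.map fun a => q a + δ).prod) :=
        continuous_const.mul (continuous_list_prod _ fun a _ => by fun_prop)
      simpa using (this.tendsto 0).mono_left nhdsWithin_le_nhds
    refine ge_of_tendsto hlim ?_
    filter_upwards [self_mem_nhdsWithin] with δ hδ using h3 δ hδ
  have e : (w.map (c • q)).prod = (r⁻¹) ^ w.length * (w.map q).prod := by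
    clear h3 h5 hw0
    induction w with
    | nil => simp
    | cons a w ih =>
      have : (c • q) a = r⁻¹ * q a := by rw [← hc]; rfl
      rw [List.map_cons, List.prod_cons, ih, this, List.map_cons, List.prod_cons, List.length_cons,
        pow_succ]
      ring
  rw [e]
  have hP := map_prod_nonneg q w
  calc p w.prod = r⁻¹ ^ w.length * (r ^ w.length * p w.prod) := by
        rw [← mul_assoc, ← mul_pow, inv_mul_cancel₀ hr.ne', one_pow, one_mul]
    _ ≤ r⁻¹ ^ w.length * (S.toReal * (w.map q).prod) := by gcongr
    _ = S.toReal * (r⁻¹ ^ w.length * (w.map q).prod) := by ring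
    _ ≤ _ := by
        gcongr
        exact le_max_left _ _

variable [PolynormableSpace 𝕜 A] [T2Space A]

theorem SequentiallyComplete.isPicardSpace (hA : SequentiallyComplete A)
    (hstar : ∀ p : Seminorm 𝕜 A, Continuous p →
      ∃ q : Seminorm 𝕜 A, Continuous q ∧ ∃ C : ℝ, ProdBound p q C)
    (hu : {a : A | IsUnit a} ∈ 𝓝 (1 : A)) : IsPicardSpace (⊤ : Submodule 𝕜 C(I, A)) where
  prodBound := hstar
  units_mem := hu
  summable := hA.factorialSummable
  exists_primitive γ _ := hA.exists_primitive γ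
  mul_mem _ _ := trivial
  mem_mul _ _ := trivial

theorem IsLipschitzCurve.mul (hstar : ∀ p : Seminorm 𝕜 A, Continuous p →
      ∃ q : Seminorm 𝕜 A, Continuous q ∧ ∃ C : ℝ, ProdBound p q C) {γ δ : C(I, A)}
    (hγ : IsLipschitzCurve 𝕜 γ) (hδ : IsLipschitzCurve 𝕜 δ) :
    IsLipschitzCurve 𝕜 (γ * δ : C(I, A)) := by
  refine isLipschitzCurve_iff.2 fun p hp => ?_
  obtain ⟨q, hq, C, hC⟩ := hstar p hp
  have hC0 : 0 ≤ C := by simpa using (apply_nonneg p _).trans (hC [])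
  have hmul : ∀ a b, p (a * b) ≤ C * (q a * q b) := fun a b => by simpa using hC [a, b]
  obtain ⟨M, hM⟩ := isLipschitzCurve_iff.1 hγ q hq
  obtain ⟨M', hM'⟩ := isLipschitzCurve_iff.1 hδ q hq
  obtain ⟨K, hK0, hK⟩ := exists_seminorm_curve_le hq γ
  obtain ⟨K', hK'0, hK'⟩ := exists_seminorm_curve_le hq δ
  refine ⟨C * (M * K' + K * M'), fun s t => ?_⟩
  have e : (γ * δ) s - (γ * δ) t = (γ s - γ t) * δ s + γ t * (δ s - δ t) := by
    simp only [ContinuousMap.mul_apply]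
    noncomm_ring
  rw [e]
  have h1 : q (γ s - γ t) * q (δ s) ≤ (M * |(s : ℝ) - t|) * K' :=
    mul_le_mul (hM s t) (hK' s) (apply_nonneg _ _) ((apply_nonneg _ _).trans (hM s t))
  have h2 : q (γ t) * q (δ s - δ t) ≤ K * (M' * |(s : ℝ) - t|) :=
    mul_le_mul (hK t) (hM' s t) (apply_nonneg _ _) hK0
  calc _ ≤ C * (q (γ s - γ t) * q (δ s)) + C * (q (γ t) * q (δ s - δ t)) :=
        (map_add_le_add p _ _).trans (add_le_add (hmul _ _) (hmul _ _))
    _ ≤ C * ((M * |(s : ℝ) - t|) * K') + C * (K * (M' * |(s : ℝ) - t|)) := by gcongr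
    _ = _ := by ring

theorem MackeyComplete.isPicardSpace (hA : MackeyComplete 𝕜 A)
    (hstar : ∀ p : Seminorm 𝕜 A, Continuous p →
      ∃ q : Seminorm 𝕜 A, Continuous q ∧ ∃ C : ℝ, ProdBound p q C)
    (hu : {a : A | IsUnit a} ∈ 𝓝 (1 : A)) : IsPicardSpace (lipSubmodule 𝕜 A) where
  prodBound := hstar
  units_mem := hu
  summable := hA.factorialSummable
  exists_primitive _ h := hA.exists_primitive h
  mul_mem hη h := IsLipschitzCurve.mul hstar hη.isLipschitzCurve h
  mem_mul hη h := IsLipschitzCurve.mul hstar h hη.isLipschitzCurve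

theorem CrCurve.toCurveLinear_mem_lipSubmodule {r k : ℕ∞} (hr : 1 ≤ r) (γ : CrCurve 𝕜 A r k) :
    CrCurve.toCurveLinear 𝕜 A r k γ ∈ lipSubmodule 𝕜 A :=
  (γ.hasCurveDeriv hr).isLipschitzCurve

/-- Regularity properties of the unit group of a sequentially complete algebra. -/
theorem SequentiallyComplete.unitsStronglyRegular
    (hL : IsPicardSpace (⊤ : Submodule 𝕜 C(I, A))) : UnitsStronglyRegular 𝕜 A 0 :=
  ⟨hL.evolMap (c := CrCurve.toCurveLinear 𝕜 A 0 0) fun _ => trivial,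
    hL.isEvolutionMap_evolMap (c := CrCurve.toCurveLinear 𝕜 A 0 0) _,
    hL.isCrOn_evol (c := CrCurve.toCurveLinear 𝕜 A 0 0) CrCurve.continuous_toCurve fun _ => trivial⟩

theorem MackeyComplete.unitsRegular (hL : IsPicardSpace (lipSubmodule 𝕜 A)) :
    UnitsRegular 𝕜 A 0 :=
  ⟨hL.evolMap (c := CrCurve.toCurveLinear 𝕜 A ⊤ 0) (CrCurve.toCurveLinear_mem_lipSubmodule le_top),
    hL.isEvolutionMap_evolMap (c := CrCurve.toCurveLinear 𝕜 A ⊤ 0) _,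
    hL.isCrOn_evol (c := CrCurve.toCurveLinear 𝕜 A ⊤ 0) CrCurve.continuous_toCurve
      (CrCurve.toCurveLinear_mem_lipSubmodule le_top)⟩

theorem MackeyComplete.unitsStronglyRegular (hL : IsPicardSpace (lipSubmodule 𝕜 A)) :
    UnitsStronglyRegular 𝕜 A 1 :=
  ⟨hL.evolMap (c := CrCurve.toCurveLinear 𝕜 A 1 1) (CrCurve.toCurveLinear_mem_lipSubmodule le_rfl),
    hL.isEvolutionMap_evolMap (c := CrCurve.toCurveLinear 𝕜 A 1 1) _,
    hL.isCrOn_evol (c := CrCurve.toCurveLinear 𝕜 A 1 1) CrCurve.continuous_toCurve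
      (CrCurve.toCurveLinear_mem_lipSubmodule le_rfl)⟩

end PicardSpaces

/-! ### Complex analyticity of the evolution map. -/

section ComplexAnalytic

/-- Nonnegative complex numbers are real, so a basis of real convex neighbourhoods is also one for
the ordered scalars ℂ, and complex seminorms become available. -/
theorem polynormableSpace_complex {E : Type*} [AddCommGroup E] [Module ℂ E] [TopologicalSpace E]
    [IsTopologicalAddGroup E] [ContinuousSMul ℂ E] [LocallyConvexSpace ℝ E] :
    PolynormableSpace ℂ E := by
  have : ContinuousSMul ℝ E := ⟨by
    have : (fun z : ℝ × E => z.1 • z.2) = fun z : ℝ × E => (z.1 : ℂ) • z.2 := by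
      funext z
      exact (Complex.coe_smul z.1 z.2).symm
    rw [this]
    exact (Complex.continuous_ofReal.comp continuous_fst).smul continuous_snd⟩
  open scoped ComplexOrder in
  have : LocallyConvexSpace ℂ E := by
    refine LocallyConvexSpace.ofBasisZero ℂ E (fun V : Set E => V)
      (fun V => V ∈ 𝓝 0 ∧ Convex ℝ V) (LocallyConvexSpace.convex_basis_zero ℝ E) fun V hV => ?_
    intro x hx y hy a b ha hb hab
    have ha' : a = (a.re : ℂ) := Complex.ext rfl (Complex.nonneg_iff.1 ha).2.symm
    have hb' : b = (b.re : ℂ) := Complex.ext rfl (Complex.nonneg_iff.1 hb).2.symm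
    rw [ha', hb', Complex.coe_smul, Complex.coe_smul]
    refine hV.2 hx hy (Complex.nonneg_iff.1 ha).1 (Complex.nonneg_iff.1 hb).1 ?_
    simpa using congrArg Complex.re hab
  infer_instance

variable {A : Type*} [Ring A] [Algebra ℂ A] [TopologicalSpace A]
  [IsTopologicalRing A] [ContinuousSMul ℂ A] [PolynormableSpace ℂ A] [T2Space A]
  {L : Submodule ℂ C(I, A)}
  {X : Type*} [AddCommGroup X] [Module ℂ X] [TopologicalSpace X] {c : X →ₗ[ℂ] C(I, A)}

theorem IsPicardSpace.isComplexAnalyticOn_evolMap (hL : IsPicardSpace L) (hc : Continuous c)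
    (hcL : ∀ x, c x ∈ L) : IsComplexAnalyticOn (hL.evolMap hcL) Set.univ := by
  refine ⟨(hL.continuous_evolMap hc hcL).continuousOn, fun x _ =>
    ⟨Set.univ, univ_mem, fun _ _ => trivial, ?_⟩⟩
  obtain ⟨β, hβ⟩ := hL.exists_series_evolMap hc hcL x
  exact ⟨β, fun y _ => hβ y⟩

/-- Composition with `splitSpace` moves values from C¹-curves in the complexification to the
complexification of the space of C¹-curves. -/
theorem IsComplexAnalyticOn.continuousLinearMap_comp {E F G : Type*} [AddCommGroup E] [Module ℂ E]
    [TopologicalSpace E] [AddCommGroup F] [Module ℂ F] [TopologicalSpace F] [AddCommGroup G]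
    [Module ℂ G] [TopologicalSpace G] {f : E → F} {U : Set E} (hf : IsComplexAnalyticOn f U)
    (φ : F →L[ℂ] G) : IsComplexAnalyticOn (fun x => φ (f x)) U := by
  refine ⟨φ.continuous.comp_continuousOn hf.1, fun x hx => ?_⟩
  obtain ⟨Y, hY, hYU, β, hβ⟩ := hf.2 x hx
  refine ⟨Y, hY, hYU, fun n => φ.compContinuousMultilinearMap (β n), fun y hy => ?_⟩
  refine ((φ.continuous.tendsto _).comp (hβ y hy)).congr fun N => ?_
  simp

end ComplexAnalytic

/-! ### Complexification of spaces, algebras and curves. -/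

namespace Complexification

section Parts

variable {E : Type*}

/-- The real part. -/
def re (z : Complexification E) : E := z.1

/-- The imaginary part. -/
def im (z : Complexification E) : E := z.2

/-- The element `a + ib`. -/
def mk (a b : E) : Complexification E := (a, b)

@[ext]
theorem ext {z w : Complexification E} (h1 : re z = re w) (h2 : im z = im w) : z = w :=
  Prod.ext h1 h2

@[simp] theorem re_mk (a b : E) : re (mk a b) = a := rfl
@[simp] theorem im_mk (a b : E) : im (mk a b) = b := rfl

variable [AddCommGroup E]

@[simp] theorem re_ofReal (a : E) : re (ofReal a) = a := rfl
@[simp] theorem im_ofReal (a : E) : im (ofReal a) = 0 := rfl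
@[simp] theorem re_zero : re (0 : Complexification E) = 0 := rfl
@[simp] theorem im_zero : im (0 : Complexification E) = 0 := rfl
@[simp] theorem re_add (z w : Complexification E) : re (z + w) = re z + re w := rfl
@[simp] theorem im_add (z w : Complexification E) : im (z + w) = im z + im w := rfl
@[simp] theorem re_sub (z w : Complexification E) : re (z - w) = re z - re w := rfl
@[simp] theorem im_sub (z w : Complexification E) : im (z - w) = im z - im w := rfl

@[simp] theorem re_sum {ι : Type*} (s : Finset ι) (f : ι → Complexification E) :
    re (∑ i ∈ s, f i) = ∑ i ∈ s, re (f i) :=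
  map_sum (⟨⟨re, rfl⟩, re_add⟩ : Complexification E →+ E) f s

@[simp] theorem im_sum {ι : Type*} (s : Finset ι) (f : ι → Complexification E) :
    im (∑ i ∈ s, f i) = ∑ i ∈ s, im (f i) :=
  map_sum (⟨⟨im, rfl⟩, im_add⟩ : Complexification E →+ E) f s

variable [Module ℝ E]

@[simp] theorem re_smul (r : ℂ) (z : Complexification E) :
    re (r • z) = r.re • re z - r.im • im z := rfl
@[simp] theorem im_smul (r : ℂ) (z : Complexification E) :
    im (r • z) = r.re • im z + r.im • re z := rfl

theorem re_ofReal_smul (r : ℝ) (z : Complexification E) :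
    re ((RCLike.ofReal r : ℂ) • z) = r • re z := by
  have h1 : (RCLike.ofReal r : ℂ).re = r := Complex.ofReal_re r
  have h2 : (RCLike.ofReal r : ℂ).im = 0 := Complex.ofReal_im r
  rw [re_smul, h1, h2, zero_smul, sub_zero]

theorem im_ofReal_smul (r : ℝ) (z : Complexification E) :
    im ((RCLike.ofReal r : ℂ) • z) = r • im z := by
  have h1 : (RCLike.ofReal r : ℂ).re = r := Complex.ofReal_re r
  have h2 : (RCLike.ofReal r : ℂ).im = 0 := Complex.ofReal_im r
  rw [im_smul, h1, h2, zero_smul, add_zero]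

theorem ofReal_smul (r : ℝ) (a : E) :
    ofReal (r • a) = (RCLike.ofReal r : ℂ) • ofReal a := by
  ext
  · rw [re_ofReal_smul, re_ofReal, re_ofReal]
  · rw [im_ofReal_smul, im_ofReal, im_ofReal, smul_zero]

end Parts

section Ring

variable {A : Type*} [Ring A] [Algebra ℝ A]

instance : Mul (Complexification A) :=
  ⟨fun z w => mk (re z * re w - im z * im w) (re z * im w + im z * re w)⟩

instance : One (Complexification A) := ⟨ofReal 1⟩

@[simp] theorem re_mul (z w : Complexification A) :
    re (z * w) = re z * re w - im z * im w := rfl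
@[simp] theorem im_mul (z w : Complexification A) :
    im (z * w) = re z * im w + im z * re w := rfl
@[simp] theorem re_one : re (1 : Complexification A) = 1 := rfl
@[simp] theorem im_one : im (1 : Complexification A) = 0 := rfl

instance : Ring (Complexification A) where
  __ := (inferInstance : AddCommGroup (Complexification A))
  left_distrib z w v := by ext <;> simp <;> noncomm_ring
  right_distrib z w v := by ext <;> simp <;> noncomm_ring
  zero_mul z := by ext <;> simp
  mul_zero z := by ext <;> simp
  mul_assoc z w v := by ext <;> simp <;> noncomm_ring
  one_mul z := by ext <;> simp
  mul_one z := by ext <;> simp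

instance : Algebra ℂ (Complexification A) :=
  Algebra.ofModule
    (fun r z w => by
      ext <;> simp only [re_mul, im_mul, re_smul, im_smul, sub_mul, add_mul, smul_mul_assoc] <;>
        module)
    (fun r z w => by
      ext <;> simp only [re_mul, im_mul, re_smul, im_smul, mul_sub, mul_add, mul_smul_comm] <;>
        module)

end Ring

section Topology

variable {E : Type*} [AddCommGroup E] [Module ℝ E] [TopologicalSpace E]

theorem continuous_re : Continuous (re : Complexification E → E) :=
  continuous_fst (X := E) (Y := E)

theorem continuous_im : Continuous (im : Complexification E → E) :=
  continuous_snd (X := E) (Y := E)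

theorem continuous_mk {Z : Type*} [TopologicalSpace Z] {f g : Z → E} (hf : Continuous f)
    (hg : Continuous g) : Continuous (fun z => mk (f z) (g z)) :=
  Continuous.prodMk hf hg

theorem continuous_ofReal : Continuous (ofReal : E → Complexification E) :=
  continuous_mk continuous_id continuous_const

theorem tendsto_mk {ι : Type*} {l : Filter ι} {f : ι → Complexification E}
    {z : Complexification E} (h1 : Tendsto (fun i => re (f i)) l (𝓝 (re z)))
    (h2 : Tendsto (fun i => im (f i)) l (𝓝 (im z))) : Tendsto f l (𝓝 z) :=
  Tendsto.prodMk_nhds h1 h2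

instance [IsTopologicalAddGroup E] : IsTopologicalAddGroup (Complexification E) :=
  inferInstanceAs (IsTopologicalAddGroup (E × E))

instance [T2Space E] : T2Space (Complexification E) := inferInstanceAs (T2Space (E × E))

instance [IsTopologicalAddGroup E] [ContinuousSMul ℝ E] :
    ContinuousSMul ℂ (Complexification E) := ⟨by
  have h1 : Continuous fun p : ℂ × Complexification E => re p.2 := continuous_re.comp continuous_snd
  have h2 : Continuous fun p : ℂ × Complexification E => im p.2 := continuous_im.comp continuous_snd
  have h3 : Continuous fun p : ℂ × Complexification E => p.1.re :=
    Complex.continuous_re.comp continuous_fst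
  have h4 : Continuous fun p : ℂ × Complexification E => p.1.im :=
    Complex.continuous_im.comp continuous_fst
  exact continuous_mk ((h3.smul h1).sub (h4.smul h2)) ((h3.smul h2).add (h4.smul h1))⟩

instance [LocallyConvexSpace ℝ E] [IsTopologicalAddGroup E] :
    LocallyConvexSpace ℝ (Complexification E) := by
  refine LocallyConvexSpace.ofBasisZero ℝ (Complexification E) (fun V : Set E × Set E => V.1 ×ˢ V.2)
    (fun V => (V.1 ∈ 𝓝 (0 : E) ∧ Convex ℝ V.1) ∧ (V.2 ∈ 𝓝 (0 : E) ∧ Convex ℝ V.2)) ?_ ?_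
  · have h := (LocallyConvexSpace.convex_basis_zero ℝ E).prod
      (LocallyConvexSpace.convex_basis_zero ℝ E)
    have e : 𝓝 (0 : Complexification E) = 𝓝 (0 : E) ×ˢ 𝓝 (0 : E) := nhds_prod_eq
    rw [e]
    exact h
  · rintro ⟨V, W⟩ ⟨⟨-, hV⟩, -, hW⟩ x hx y hy a b ha hb hab
    have e : a • x + b • y = mk (a • re x + b • re y) (a • im x + b • im y) := by
      have h1 : ∀ (r : ℝ) (z : Complexification E), r • z = (RCLike.ofReal r : ℂ) • z :=
        fun r z => rfl
      rw [h1, h1]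
      ext <;>
      simp only [re_add, im_add, re_ofReal_smul, im_ofReal_smul, re_mk, im_mk]
    rw [e]
    exact ⟨hV hx.1 hy.1 ha hb hab, hW hx.2 hy.2 ha hb hab⟩

instance {A : Type*} [Ring A] [Algebra ℝ A] [TopologicalSpace A] [IsTopologicalRing A] :
    IsTopologicalRing (Complexification A) where
  continuous_add := (inferInstance : IsTopologicalAddGroup (Complexification A)).continuous_add
  continuous_neg := (inferInstance : IsTopologicalAddGroup (Complexification A)).continuous_neg
  continuous_mul := by
    have h1 : Continuous fun p : Complexification A × Complexification A => re p.1 :=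
      continuous_re.comp continuous_fst
    have h2 : Continuous fun p : Complexification A × Complexification A => im p.1 :=
      continuous_im.comp continuous_fst
    have h3 : Continuous fun p : Complexification A × Complexification A => re p.2 :=
      continuous_re.comp continuous_snd
    have h4 : Continuous fun p : Complexification A × Complexification A => im p.2 :=
      continuous_im.comp continuous_snd
    exact continuous_mk ((h1.mul h3).sub (h2.mul h4)) ((h1.mul h4).add (h2.mul h3))

/-! ### Completeness -/

theorem sequentiallyComplete (hE : SequentiallyComplete E) :
    SequentiallyComplete (Complexification E) := by
  intro u hu
  obtain ⟨x, hx⟩ := hE (fun n => re (u n)) fun V hV =>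
    hu _ (continuous_re.continuousAt (x := (0 : Complexification E)) hV)
  obtain ⟨y, hy⟩ := hE (fun n => im (u n)) fun V hV =>
    hu _ (continuous_im.continuousAt (x := (0 : Complexification E)) hV)
  exact ⟨mk x y, tendsto_mk hx hy⟩

/-- Positive homogeneity upgrades the inclusion of {q < 1} in {f < 1} to f ≤ q. This serves
functions such as p(re z) + p(im z), which need not be invariant under complex rotations and hence
need not be complex seminorms. -/
theorem exists_seminorm_ge {𝕜 : Type*} [RCLike 𝕜] {F : Type*} [AddCommGroup F] [Module 𝕜 F]
    [TopologicalSpace F] [PolynormableSpace 𝕜 F] {f : F → ℝ} (hf : Continuous f) (hf0 : f 0 = 0)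
    (h : ∀ (r : ℝ) (x : F), 0 < r → f ((r : 𝕜) • x) = r * f x) :
    ∃ q : Seminorm 𝕜 F, Continuous q ∧ ∀ x, f x ≤ q x := by
  obtain ⟨q, hq, hqf⟩ := exists_seminorm_lt_one_subset 𝕜
    (hf.continuousAt.eventually (gt_mem_nhds (show f 0 < 1 by rw [hf0]; exact one_pos)))
  refine ⟨q, hq, fun x => ?_⟩
  by_contra! hlt
  obtain ⟨r, h1, h2⟩ := exists_between hlt
  have hr : 0 < r := (apply_nonneg q x).trans_lt h1
  have h3 : f (((r⁻¹ : ℝ) : 𝕜) • x) < 1 := hqf _ (by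
    rw [map_smul_eq_mul, RCLike.norm_ofReal, abs_of_pos (inv_pos.2 hr), inv_mul_lt_iff₀ hr]
    linarith)
  rw [h _ _ (inv_pos.2 hr), inv_mul_lt_iff₀ hr] at h3
  linarith

variable [IsTopologicalAddGroup E] [ContinuousSMul ℝ E] [LocallyConvexSpace ℝ E]

theorem exists_seminorm_add_le {p : Seminorm ℝ E} (hp : Continuous p) :
    ∃ q : Seminorm ℂ (Complexification E), Continuous q ∧ ∀ z, p (re z) + p (im z) ≤ q z := by
  have : PolynormableSpace ℂ (Complexification E) := polynormableSpace_complex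
  refine exists_seminorm_ge ((hp.comp continuous_re).add (hp.comp continuous_im)) ?_ ?_
  · simp
  · intro r z hr
    simp only [re_ofReal_smul, im_ofReal_smul]
    rw [map_smul_eq_mul, map_smul_eq_mul, Real.norm_of_nonneg hr.le, mul_add]

theorem exists_seminorm_le_add {P : Seminorm ℂ (Complexification E)} (hP : Continuous P) :
    ∃ p : Seminorm ℝ E, Continuous p ∧ ∀ z, P z ≤ p (re z) + p (im z) := by
  obtain ⟨p, hp, hpP⟩ := exists_seminorm_ge (𝕜 := ℝ) (f := fun x : E => P (ofReal x))
    (hP.comp continuous_ofReal) (map_zero P) (fun r x hr => by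
      change P (ofReal (r • x)) = _
      rw [ofReal_smul, map_smul_eq_mul, RCLike.norm_ofReal, abs_of_pos hr])
  refine ⟨p, hp, fun z => ?_⟩
  have e : z = ofReal (re z) + Complex.I • ofReal (im z) := by ext <;> simp
  conv_lhs => rw [e]
  refine (map_add_le_add P _ _).trans ?_
  rw [map_smul_eq_mul, Complex.norm_I, one_mul]
  exact add_le_add (hpP _) (hpP _)

theorem isLipschitzCurve_iff {γ : I → Complexification E} : IsLipschitzCurve ℂ γ ↔
    IsLipschitzCurve ℝ (fun t => re (γ t)) ∧ IsLipschitzCurve ℝ (fun t => im (γ t)) := by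
  have : PolynormableSpace ℂ (Complexification E) := polynormableSpace_complex
  rw [CIA.isLipschitzCurve_iff, CIA.isLipschitzCurve_iff, CIA.isLipschitzCurve_iff]
  constructor
  · intro h
    constructor <;>
    · intro p hp
      obtain ⟨q, hq, hpq⟩ := exists_seminorm_add_le hp
      obtain ⟨M, hM⟩ := h q hq
      refine ⟨M, fun s t => le_trans ?_ ((hpq _).trans (hM s t))⟩
      rw [re_sub, im_sub]
      first
      | exact le_add_of_nonneg_right (apply_nonneg p _)
      | exact le_add_of_nonneg_left (apply_nonneg p _)
  · rintro ⟨h1, h2⟩ P hP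
    obtain ⟨p, hp, hpP⟩ := exists_seminorm_le_add hP
    obtain ⟨M, hM⟩ := h1 p hp
    obtain ⟨M', hM'⟩ := h2 p hp
    refine ⟨M + M', fun s t => (hpP _).trans ?_⟩
    rw [add_mul]
    exact add_le_add (hM s t) (hM' s t)

theorem mackeyComplete (hE : MackeyComplete ℝ E) : MackeyComplete ℂ (Complexification E) := by
  intro γ hγ
  obtain ⟨h1, h2⟩ := isLipschitzCurve_iff.1 hγ
  obtain ⟨x, hx⟩ := hE _ h1
  obtain ⟨y, hy⟩ := hE _ h2
  refine ⟨mk x y, fun V hV => ?_⟩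
  obtain ⟨W, hW, W', hW', hWV⟩ := mem_nhds_prod_iff.1
    (show V ∈ 𝓝 ((0, 0) : E × E) from hV)
  obtain ⟨ε, hε, h⟩ := hx W hW
  obtain ⟨ε', hε', h'⟩ := hy W' hW'
  refine ⟨min ε ε', lt_min hε hε', fun n t s ht h0 h1 hs hmesh => hWV ?_⟩
  have k := h n t s ht h0 h1 hs fun i => (hmesh i).trans_le (min_le_left _ _)
  have k' := h' n t s ht h0 h1 hs fun i => (hmesh i).trans_le (min_le_right _ _)
  refine ⟨?_, ?_⟩
  · change re (_ - _) ∈ W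
    simp only [re_sub, re_sum, re_ofReal_smul, re_mk]
    exact k
  · change im (_ - _) ∈ W'
    simp only [im_sub, im_sum, im_ofReal_smul, im_mk]
    exact k'

end Topology

/-! ### The complexification of a continuous inverse algebra -/

section Algebra

variable {A : Type*} [Ring A] [Algebra ℝ A] [TopologicalSpace A] [IsTopologicalRing A]

theorem isUnit_ofReal {a : A} (h : IsUnit a) : IsUnit (ofReal a) := by
  obtain ⟨u, rfl⟩ := h
  refine ⟨⟨ofReal u, ofReal ↑u⁻¹, ?_, ?_⟩, rfl⟩ <;> ext <;> simp

/-- The factors in (1 + ic)(1 - ic) = 1 + c² commute, so both are units if the product is. -/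
theorem isUnit_mk_one {c : A} (h : IsUnit (1 + c * c)) : IsUnit (mk 1 c) := by
  have h1 : mk 1 c * mk 1 (-c) = ofReal (1 + c * c) := by ext <;> simp
  have h2 : mk 1 (-c) * mk 1 c = ofReal (1 + c * c) := by ext <;> simp
  have hc : Commute (mk 1 c) (mk 1 (-c)) := h1.trans h2.symm
  exact (hc.isUnit_mul_iff.1 (h1 ▸ isUnit_ofReal h)).1

/-- Near 1 the real part a of z is a unit and z = a(1 + ic) with c = a⁻¹ im z. Continuity of
inversion at 1 makes c small, so 1 + c² is a unit too. -/
theorem units_mem (hA : HasContinuousInverse A) :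
    {z : Complexification A | IsUnit z} ∈ 𝓝 (1 : Complexification A) := by
  have h1 : ContinuousAt (Ring.inverse : A → A) 1 := hA.2.continuousAt hA.units_mem
  have h2 : Tendsto (re : Complexification A → A) (𝓝 1) (𝓝 (1 : A)) :=
    continuous_re.tendsto 1
  have h3 : Tendsto (im : Complexification A → A) (𝓝 1) (𝓝 (0 : A)) :=
    continuous_im.tendsto 1
  have h4 := (h1.tendsto.comp h2).mul h3
  have h5 := (h4.mul h4).const_add 1
  rw [mul_zero, mul_zero, add_zero] at h5
  filter_upwards [h2 hA.units_mem, h5 hA.units_mem] with z hz hz'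
  have hz : IsUnit (re z) := hz
  have e : z = ofReal (re z) * mk 1 (Ring.inverse (re z) * im z) := by
    ext
    · simp
    · simp [← mul_assoc, Ring.mul_inverse_cancel _ hz]
  have h6 := (isUnit_ofReal hz).mul (isUnit_mk_one hz')
  change IsUnit z
  rw [e]
  exact h6

/-- Expanding a product of n elements a + ib gives 2ⁿ real words, whose weights add up to the
product of the q(a) + q(b). The prefix `u` stores the letters already chosen, so the real bound is
applied only once, to complete words. -/
theorem seminorm_prod_le {p q : Seminorm ℝ A} {C : ℝ} (h : ProdBound p q C)
    (w : List (Complexification A)) (u : List A) :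
    p (u.prod * re w.prod) + p (u.prod * im w.prod) ≤
      C * ((u.map q).prod * (w.map fun z => q (re z) + q (im z)).prod) := by
  induction w generalizing u with
  | nil => simpa using h u
  | cons z w ih =>
    have h1 := ih (u ++ [re z])
    have h2 := ih (u ++ [im z])
    simp only [List.prod_append, List.map_append, List.map_cons, List.map_nil, List.prod_cons,
      List.prod_nil, mul_one] at h1 h2 ⊢
    have e1 : u.prod * re (z * w.prod) =
        u.prod * re z * re w.prod - u.prod * im z * im w.prod := by
      rw [re_mul]; noncomm_ring
    have e2 : u.prod * im (z * w.prod) =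
        u.prod * re z * im w.prod + u.prod * im z * re w.prod := by
      rw [im_mul]; noncomm_ring
    rw [e1, e2]
    have h3 := map_sub_le_add p (u.prod * re z * re w.prod) (u.prod * im z * im w.prod)
    have h4 := map_add_le_add p (u.prod * re z * im w.prod) (u.prod * im z * re w.prod)
    linarith

variable [ContinuousSMul ℝ A] [LocallyConvexSpace ℝ A]

theorem exists_prodBound (hstar : ∀ p : Seminorm ℝ A, Continuous p →
      ∃ q : Seminorm ℝ A, Continuous q ∧ ∃ C : ℝ, ProdBound p q C)
    (P : Seminorm ℂ (Complexification A)) (hP : Continuous P) :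
    ∃ Q : Seminorm ℂ (Complexification A), Continuous Q ∧ ∃ C : ℝ, ProdBound P Q C := by
  obtain ⟨p, hp, hpP⟩ := exists_seminorm_le_add hP
  obtain ⟨q, hq, C, hC⟩ := hstar p hp
  have hC0 : 0 ≤ C := by simpa using (apply_nonneg p _).trans (hC [])
  obtain ⟨Q, hQ, hqQ⟩ := exists_seminorm_add_le hq
  refine ⟨Q, hQ, C, fun w => ?_⟩
  have h1 := seminorm_prod_le hC w []
  simp only [List.prod_nil, one_mul, List.map_nil] at h1
  refine (hpP _).trans (h1.trans ?_)
  refine mul_le_mul_of_nonneg_left ?_ hC0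
  exact List.prod_map_le_prod_map₀ _ _
    (fun z _ => add_nonneg (apply_nonneg q _) (apply_nonneg q _)) fun z _ => hqQ z

end Algebra

/-! ### Curves in the complexification -/

section Curves

variable {E : Type*} [AddCommGroup E] [Module ℝ E]

theorem re_diffQuot (γ : I → Complexification E) (s t : I) :
    re (diffQuot ℂ γ s t) = diffQuot ℝ (fun t => re (γ t)) s t := by
  rw [diffQuot, ← RCLike.ofReal_inv, re_ofReal_smul]
  rfl

theorem im_diffQuot (γ : I → Complexification E) (s t : I) :
    im (diffQuot ℂ γ s t) = diffQuot ℝ (fun t => im (γ t)) s t := by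
  rw [diffQuot, ← RCLike.ofReal_inv, im_ofReal_smul]
  rfl

variable [TopologicalSpace E]

theorem hasCurveDeriv_re {γ δ : I → Complexification E} (h : HasCurveDeriv ℂ γ δ) :
    HasCurveDeriv ℝ (fun t => re (γ t)) (fun t => re (δ t)) := fun t =>
  ((continuous_re.tendsto _).comp (h t)).congr fun s => re_diffQuot γ s t

theorem hasCurveDeriv_im {γ δ : I → Complexification E} (h : HasCurveDeriv ℂ γ δ) :
    HasCurveDeriv ℝ (fun t => im (γ t)) (fun t => im (δ t)) := fun t =>
  ((continuous_im.tendsto _).comp (h t)).congr fun s => im_diffQuot γ s t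

theorem hasCurveDeriv_ofReal {γ δ : I → E} (h : HasCurveDeriv ℝ γ δ) :
    HasCurveDeriv ℂ (fun t => ofReal (γ t)) (fun t => ofReal (δ t)) := fun t =>
  ((continuous_ofReal.tendsto _).comp (h t)).congr fun s => by
    ext
    · rw [re_diffQuot]
      rfl
    · rw [im_diffQuot]
      simp [diffQuot]

/-- The curve of real parts. -/
def reCurve (γ : C(I, Complexification E)) : C(I, E) := (⟨re, continuous_re⟩ : C(_, E)).comp γ

/-- The curve of imaginary parts. -/
def imCurve (γ : C(I, Complexification E)) : C(I, E) := (⟨im, continuous_im⟩ : C(_, E)).comp γ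

/-- The curve with given real and imaginary parts. -/
def mkCurve (γ δ : C(I, E)) : C(I, Complexification E) :=
  ⟨fun t => mk (γ t) (δ t), continuous_mk γ.continuous δ.continuous⟩

@[simp] theorem mkCurve_apply (γ δ : C(I, E)) (t : I) : mkCurve γ δ t = mk (γ t) (δ t) := rfl

theorem continuous_reCurve :
    Continuous (reCurve : C(I, Complexification E) → C(I, E)) :=
  ContinuousMap.continuous_postcomp _

theorem continuous_imCurve :
    Continuous (imCurve : C(I, Complexification E) → C(I, E)) :=
  ContinuousMap.continuous_postcomp _

theorem continuous_mkCurve :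
    Continuous fun z : C(I, E) × C(I, E) => mkCurve z.1 z.2 := by
  refine ContinuousMap.continuous_of_continuous_uncurry _ ?_
  exact continuous_mk
    (ContinuousEval.continuous_eval.comp
      ((continuous_fst.comp continuous_fst).prodMk continuous_snd))
    (ContinuousEval.continuous_eval.comp
      ((continuous_snd.comp continuous_fst).prodMk continuous_snd))

variable [IsTopologicalAddGroup E] [ContinuousSMul ℝ E]

variable {X : Type*} [AddCommGroup X] [Module ℝ X] (c : X →ₗ[ℝ] C(I, E))

/-- The complexification of a real linear map into a space of curves. -/
def curveMap : Complexification X →ₗ[ℂ] C(I, Complexification E) where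
  toFun x := mkCurve (c (re x)) (c (im x))
  map_add' x y := by
    ext t <;> simp
  map_smul' r x := by
    ext t <;> simp

@[simp] theorem curveMap_apply (x : Complexification X) :
    curveMap c x = mkCurve (c (re x)) (c (im x)) := rfl

theorem continuous_curveMap [TopologicalSpace X] (hc : Continuous c) :
    Continuous (curveMap c) :=
  continuous_mkCurve.comp ((hc.comp continuous_re).prodMk (hc.comp continuous_im))

variable [T2Space E]

/-- The real part of a `C¹`-curve. -/
def reSpace (γ : CrSpace ℂ (Complexification E) 1) : CrSpace ℝ E 1 :=
  CrSpace.mk₁ (reCurve γ.toCurve) (reCurve (curveDeriv ℂ γ.toCurve))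
    (hasCurveDeriv_re (γ.hasCurveDeriv le_rfl))

/-- The imaginary part of a `C¹`-curve. -/
def imSpace (γ : CrSpace ℂ (Complexification E) 1) : CrSpace ℝ E 1 :=
  CrSpace.mk₁ (imCurve γ.toCurve) (imCurve (curveDeriv ℂ γ.toCurve))
    (hasCurveDeriv_im (γ.hasCurveDeriv le_rfl))

theorem continuous_reSpace :
    Continuous (reSpace : CrSpace ℂ (Complexification E) 1 → CrSpace ℝ E 1) := by
  have e : ∀ γ : CrSpace ℂ (Complexification E) 1,
      curveDeriv ℝ (reSpace γ).toCurve = reCurve (curveDeriv ℂ γ.toCurve) := fun γ =>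
    HasCurveDeriv.curveDeriv_eq (hasCurveDeriv_re (γ.hasCurveDeriv le_rfl))
  refine continuous_iff_continuousAt.2 fun γ => CrSpace.tendsto_nhds ?_ ?_
  · exact (continuous_reCurve.comp CrCurve.continuous_toCurve).tendsto γ
  · simp only [e]
    exact (continuous_reCurve.comp CrSpace.continuous_curveDeriv).tendsto γ

theorem continuous_imSpace :
    Continuous (imSpace : CrSpace ℂ (Complexification E) 1 → CrSpace ℝ E 1) := by
  have e : ∀ γ : CrSpace ℂ (Complexification E) 1,
      curveDeriv ℝ (imSpace γ).toCurve = imCurve (curveDeriv ℂ γ.toCurve) := fun γ =>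
    HasCurveDeriv.curveDeriv_eq (hasCurveDeriv_im (γ.hasCurveDeriv le_rfl))
  refine continuous_iff_continuousAt.2 fun γ => CrSpace.tendsto_nhds ?_ ?_
  · exact (continuous_imCurve.comp CrCurve.continuous_toCurve).tendsto γ
  · simp only [e]
    exact (continuous_imCurve.comp CrSpace.continuous_curveDeriv).tendsto γ

variable (E) in
/-- A `C¹`-curve in the complexification is a pair of `C¹`-curves. -/
def splitSpace : CrSpace ℂ (Complexification E) 1 →L[ℂ] Complexification (CrSpace ℝ E 1) where
  toFun γ := mk (reSpace γ) (imSpace γ)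
  map_add' _ _ := rfl
  map_smul' _ _ := rfl
  cont := continuous_mk continuous_reSpace continuous_imSpace

end Curves

end Complexification

open Complexification

/-! ### Real analyticity by extension to the complexification. -/

section RealAnalytic

variable {A : Type*} [Ring A] [Algebra ℝ A] [TopologicalSpace A] [IsTopologicalRing A]
  [ContinuousSMul ℝ A] [LocallyConvexSpace ℝ A] [T2Space A] {L : Submodule ℝ C(I, A)}
  {L' : Submodule ℂ C(I, Complexification A)}
  {X : Type*} [AddCommGroup X] [Module ℝ X] [TopologicalSpace X] {c : X →ₗ[ℝ] C(I, A)}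

/-- The extension is the evolution map of the complexified algebra, defined on all of the
complexified space. On real curves the embedded real evolution solves the same equation, so
uniqueness identifies the two. -/
theorem IsPicardSpace.isRealAnalyticOn_evolMap (hL : IsPicardSpace L)
    (hL' : IsPicardSpace L') (hc : Continuous c) (hcL : ∀ x, c x ∈ L)
    (hcL' : ∀ x, curveMap c x ∈ L') : IsRealAnalyticOn (hL.evolMap hcL) Set.univ := by
  have : PolynormableSpace ℂ (Complexification A) := polynormableSpace_complex
  refine ⟨Set.univ, fun x => splitSpace A (hL'.evolMap hcL' x), isOpen_univ,
    (hL'.isComplexAnalyticOn_evolMap (continuous_curveMap c hc) hcL').continuousLinearMap_comp _,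
    fun x _ => ⟨trivial, ?_⟩⟩
  obtain ⟨h0, h1⟩ := hL.evol_spec (hcL x)
  have key : mkCurve (evol ℝ (c x)) 0 = evol ℂ (curveMap c (ofReal x)) := by
    refine hL'.evol_unique (hcL' _) ?_ ?_
    · have h2 := hasCurveDeriv_ofReal h1
      have e : (⇑(mkCurve (evol ℝ (c x)) 0 * curveMap c (ofReal x)) : I → Complexification A) =
          fun t => ofReal ((evol ℝ (c x) * c x) t) := by
        funext t
        ext <;> simp
      rw [e]
      exact h2
    · rw [mkCurve_apply, h0]
      rfl
  ext
  · refine CrCurve.toCurve_injective ?_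
    change reCurve (evol ℂ (curveMap c (ofReal x))) = evol ℝ (c x)
    rw [← key]
    rfl
  · refine CrCurve.toCurve_injective ?_
    change imCurve (evol ℂ (curveMap c (ofReal x))) = 0
    rw [← key]
    rfl

theorem SequentiallyComplete.isRealAnalyticOn_evolMap (hA : HasContinuousInverse A)
    (hstar : ConditionStar ℝ A) (hE : SequentiallyComplete A)
    (hL : IsPicardSpace (⊤ : Submodule ℝ C(I, A))) (hc : Continuous c)
    (hcL : ∀ x, c x ∈ (⊤ : Submodule ℝ C(I, A))) :
    IsRealAnalyticOn (hL.evolMap hcL) Set.univ := by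
  have : PolynormableSpace ℂ (Complexification A) := polynormableSpace_complex
  exact hL.isRealAnalyticOn_evolMap ((Complexification.sequentiallyComplete hE).isPicardSpace
    (exists_prodBound hstar.exists_prodBound) (units_mem hA)) hc hcL fun _ => trivial

theorem MackeyComplete.isRealAnalyticOn_evolMap (hA : HasContinuousInverse A)
    (hstar : ConditionStar ℝ A) (hE : MackeyComplete ℝ A)
    (hL : IsPicardSpace (lipSubmodule ℝ A)) (hc : Continuous c)
    (hcL : ∀ x, c x ∈ lipSubmodule ℝ A) :
    IsRealAnalyticOn (hL.evolMap hcL) Set.univ := by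
  have : PolynormableSpace ℂ (Complexification A) := polynormableSpace_complex
  exact hL.isRealAnalyticOn_evolMap ((Complexification.mackeyComplete hE).isPicardSpace
    (exists_prodBound hstar.exists_prodBound) (units_mem hA)) hc hcL fun x =>
      Complexification.isLipschitzCurve_iff.2 ⟨hcL (re x), hcL (im x)⟩

end RealAnalytic

end CIA

end

/-! ### Assembly of both parts over ℝ and over ℂ. -/

theorem mainTheorem3 :
    (∀ (A : Type*) [Ring A] [Algebra ℝ A] [TopologicalSpace A] [IsTopologicalRing A]
        [ContinuousSMul ℝ A] [LocallyConvexSpace ℝ A] [T2Space A],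
      CIA.HasContinuousInverse A → CIA.ConditionStar ℝ A →
      (CIA.SequentiallyComplete A →
        CIA.UnitsStronglyRegular ℝ A 0 ∧
        ∃ Evol : CIA.CrSpace ℝ A 0 → CIA.CrSpace ℝ A 1,
          CIA.IsEvolutionMap CIA.CrCurve.toCurve Evol ∧
          CIA.IsRealAnalyticOn Evol Set.univ) ∧
      (CIA.MackeyComplete ℝ A →
        CIA.UnitsRegular ℝ A 0 ∧ CIA.UnitsStronglyRegular ℝ A 1 ∧
        ∃ Evol : CIA.lipSubmodule ℝ A → CIA.CrSpace ℝ A 1,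
          CIA.IsEvolutionMap Subtype.val Evol ∧
          CIA.IsRealAnalyticOn Evol Set.univ)) ∧
    (∀ (A : Type*) [Ring A] [Algebra ℂ A] [TopologicalSpace A] [IsTopologicalRing A]
        [ContinuousSMul ℂ A] [LocallyConvexSpace ℝ A] [T2Space A],
      CIA.HasContinuousInverse A → CIA.ConditionStar ℂ A →
      (CIA.SequentiallyComplete A →
        CIA.UnitsStronglyRegular ℂ A 0 ∧
        ∃ Evol : CIA.CrSpace ℂ A 0 → CIA.CrSpace ℂ A 1,
          CIA.IsEvolutionMap CIA.CrCurve.toCurve Evol ∧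
          CIA.IsComplexAnalyticOn Evol Set.univ) ∧
      (CIA.MackeyComplete ℂ A →
        CIA.UnitsRegular ℂ A 0 ∧ CIA.UnitsStronglyRegular ℂ A 1 ∧
        ∃ Evol : CIA.lipSubmodule ℂ A → CIA.CrSpace ℂ A 1,
          CIA.IsEvolutionMap Subtype.val Evol ∧
          CIA.IsComplexAnalyticOn Evol Set.univ)) := by
  constructor
  · intro A _ _ _ _ _ _ _ hA hstar
    refine ⟨fun hE => ?_, fun hE => ?_⟩
    · have hL := hE.isPicardSpace (𝕜 := ℝ) hstar.exists_prodBound hA.units_mem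
      have hc : Continuous (CIA.CrCurve.toCurveLinear ℝ A 0 0) := CIA.CrCurve.continuous_toCurve
      exact ⟨CIA.SequentiallyComplete.unitsStronglyRegular hL, hL.evolMap fun _ => trivial,
        hL.isEvolutionMap_evolMap (c := CIA.CrCurve.toCurveLinear ℝ A 0 0) _,
        hE.isRealAnalyticOn_evolMap hA hstar hL hc _⟩
    · have hL := hE.isPicardSpace hstar.exists_prodBound hA.units_mem
      exact ⟨CIA.MackeyComplete.unitsRegular hL, CIA.MackeyComplete.unitsStronglyRegular hL,
        hL.evolMap (c := (CIA.lipSubmodule ℝ A).subtype) fun γ => γ.2,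
        hL.isEvolutionMap_evolMap (c := (CIA.lipSubmodule ℝ A).subtype) _,
        hE.isRealAnalyticOn_evolMap hA hstar hL continuous_subtype_val _⟩
  · intro A _ _ _ _ _ _ _ hA hstar
    have : PolynormableSpace ℂ A := CIA.polynormableSpace_complex
    refine ⟨fun hE => ?_, fun hE => ?_⟩
    · have hL := hE.isPicardSpace (𝕜 := ℂ) hstar.exists_prodBound hA.units_mem
      have hc : Continuous (CIA.CrCurve.toCurveLinear ℂ A 0 0) := CIA.CrCurve.continuous_toCurve
      exact ⟨CIA.SequentiallyComplete.unitsStronglyRegular hL, hL.evolMap fun _ => trivial,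
        hL.isEvolutionMap_evolMap (c := CIA.CrCurve.toCurveLinear ℂ A 0 0) _,
        hL.isComplexAnalyticOn_evolMap hc _⟩
    · have hL := hE.isPicardSpace hstar.exists_prodBound hA.units_mem
      exact ⟨CIA.MackeyComplete.unitsRegular hL, CIA.MackeyComplete.unitsStronglyRegular hL,
        hL.evolMap (c := (CIA.lipSubmodule ℂ A).subtype) fun γ => γ.2,
        hL.isEvolutionMap_evolMap (c := (CIA.lipSubmodule ℂ A).subtype) _,
        hL.isComplexAnalyticOn_evolMap continuous_subtype_val _⟩
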